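/- Let $\mathbb T=\mathbb R/\mathbb Z$ and let $q\in L^2(\mathbb T,\mathbb R)$ be a real potential with mean value $\int_{\mathbb T} q\,dx=0$; write $\|q\|_0=(\int_{\mathbb T}q^2\,dx)^{1/2}$. Let $$\lambda_0^+<\lambda_1^-\le\lambda_1^+<\lambda_2^-\le\lambda_2^+<\cdots$$ be the eigenvalues, counted with multiplicity, of $-\frac{d^2}{dx^2}+q$ on $[0,2]$ with periodic boundary conditions. Let $\Delta(\lambda)=y_1(1,\lambda)+y_2'(1,\lambda)$ be the discriminant, where $y_1,y_2$ are the solutions of $-y''+qy=\lambda y$ with $y_1(0)=y_2'(0)=1$, $y_1'(0)=y_2(0)=0$, and let $\Delta^{\bullet}=\partial_\lambda\Delta$. With $\tau_k=(\lambda_k^-+\lambda_k^+)/2$, $\gamma_k=\lambda_k^+-\lambda_k^-$ and $\sqrt[+]{\phantom{x}}$ the principal square root, put $$\varsigma_k(\lambda)=(\tau_k-\lambda)\sqrt[+]{1-\frac{\gamma_k^2}{4(\tau_k-\lambda)^2}},\qquad \sqrt[c]{\Delta^2(\lambda)-4}=-2\mathrm i\,\sqrt[+]{\lambda-\lambda_0^+}\prod_{k\ge1}\frac{\varsigma_k(\lambda)}{k^2\pi^2}.$$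 For $n\ge1$ and $m\ge0$ define $$I_n=\frac1\pi\int_{\Gamma_n}\frac{\lambda\,\Delta^{\bullet}(\lambda)}{\sqrt[c]{\Delta^2(\lambda)-4}}\,d\lambda,\qquad J_{n,m}=\frac1{(m+1)\pi}\int_{\Gamma_n}\frac{\lambda^{m+1}\Delta^{\bullet}(\lambda)}{\sqrt[c]{\Delta^2(\lambda)-4}}\,d\lambda,$$ where $\Gamma_n$ is the counterclockwise circle with centre $\tau_n$ and radius $\frac{\gamma_n}2+\frac12\min(\lambda_n^--\lambda_{n-1}^+,\ \lambda_{n+1}^--\lambda_n^+)$ (a circuit around $[\lambda_n^-,\lambda_n^+]$ that neither meets nor encloses a point of $(-\infty,\lambda_0^+]$ or of another interval $[\lambda_k^-,\lambda_k^+]$). Then for all $n\ge1$ and $m\ge0$ the numbers $I_n$ and $J_{n,m}$ are real. If $n\ge4\|q\|_0$, then $$2^{-m}(n\pi)^{2m}I_n\le J_{n,m}\le2^m(n\pi)^{2m}I_n,$$ and if $1\le n<4\|q\|_0$, then $$-5^m\|q\|_0^{2m}I_n\le J_{n,m}\le256^m\|q\|_0^{2m}I_n.$$ -/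

import Mathlib

open MeasureTheory

noncomputable section

/-- Real potentials in `L²(𝕋)`, `𝕋 = ℝ/ℤ` with Lebesgue measure (of total mass one).
Its norm is `‖q‖₀`. -/
abbrev Potential : Type := Lp ℝ 2 (volume : Measure UnitAddCircle)

/-- `y` is a solution on `ℝ` of `-y'' + q y = lam y`, in the sense that `y` is differentiable and
`y'` is the locally absolutely continuous function with `y'' = (q - lam) y` almost everywhere.
(The `1`-periodic extension of `q` is `t ↦ q (t : UnitAddCircle)`.) -/
def IsHillSolution (q : Potential) (lam : ℂ) (y : ℝ → ℂ) : Prop :=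
  Differentiable ℝ y ∧
    ∀ x : ℝ, deriv y x = deriv y 0 + ∫ t in (0 : ℝ)..x, ((q (t : UnitAddCircle) : ℂ) - lam) * y t

/-- The solution of `-y'' + q y = lam y` with `y(0) = a`, `y'(0) = b`. -/
def hillSolution (q : Potential) (lam a b : ℂ) : ℝ → ℂ :=
  Classical.epsilon fun y => IsHillSolution q lam y ∧ y 0 = a ∧ deriv y 0 = b

/-- The discriminant `Δ(lam) = y₁(1, lam) + y₂'(1, lam)`. -/
def discriminant (q : Potential) (lam : ℂ) : ℂ :=
  hillSolution q lam 1 0 1 + deriv (hillSolution q lam 0 1) 1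

/-- The eigenfunctions (and zero) for `lam` of `-d²/dx² + q` on `[0,2]` with periodic boundary
conditions, each extended to a `2`-periodic function on `ℝ`. -/
def periodicSolutions (q : Potential) (lam : ℂ) : Set (ℝ → ℂ) :=
  {y | IsHillSolution q lam y ∧ Function.Periodic y 2}

/-- `μ` lists the periodic spectrum of `q` in nondecreasing order and with multiplicities. -/
def IsPeriodicSpectrum (q : Potential) (μ : ℕ → ℝ) : Prop :=
  Monotone μ ∧
    ∀ lam : ℂ, {k : ℕ | (μ k : ℂ) = lam}.encard = (Set.finrank ℂ (periodicSolutions q lam) : ℕ∞)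

/-- The periodic spectrum of `q`, listed as
`λ₀⁺ < λ₁⁻ ≤ λ₁⁺ < λ₂⁻ ≤ λ₂⁺ < ⋯` (real, since `q` is real). -/
def periodicSpectrum (q : Potential) : ℕ → ℝ :=
  Classical.epsilon (IsPeriodicSpectrum q)

/-- `λₙ⁺`, for `n ≥ 0`. -/
def eigPlus (q : Potential) (n : ℕ) : ℝ := periodicSpectrum q (2 * n)

/-- `λₙ⁻`, for `n ≥ 1`. -/
def eigMinus (q : Potential) (n : ℕ) : ℝ := periodicSpectrum q (2 * n - 1)

/-- The gap length `γₙ = λₙ⁺ - λₙ⁻`, for `n ≥ 1`. -/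
def gapLength (q : Potential) (n : ℕ) : ℝ := eigPlus q n - eigMinus q n

/-- The midpoint `τₙ = (λₙ⁻ + λₙ⁺) / 2` of the gap, for `n ≥ 1`. -/
def gapMid (q : Potential) (n : ℕ) : ℝ := (eigMinus q n + eigPlus q n) / 2

/-- The principal branch of the square root. -/
def principalRoot (z : ℂ) : ℂ := z ^ (1 / 2 : ℂ)

/-- The standard root of `(λₙ⁺ - lam) (λₙ⁻ - lam)`, for `n ≥ 1` and `lam` off the gap
`[λₙ⁻, λₙ⁺]`. -/
def standardRoot (q : Potential) (n : ℕ) (lam : ℂ) : ℂ :=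
  ((gapMid q n : ℂ) - lam) *
    principalRoot (1 - (gapLength q n : ℂ) ^ 2 / (4 * ((gapMid q n : ℂ) - lam) ^ 2))

/-- The canonical root of `Δ(lam)² - 4`. The factor with index `k` of the infinite product belongs
to the gap number `k + 1`. -/
def canonicalRoot (q : Potential) (lam : ℂ) : ℂ :=
  -2 * Complex.I * principalRoot (lam - (eigPlus q 0 : ℂ)) *
    ∏' k : ℕ, standardRoot q (k + 1) lam / (((k + 1 : ℕ) : ℂ) ^ 2 * (Real.pi : ℂ) ^ 2)

/-- The radius of the circuit `Γₙ`, `n ≥ 1`. The circle with this radius around `τₙ` encloses the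
gap `[λₙ⁻, λₙ⁺]` and goes half-way to the nearer one of the neighbouring gaps. -/
def circuitRadius (q : Potential) (n : ℕ) : ℝ :=
  gapLength q n / 2 +
    min (eigMinus q n - eigPlus q (n - 1)) (eigMinus q (n + 1) - eigPlus q n) / 2

/-- The `n`-th KdV action variable on level `m`, for `n ≥ 1`,
`J_{n,m} = 1 / ((m+1) π) ∫_{Γₙ} lam^(m+1) Δ'(lam) / √(Δ(lam)² - 4) d lam`,
with the canonical root and the circuit `Γₙ` traversed counterclockwise. -/
def actionJ (q : Potential) (n m : ℕ) : ℂ :=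
  1 / (((m : ℂ) + 1) * (Real.pi : ℂ)) *
    ∮ z in C((gapMid q n : ℂ), circuitRadius q n),
      z ^ (m + 1) * deriv (discriminant q) z / canonicalRoot q z

/-- The `n`-th KdV action variable, for `n ≥ 1`,
`I_n = 1 / π ∫_{Γₙ} lam Δ'(lam) / √(Δ(lam)² - 4) d lam`. -/
def actionI (q : Potential) (n : ℕ) : ℂ :=
  1 / (Real.pi : ℂ) *
    ∮ z in C((gapMid q n : ℂ), circuitRadius q n),
      z * deriv (discriminant q) z / canonicalRoot q z

end

/-!
The actions of all levels are moments of one and the same nonnegative density, supported on the gap: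
`J_{n,m} = ∫ λ ^ m k`, with a density `k ≥ 0` on `[λₙ⁻, λₙ⁺]` that does not depend on `m`. Hence all of
them are real, `I_n = J_{n,0} = ∫ k`, and `J_{n,m} / I_n` lies between the bounds of `λ ^ m` on the gap.
The bounds claimed then follow from the localization of the gaps: `λₙ⁻ ≥ (nπ)² / 2` and
`λₙ⁺ ≤ 2 (nπ)²` if `n ≥ 4 ‖q‖`, and `-5 ‖q‖² ≤ λₙ⁻`, `λₙ⁺ ≤ 256 ‖q‖²` otherwise.

The density (`exists_density`). Inside the circuit the canonical root is the standard root of the gap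
times a function without zeros, and the reciprocal of the standard root is an average of Cauchy kernels
with poles in the gap. Cauchy's formula turns the contour integral into an integral over the gap
(`circleIntegral_div_root`). There `Δ' / √(Δ² - 4)` is up to sign the derivative of `arcosh (|Δ| / 2)`,
which vanishes at the ends of the gap, so an integration by parts (`integral_pow_mul_deriv_div`) leaves
`λ ^ m` against the nonnegative function `arcosh (|Δ| / 2)`. That the square of the canonical root is a
constant multiple of `Δ² - 4` is the product formula `SpectrumData.exists_product_formula`. The constant
enters all the actions alike and need not be known; it suffices that it is positive.

The spectrum. The periodic spectrum is defined by dimensions of spaces of solutions, and it is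
identified with the points where `Δ = ±2` (`exists_spectrumData_periodicSpectrum`). Inside the bands the
derivative of `Δ` is the integral of a definite quadratic form, so it has no zeros
(`deriv_hillDisc_ne_zero`), and at a critical point with `Δ = ±2` the monodromy is scalar
(`monodromy_scalar_of_deriv_eq_zero`). This gives the alternation of bands and gaps. The zeros of `Δ` are
simple, so along the homotopy from the zero potential to `q` their number below a point that none of
them crosses is constant (`ncard_hillDisc_zeros`); together with the estimate of `Δ(ν²) - 2 cos ν` this
enumerates and localizes the gaps. The lower bound of the spectrum comes from the energy identity
(`real_of_hillDisc_sq`). For the product formula the quotient of `Δ² - 4` and the product over the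
eigenvalues is entire, and it is bounded on large circles by comparison with Euler's product for the
sine.
-/

section

open Set Filter Topology

/-! ### Calculus of primitives of locally integrable functions -/

section Primitive

variable {E : Type*} [NormedAddCommGroup E] [NormedSpace ℝ E]

/-- `F` is a primitive of the locally integrable function `f`; in other words `F` is locally
absolutely continuous with derivative `f` almost everywhere. -/
structure IsPrim (f F : ℝ → E) : Prop where
  int : ∀ a b : ℝ, IntervalIntegrable f volume a b
  eq : ∀ x : ℝ, F x = F 0 + ∫ t in (0 : ℝ)..x, f t

namespace IsPrim

variable {f F g G : ℝ → E}

lemma sub_eq (h : IsPrim f F) (a b : ℝ) : F b - F a = ∫ t in a..b, f t := by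
  rw [h.eq a, h.eq b, ← intervalIntegral.integral_interval_sub_left (h.int 0 b) (h.int 0 a)]
  abel

lemma continuous (h : IsPrim f F) : Continuous F := by
  have : F = fun x => F 0 + ∫ t in (0 : ℝ)..x, f t := funext h.eq
  rw [this]
  exact continuous_const.add (intervalIntegral.continuous_primitive h.int 0)

lemma ac (h : IsPrim f F) (a b : ℝ) : AbsolutelyContinuousOnInterval F a b := by
  have hn := ((h.int a b).norm.absolutelyContinuousOnInterval_intervalIntegral
    (left_mem_uIcc (a := a) (b := b)))
  refine squeeze_zero (fun _ => Finset.sum_nonneg fun _ _ => dist_nonneg) (fun E => ?_) hn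
  refine Finset.sum_le_sum fun i _ => ?_
  have hi : ∀ u v : ℝ, IntervalIntegrable (fun t => ‖f t‖) volume u v := fun u v => (h.int u v).norm
  rw [dist_comm, dist_eq_norm, h.sub_eq, dist_comm, Real.dist_eq,
    intervalIntegral.integral_interval_sub_left (hi _ _) (hi _ _)]
  exact intervalIntegral.norm_integral_le_abs_integral_norm

lemma ae_hasDerivAt [CompleteSpace E] (h : IsPrim f F) : ∀ᵐ x, HasDerivAt F (f x) x := by
  have h1 : ∀ᵐ x : ℝ, ∀ N : ℕ, x ∈ uIcc (-(N : ℝ)) N → ∀ c ∈ uIcc (-(N : ℝ)) N,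
      HasDerivAt (fun x => ∫ t in c..x, f t) (f x) x :=
    ae_all_iff.2 fun N => (h.int (-(N : ℝ)) N).ae_hasDerivAt_integral
  filter_upwards [h1] with x hx
  obtain ⟨N, hN⟩ := exists_nat_ge |x|
  have hN0 : (0 : ℝ) ≤ N := (abs_nonneg x).trans hN
  have hle : -(N : ℝ) ≤ N := by linarith
  have := hx N (by rw [uIcc_of_le hle]; exact ⟨by linarith [neg_abs_le x], by linarith [le_abs_self x]⟩)
    0 (by rw [uIcc_of_le hle]; exact ⟨by linarith, hN0⟩)
  have hF : F = fun x => F 0 + ∫ t in (0 : ℝ)..x, f t := funext h.eq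
  rw [hF]
  exact this.const_add _

/-- The fundamental theorem of calculus for absolutely continuous functions. -/
lemma of_ac [CompleteSpace E] (hF : ∀ a b, AbsolutelyContinuousOnInterval F a b)
    (hf : ∀ a b : ℝ, IntervalIntegrable f volume a b) (hd : ∀ᵐ x, HasDerivAt F (f x) x) :
    IsPrim f F := by
  refine ⟨hf, fun x => ?_⟩
  have hG : IsPrim f (fun x => ∫ t in (0 : ℝ)..x, f t) := ⟨hf, fun x => by simp⟩
  obtain ⟨C, hC⟩ := ((hF 0 x).sub (hG.ac 0 x)).const_of_ae_hasDerivAt_zero (by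
    filter_upwards [hd, hG.ae_hasDerivAt] with y h1 h2 _
    simpa using h1.sub h2)
  have h0 := hC 0 left_mem_uIcc
  have hx := hC x right_mem_uIcc
  simp only [Pi.sub_apply, intervalIntegral.integral_same, sub_zero] at h0 hx
  rw [h0, ← hx]; abel

lemma add (hf : IsPrim f F) (hg : IsPrim g G) :
    IsPrim (fun x => f x + g x) (fun x => F x + G x) := by
  refine ⟨fun a b => (hf.int a b).add (hg.int a b), fun x => ?_⟩
  rw [intervalIntegral.integral_add (hf.int _ _) (hg.int _ _), hf.eq x, hg.eq x]; abel

lemma sub (hf : IsPrim f F) (hg : IsPrim g G) :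
    IsPrim (fun x => f x - g x) (fun x => F x - G x) := by
  refine ⟨fun a b => (hf.int a b).sub (hg.int a b), fun x => ?_⟩
  rw [intervalIntegral.integral_sub (hf.int _ _) (hg.int _ _), hf.eq x, hg.eq x]; abel

lemma clm [CompleteSpace E] {E' : Type*} [NormedAddCommGroup E'] [NormedSpace ℝ E']
    [CompleteSpace E'] (L : E →L[ℝ] E') (hf : IsPrim f F) :
    IsPrim (fun x => L (f x)) (fun x => L (F x)) := by
  refine ⟨fun a b => ⟨L.integrable_comp (hf.int a b).1, L.integrable_comp (hf.int a b).2⟩,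
    fun x => ?_⟩
  rw [L.intervalIntegral_comp_comm (hf.int 0 x), ← map_add, ← hf.eq x]

lemma prodMk [CompleteSpace E] {E' : Type*} [NormedAddCommGroup E'] [NormedSpace ℝ E']
    [CompleteSpace E'] {g G : ℝ → E'} (hf : IsPrim f F) (hg : IsPrim g G) :
    IsPrim (fun x => (f x, g x)) (fun x => (F x, G x)) := by
  have h1 := hf.clm (ContinuousLinearMap.inl ℝ E E')
  have h2 := hg.clm (ContinuousLinearMap.inr ℝ E E')
  simpa using h1.add h2

lemma of_hasDerivAt [CompleteSpace E] (hd : ∀ x, HasDerivAt F (f x) x) (hc : Continuous f) :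
    IsPrim f F := by
  refine ⟨fun a b => hc.intervalIntegrable a b, fun x => ?_⟩
  rw [intervalIntegral.integral_eq_sub_of_hasDerivAt (fun y _ => hd y) (hc.intervalIntegrable _ _)]
  abel

lemma mul {𝕜 : Type*} [RCLike 𝕜] {f F g G : ℝ → 𝕜} (hf : IsPrim f F) (hg : IsPrim g G) :
    IsPrim (fun x => f x * G x + F x * g x) (fun x => F x * G x) := by
  refine of_ac (fun a b => (hf.ac a b).smul (hg.ac a b)) (fun a b => ?_) ?_
  · exact ((hf.int a b).mul_continuousOn hg.continuous.continuousOn).add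
      ((hg.int a b).continuousOn_mul hf.continuous.continuousOn)
  · filter_upwards [hf.ae_hasDerivAt, hg.ae_hasDerivAt] with x h1 h2
    exact h1.mul h2

/-- The chain rule for a continuously differentiable function of a primitive. On a compact interval
the outer function is Lipschitz, so the composition is absolutely continuous. -/
lemma comp {w W : ℝ → ℝ} (hw : IsPrim w W) {φ φ' : ℝ → ℝ} (hφ : ∀ x, HasDerivAt φ (φ' x) x)
    (hφ' : Continuous φ') : IsPrim (fun x => φ' (W x) * w x) (fun x => φ (W x)) := by
  refine of_ac (fun a b => ?_) (fun a b => ?_) ?_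
  · have hcpt : IsCompact (W '' uIcc a b) := isCompact_uIcc.image hw.continuous
    obtain ⟨R, hR⟩ := hcpt.isBounded.subset_closedBall 0
    obtain ⟨K, hK⟩ : ∃ K, LipschitzOnWith K φ (Metric.closedBall (0 : ℝ) R) := by
      have hφC : ContDiff ℝ 1 φ := by
        rw [contDiff_one_iff_deriv]
        exact ⟨fun x => (hφ x).differentiableAt, by
          rw [show deriv φ = φ' from funext fun x => (hφ x).deriv]; exact hφ'⟩
      exact hφC.contDiffOn.exists_lipschitzOnWith (by decide) (convex_closedBall _ _)
        (isCompact_closedBall _ _)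
    have h2 : Tendsto (fun E : ℕ × (ℕ → ℝ × ℝ) => (K : ℝ) * ∑ i ∈ Finset.range E.1,
        dist (W (E.2 i).1) (W (E.2 i).2))
        (AbsolutelyContinuousOnInterval.totalLengthFilter ⊓
          𝓟 (AbsolutelyContinuousOnInterval.disjWithin a b)) (𝓝 0) := by
      simpa using Tendsto.const_mul (K : ℝ) (show Tendsto _ _ _ from hw.ac a b)
    refine squeeze_zero' (Eventually.of_forall fun _ => Finset.sum_nonneg fun _ _ => dist_nonneg)
      ?_ h2
    have hmem : ∀ᶠ E in AbsolutelyContinuousOnInterval.totalLengthFilter ⊓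
          𝓟 (AbsolutelyContinuousOnInterval.disjWithin a b),
          E ∈ AbsolutelyContinuousOnInterval.disjWithin a b :=
      eventually_inf_principal.2 (by simp)
    filter_upwards [hmem] with E hE
    rw [Finset.mul_sum]
    refine Finset.sum_le_sum fun i hi => ?_
    exact hK.dist_le_mul _ (hR ⟨_, (hE.1 i hi).1, rfl⟩) _ (hR ⟨_, (hE.1 i hi).2, rfl⟩)
  · exact (hw.int a b).continuousOn_mul (hφ'.comp hw.continuous).continuousOn
  · filter_upwards [hw.ae_hasDerivAt] with x hx
    exact (hφ _).comp x hx

end IsPrim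

end Primitive

/-- Grönwall's inequality with an integrable rate `w`: the right-hand side `N` of the hypothesis
makes `N exp (-∫ w)` nonincreasing. -/
lemma gronwall_right {n w : ℝ → ℝ} {c X : ℝ} (hn : Continuous n)
    (hw : ∀ a b : ℝ, IntervalIntegrable w volume a b) (hw0 : ∀ x, 0 ≤ w x)
    (h : ∀ x ∈ Icc 0 X, n x ≤ c + ∫ t in (0 : ℝ)..x, w t * n t) :
    ∀ x ∈ Icc 0 X, n x ≤ c * Real.exp (∫ t in (0 : ℝ)..x, w t) := by
  intro x hx
  set W : ℝ → ℝ := fun x => ∫ t in (0 : ℝ)..x, w t with hW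
  have hWp : IsPrim w W := ⟨hw, fun x => by simp [hW]⟩
  set N : ℝ → ℝ := fun x => c + ∫ t in (0 : ℝ)..x, w t * n t with hN
  have hNp : IsPrim (fun t => w t * n t) N :=
    ⟨fun a b => (hw a b).mul_continuousOn hn.continuousOn, fun x => by simp [hN]⟩
  have hE : IsPrim (fun x => -Real.exp (-W x) * w x) (fun x => Real.exp (-W x)) := by
    refine hWp.comp (φ := fun y => Real.exp (-y)) (φ' := fun y => -Real.exp (-y)) (fun y => ?_)
      (by fun_prop)
    simpa using (hasDerivAt_neg y).exp
  have hP := hNp.mul hE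
  have h1 := hP.sub_eq 0 x
  have h2 : ∫ t in (0 : ℝ)..x, (w t * n t * Real.exp (-W t) + N t * (-Real.exp (-W t) * w t)) ≤ 0 := by
    rw [← neg_nonneg, ← intervalIntegral.integral_neg]
    refine intervalIntegral.integral_nonneg hx.1 fun t ht => ?_
    have h3 : n t ≤ N t := h t ⟨ht.1, ht.2.trans hx.2⟩
    have := mul_nonneg (mul_nonneg (hw0 t) (Real.exp_pos (-W t)).le) (sub_nonneg.2 h3)
    linarith
  have h4 : N x * Real.exp (-W x) ≤ c := by
    have h0 : N 0 * Real.exp (-W 0) = c := by simp [hN, hW]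
    linarith
  calc n x ≤ N x := h x hx
    _ = N x * Real.exp (-W x) * Real.exp (W x) := by
      rw [mul_assoc, ← Real.exp_add]; simp
    _ ≤ c * Real.exp (W x) := by gcongr

lemma gronwall_abs {n w : ℝ → ℝ} {c X : ℝ} (hn : Continuous n)
    (hw : ∀ a b : ℝ, IntervalIntegrable w volume a b) (hw0 : ∀ x, 0 ≤ w x)
    (h : ∀ x, |x| ≤ X → n x ≤ c + |∫ t in (0 : ℝ)..x, w t * n t|) (hn0 : ∀ x, 0 ≤ n x) :
    ∀ x, |x| ≤ X → n x ≤ c * Real.exp |∫ t in (0 : ℝ)..x, w t| := by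
  intro x hx
  rcases le_total 0 x with h0 | h0
  · rw [abs_of_nonneg (intervalIntegral.integral_nonneg h0 fun t _ => hw0 t)]
    refine gronwall_right (X := X) hn hw hw0 (fun y hy => ?_) x ⟨h0, (le_abs_self x).trans hx⟩
    have := h y (by rw [abs_of_nonneg hy.1]; exact hy.2)
    rwa [abs_of_nonneg (intervalIntegral.integral_nonneg hy.1
      fun t _ => mul_nonneg (hw0 t) (hn0 t))] at this
  · have key := gronwall_right (n := fun y => n (-y)) (w := fun y => w (-y)) (c := c) (X := X)
      (hn.comp continuous_neg) (fun a b => by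
        simpa using (IntervalIntegrable.iff_comp_neg (f := w)).1 (hw (-a) (-b)))
      (fun y => hw0 _) (fun y hy => ?_) (-x) ⟨by linarith, (neg_le_abs x).trans hx⟩
    · have e : ∫ t in (0 : ℝ)..-x, w (-t) = |∫ t in (0 : ℝ)..x, w t| := by
        rw [intervalIntegral.integral_comp_neg, neg_zero, neg_neg,
          intervalIntegral.integral_symm x 0, abs_neg,
          abs_of_nonneg (intervalIntegral.integral_nonneg h0 fun t _ => hw0 t)]
      rw [e] at key
      simpa using key
    · have e : ∫ t in (0 : ℝ)..y, w (-t) * n (-t) = |∫ t in (0 : ℝ)..-y, w t * n t| := by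
        rw [intervalIntegral.integral_comp_neg (fun t => w t * n t), neg_zero,
          intervalIntegral.integral_symm (-y) 0, abs_neg,
          abs_of_nonneg (intervalIntegral.integral_nonneg (by linarith [hy.1])
            fun t _ => mul_nonneg (hw0 t) (hn0 t))]
      have := h (-y) (by rw [abs_neg, abs_of_nonneg hy.1]; exact hy.2)
      rwa [← e] at this

/-! ### The first-order system of Hill's equation -/

/-- `Y = (y, p)` is a solution on `ℝ` of the system `y' = p`, `p' = g y`, in the Carathéodory
sense: `y` is continuously differentiable, and `p` is locally absolutely continuous and satisfies its
equation almost everywhere. -/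
def IsSol (g : ℝ → ℂ) (Y : ℝ → ℂ × ℂ) : Prop :=
  IsPrim (fun t => ((Y t).2, g t * (Y t).1)) Y

namespace IsSol

variable {g : ℝ → ℂ} {Y Z : ℝ → ℂ × ℂ}

lemma fst (h : IsSol g Y) : IsPrim (fun t => (Y t).2) (fun t => (Y t).1) := by
  simpa using h.clm (ContinuousLinearMap.fst ℝ ℂ ℂ)

lemma snd (h : IsSol g Y) : IsPrim (fun t => g t * (Y t).1) (fun t => (Y t).2) := by
  simpa using h.clm (ContinuousLinearMap.snd ℝ ℂ ℂ)

lemma mk (h1 : IsPrim (fun t => (Y t).2) (fun t => (Y t).1))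
    (h2 : IsPrim (fun t => g t * (Y t).1) (fun t => (Y t).2)) : IsSol g Y :=
  h1.prodMk h2

lemma add (hY : IsSol g Y) (hZ : IsSol g Z) : IsSol g (fun t => Y t + Z t) := by
  refine mk ?_ ?_
  · simpa using hY.fst.add hZ.fst
  · simpa [mul_add] using hY.snd.add hZ.snd

lemma sub (hY : IsSol g Y) (hZ : IsSol g Z) : IsSol g (fun t => Y t - Z t) := by
  refine mk ?_ ?_
  · simpa using IsPrim.sub hY.fst hZ.fst
  · simpa [mul_sub] using IsPrim.sub hY.snd hZ.snd

lemma smul (hY : IsSol g Y) (c : ℂ) : IsSol g (fun t => c • Y t) := by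
  refine mk ?_ ?_
  · simpa using hY.fst.clm (c • ContinuousLinearMap.id ℝ ℂ)
  · simpa [mul_left_comm] using hY.snd.clm (c • ContinuousLinearMap.id ℝ ℂ)

lemma norm_coeff_le (t : ℝ) (v : ℂ × ℂ) :
    ‖(v.2, g t * v.1)‖ ≤ (1 + ‖g t‖) * ‖v‖ := by
  have h1 : ‖v.1‖ ≤ ‖v‖ := norm_fst_le v
  have h2 : ‖v.2‖ ≤ ‖v‖ := norm_snd_le v
  have h3 := norm_nonneg (g t)
  rw [Prod.norm_mk, max_le_iff, norm_mul]
  constructor <;> nlinarith [norm_nonneg v]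

lemma norm_le (hg : ∀ a b : ℝ, IntervalIntegrable g volume a b) (hY : IsSol g Y) (x : ℝ) :
    ‖Y x‖ ≤ ‖Y 0‖ * Real.exp |∫ t in (0 : ℝ)..x, (1 + ‖g t‖)| := by
  have hw : ∀ a b : ℝ, IntervalIntegrable (fun t => 1 + ‖g t‖) volume a b :=
    fun a b => intervalIntegrable_const.add (hg a b).norm
  refine gronwall_abs (n := fun t => ‖Y t‖) (X := |x|) hY.continuous.norm hw
    (fun t => by positivity) (fun y _ => ?_) (fun t => norm_nonneg _) x le_rfl
  have hb := (hw 0 y).mul_continuousOn (hY.continuous.norm.continuousOn)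
  calc ‖Y y‖ = ‖Y 0 + ∫ t in (0 : ℝ)..y, ((Y t).2, g t * (Y t).1)‖ := by rw [← hY.eq y]
    _ ≤ ‖Y 0‖ + ‖∫ t in (0 : ℝ)..y, ((Y t).2, g t * (Y t).1)‖ := norm_add_le _ _
    _ ≤ _ := by
      gcongr
      exact intervalIntegral.norm_integral_le_abs_of_norm_le
        (Eventually.of_forall fun t => norm_coeff_le t _) hb

lemma unique (hg : ∀ a b : ℝ, IntervalIntegrable g volume a b) (hY : IsSol g Y) (hZ : IsSol g Z)
    (h0 : Y 0 = Z 0) : Y = Z := by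
  funext x
  have := (hY.sub hZ).norm_le hg x
  simp only [h0, sub_self, norm_zero, zero_mul] at this
  exact sub_eq_zero.1 (norm_le_zero_iff.1 this)

end IsSol

/-- The Picard iterates of the system with initial value `v`. -/
noncomputable def picardIter (g : ℝ → ℂ) (v : ℂ × ℂ) : ℕ → ℝ → ℂ × ℂ
  | 0 => fun _ => v
  | k + 1 => fun x => ∫ t in (0 : ℝ)..x, ((picardIter g v k t).2, g t * (picardIter g v k t).1)

section Existence

variable {g : ℝ → ℂ} (hg : ∀ a b : ℝ, IntervalIntegrable g volume a b) (v : ℂ × ℂ)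
include hg

lemma intervalIntegrable_coeff {Y : ℝ → ℂ × ℂ} (hY : Continuous Y) (a b : ℝ) :
    IntervalIntegrable (fun t => ((Y t).2, g t * (Y t).1)) volume a b := by
  have h1 : IntervalIntegrable (fun t => (Y t).2) volume a b :=
    (continuous_snd.comp hY).intervalIntegrable a b
  have h2 : IntervalIntegrable (fun t => g t * (Y t).1) volume a b :=
    (hg a b).mul_continuousOn (continuous_fst.comp hY).continuousOn
  exact ⟨h1.1.prodMk h2.1, h1.2.prodMk h2.2⟩

lemma continuous_picardIter (k : ℕ) : Continuous (picardIter g v k) := by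
  induction k with
  | zero => exact continuous_const
  | succ k ih =>
    exact intervalIntegral.continuous_primitive (fun a b => intervalIntegrable_coeff hg ih a b) 0

/-- The weight `cosh (2 W)` makes the integral operator of the system a contraction by the factor
`1/2` on both sides of the origin. -/
lemma norm_picardIter_le (k : ℕ) (x : ℝ) : ‖picardIter g v k x‖ ≤
    (‖v‖ * Real.cosh (2 * ∫ t in (0 : ℝ)..x, (1 + ‖g t‖))) * (1 / 2) ^ k := by
  have hw : ∀ a b : ℝ, IntervalIntegrable (fun t => 1 + ‖g t‖) volume a b :=
    fun a b => intervalIntegrable_const.add (hg a b).norm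
  set W : ℝ → ℝ := fun x => ∫ t in (0 : ℝ)..x, (1 + ‖g t‖) with hWd
  have hW : IsPrim (fun t => 1 + ‖g t‖) W := ⟨hw, fun x => by simp [hWd]⟩
  change ‖picardIter g v k x‖ ≤ (‖v‖ * Real.cosh (2 * W x)) * (1 / 2) ^ k
  induction k generalizing x with
  | zero =>
    have := Real.one_le_cosh (2 * W x)
    simp only [picardIter, pow_zero, mul_one]
    nlinarith [norm_nonneg v]
  | succ k ih =>
    have hS : IsPrim (fun x => (2 * Real.cosh (2 * W x)) * (1 + ‖g x‖))
        (fun x => Real.sinh (2 * W x)) := by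
      refine hW.comp (φ := fun y => Real.sinh (2 * y)) (φ' := fun y => 2 * Real.cosh (2 * y))
        (fun y => ?_) (by fun_prop)
      simpa [mul_comm] using ((hasDerivAt_id y).const_mul 2).sinh
    have h1 := hS.sub_eq 0 x
    have hW0 : W 0 = 0 := by simp [hWd]
    rw [hW0, mul_zero, Real.sinh_zero, sub_zero] at h1
    have h2 : ‖picardIter g v (k + 1) x‖ ≤ |∫ t in (0 : ℝ)..x, ‖v‖ * (1 / 2) ^ (k + 1) *
        ((2 * Real.cosh (2 * W t)) * (1 + ‖g t‖))| := by
      refine intervalIntegral.norm_integral_le_abs_of_norm_le (Eventually.of_forall fun t => ?_)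
        ((hS.int 0 x).const_mul _)
      refine (IsSol.norm_coeff_le t _).trans ?_
      have := ih t
      calc (1 + ‖g t‖) * ‖picardIter g v k t‖
          ≤ (1 + ‖g t‖) * ((‖v‖ * Real.cosh (2 * W t)) * (1 / 2) ^ k) := by gcongr
        _ = _ := by ring
    rw [intervalIntegral.integral_const_mul, ← h1, abs_mul, abs_of_nonneg (by positivity)] at h2
    have h3 : |Real.sinh (2 * W x)| ≤ Real.cosh (2 * W x) := by
      rw [Real.abs_sinh, ← Real.cosh_abs]; exact (Real.sinh_lt_cosh _).le
    calc _ ≤ _ := h2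
      _ ≤ ‖v‖ * (1 / 2) ^ (k + 1) * Real.cosh (2 * W x) := by gcongr
      _ = _ := by ring

/-- The initial value problem of the system is solvable; the solution is the sum of the Picard
iterates. -/
theorem exists_isSol : ∃ Y, IsSol g Y ∧ Y 0 = v := by
  have hw : ∀ a b : ℝ, IntervalIntegrable (fun t => 1 + ‖g t‖) volume a b :=
    fun a b => intervalIntegrable_const.add (hg a b).norm
  set C : ℝ → ℝ := fun x => ‖v‖ * Real.cosh (2 * ∫ t in (0 : ℝ)..x, (1 + ‖g t‖)) with hC
  have hCc : Continuous C := by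
    have := intervalIntegral.continuous_primitive hw 0
    fun_prop
  have hb : ∀ k x, ‖picardIter g v k x‖ ≤ C x * (1 / 2) ^ k := norm_picardIter_le hg v
  have hgeo : Summable fun k : ℕ => ((1 : ℝ) / 2) ^ k := summable_geometric_two
  have hsum : ∀ x, Summable fun k => picardIter g v k x := fun x =>
    Summable.of_norm_bounded (hgeo.mul_left (C x)) fun k => hb k x
  set Y : ℝ → ℂ × ℂ := fun x => ∑' k, picardIter g v k x with hY
  have hYc : Continuous Y := by
    rw [continuous_iff_continuousAt]
    intro x
    obtain ⟨B, hB⟩ := (isCompact_Icc (a := x - 1) (b := x + 1)).exists_bound_of_continuousOn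
      hCc.continuousOn
    have : ContinuousOn Y (Icc (x - 1) (x + 1)) :=
      continuousOn_tsum (fun k => (continuous_picardIter hg v k).continuousOn) (hgeo.mul_left B)
        fun k y hy => (hb k y).trans (by
          gcongr
          exact (le_abs_self _).trans (hB y hy))
    exact this.continuousAt (Icc_mem_nhds (by linarith) (by linarith))
  have hint : ∀ x, HasSum (fun k => picardIter g v (k + 1) x)
      (∫ t in (0 : ℝ)..x, ((Y t).2, g t * (Y t).1)) := by
    intro x
    refine intervalIntegral.hasSum_integral_of_dominated_convergence
      (fun k t => (1 + ‖g t‖) * (C t * (1 / 2) ^ k)) (fun k => ?_) (fun k => ?_) ?_ ?_ ?_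
    · exact (intervalIntegrable_coeff hg (continuous_picardIter hg v k) 0 x).aestronglyMeasurable_restrict_uIoc
    · refine Eventually.of_forall fun t _ => (IsSol.norm_coeff_le t _).trans ?_
      gcongr
      exact hb k t
    · exact Eventually.of_forall fun t _ => (hgeo.mul_left (C t)).mul_left _
    · have : (fun t => ∑' k : ℕ, (1 + ‖g t‖) * (C t * (1 / 2) ^ k)) =
          fun t => (1 + ‖g t‖) * (C t * 2) := by
        funext t
        rw [tsum_mul_left, tsum_mul_left, tsum_geometric_two]
      rw [this]
      exact (hw 0 x).mul_continuousOn (hCc.mul continuous_const).continuousOn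
    · refine Eventually.of_forall fun t _ => ?_
      have h := (hsum t).hasSum
      have h1 := h.mapL (ContinuousLinearMap.fst ℝ ℂ ℂ)
      have h2 := h.mapL (ContinuousLinearMap.snd ℝ ℂ ℂ)
      exact h2.prodMk (h1.mul_left (g t))
  refine ⟨Y, ⟨intervalIntegrable_coeff hg hYc, fun x => ?_⟩, ?_⟩
  · have hz : ∀ x, Y x = v + ∫ t in (0 : ℝ)..x, ((Y t).2, g t * (Y t).1) := fun x => by
      rw [← (hint x).tsum_eq, hY]
      exact (hsum x).tsum_eq_zero_add
    rw [hz 0, hz x]; simp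
  · have : Y 0 = v + ∑' k, picardIter g v (k + 1) 0 := (hsum 0).tsum_eq_zero_add
    rw [this]
    simp [picardIter]

end Existence

/-! ### The fundamental solutions and their dependence on the parameters -/

/-- The coefficient `V - lam` of Hill's equation `y'' = (V - lam) y`. -/
def hillCoeff (V : ℝ → ℝ) (lam : ℂ) : ℝ → ℂ := fun t => (V t : ℂ) - lam

/-- The solution `(y, y')` of the system of Hill's equation with value `v` at `0`. -/
noncomputable def hillFlow (V : ℝ → ℝ) (lam : ℂ) (v : ℂ × ℂ) : ℝ → ℂ × ℂ :=
  Classical.epsilon fun Y => IsSol (hillCoeff V lam) Y ∧ Y 0 = v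

section Flow

variable {V : ℝ → ℝ} (hV : ∀ a b : ℝ, IntervalIntegrable V volume a b)
include hV

lemma intervalIntegrable_hillCoeff (lam : ℂ) (a b : ℝ) :
    IntervalIntegrable (hillCoeff V lam) volume a b := by
  have h : IntervalIntegrable (fun t => (V t : ℂ)) volume a b := ⟨(hV a b).1.ofReal, (hV a b).2.ofReal⟩
  exact h.sub intervalIntegrable_const

lemma isSol_hillFlow (lam : ℂ) (v : ℂ × ℂ) : IsSol (hillCoeff V lam) (hillFlow V lam v) :=
  (Classical.epsilon_spec (exists_isSol (intervalIntegrable_hillCoeff hV lam) v)).1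

lemma hillFlow_zero (lam : ℂ) (v : ℂ × ℂ) : hillFlow V lam v 0 = v :=
  (Classical.epsilon_spec (exists_isSol (intervalIntegrable_hillCoeff hV lam) v)).2

lemma eq_hillFlow {lam : ℂ} {Y : ℝ → ℂ × ℂ} (hY : IsSol (hillCoeff V lam) Y) :
    Y = hillFlow V lam (Y 0) :=
  hY.unique (intervalIntegrable_hillCoeff hV lam) (isSol_hillFlow hV lam _)
    (hillFlow_zero hV lam _).symm

/-- The flow is linear in the initial value. -/
lemma hillFlow_eq_comb (lam : ℂ) (v : ℂ × ℂ) (x : ℝ) :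
    hillFlow V lam v x = v.1 • hillFlow V lam (1, 0) x + v.2 • hillFlow V lam (0, 1) x := by
  have h := ((isSol_hillFlow hV lam (1, 0)).smul v.1).add ((isSol_hillFlow hV lam (0, 1)).smul v.2)
  have := congrFun (eq_hillFlow hV h) x
  simp only [hillFlow_zero hV] at this
  rw [this]
  simp

/-- The flow at a real spectral parameter is real. -/
lemma hillFlow_im (lam : ℝ) (a b x : ℝ) :
    (hillFlow V lam (a, b) x).1.im = 0 ∧ (hillFlow V lam (a, b) x).2.im = 0 := by
  set Y := hillFlow V lam ((a : ℂ), (b : ℂ)) with hYd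
  have hY := isSol_hillFlow hV lam ((a : ℂ), (b : ℂ))
  have hZ : IsSol (hillCoeff V lam)
      (fun t => (starRingEnd ℂ (Y t).1, starRingEnd ℂ (Y t).2)) := by
    refine IsSol.mk ?_ ?_
    · simpa using hY.fst.clm (Complex.conjCLE : ℂ →L[ℝ] ℂ)
    · simpa [hillCoeff] using hY.snd.clm (Complex.conjCLE : ℂ →L[ℝ] ℂ)
  have h0 : Y 0 = ((a : ℂ), (b : ℂ)) := hillFlow_zero hV _ _
  have := congrFun (hZ.unique (intervalIntegrable_hillCoeff hV lam) hY (by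
    change _ = Y 0
    rw [h0]; simp)) x
  have h1 := congrArg Prod.fst this
  have h2 := congrArg Prod.snd this
  exact ⟨Complex.conj_eq_iff_im.1 h1, Complex.conj_eq_iff_im.1 h2⟩

end Flow

/-- The Wronskian of two solutions at the same or at different spectral parameters; its derivative is
a multiple of the product of the solutions. -/
lemma wronskian_sub {V : ℝ → ℝ} {lam lam' : ℂ} {Y Z : ℝ → ℂ × ℂ}
    (hY : IsSol (hillCoeff V lam) Y) (hZ : IsSol (hillCoeff V lam') Z) (x : ℝ) :
    ((Z x).1 * (Y x).2 - (Z x).2 * (Y x).1) - ((Z 0).1 * (Y 0).2 - (Z 0).2 * (Y 0).1) =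
      -(lam - lam') * ∫ t in (0 : ℝ)..x, (Z t).1 * (Y t).1 := by
  have h := ((hZ.fst.mul hY.snd).sub (hZ.snd.mul hY.fst)).sub_eq 0 x
  rw [h, ← intervalIntegral.integral_const_mul]
  congr 1
  funext t
  simp only [hillCoeff]
  ring

/-- Stability of the system under a perturbation of the coefficient: the difference of the solutions
solves an inhomogeneous system to which Grönwall's inequality applies. -/
lemma IsSol.norm_sub_le {g g' : ℝ → ℂ} (hg : ∀ a b : ℝ, IntervalIntegrable g volume a b)
    (hg' : ∀ a b : ℝ, IntervalIntegrable g' volume a b) {Y Z : ℝ → ℂ × ℂ} (hY : IsSol g Y)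
    (hZ : IsSol g' Z) (h0 : Y 0 = Z 0) {R x : ℝ} (hx : |x| ≤ R) :
    ‖Y x - Z x‖ ≤ (‖Y 0‖ * Real.exp (∫ t in -R..R, (1 + ‖g' t‖)) * ∫ t in -R..R, ‖g t - g' t‖) *
      Real.exp (∫ t in -R..R, (1 + ‖g t‖)) := by
  have hw : ∀ a b : ℝ, IntervalIntegrable (fun t => 1 + ‖g t‖) volume a b :=
    fun a b => intervalIntegrable_const.add (hg a b).norm
  have hw' : ∀ a b : ℝ, IntervalIntegrable (fun t => 1 + ‖g' t‖) volume a b :=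
    fun a b => intervalIntegrable_const.add (hg' a b).norm
  have hd : ∀ a b : ℝ, IntervalIntegrable (fun t => ‖g t - g' t‖) volume a b :=
    fun a b => ((hg a b).sub (hg' a b)).norm
  have hR : 0 ≤ R := (abs_nonneg x).trans hx
  -- integrals over `[0, y]`, in either direction, are at most the integral over `[-R, R]`
  have hmono : ∀ (f : ℝ → ℝ), (∀ a b : ℝ, IntervalIntegrable f volume a b) → (∀ t, 0 ≤ f t) →
      ∀ y : ℝ, |y| ≤ R → |∫ t in (0 : ℝ)..y, f t| ≤ ∫ t in -R..R, f t := by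
    intro f hf hf0 y hy
    have hy' := abs_le.1 hy
    rw [← abs_of_nonneg (intervalIntegral.integral_nonneg (by linarith) fun t _ => hf0 t :
      0 ≤ ∫ t in -R..R, f t)]
    refine intervalIntegral.abs_integral_mono_interval ?_ (Eventually.of_forall fun t => hf0 t) (hf _ _)
    intro t ht
    rw [uIoc_of_le (by linarith)]
    rcases mem_uIoc.1 ht with h | h <;> constructor <;> linarith [h.1, h.2]
  set c := ‖Y 0‖ * Real.exp (∫ t in -R..R, (1 + ‖g' t‖)) * ∫ t in -R..R, ‖g t - g' t‖ with hc
  have hDc : Continuous fun t => ‖Y t - Z t‖ := (hY.continuous.sub hZ.continuous).norm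
  have hc0 : 0 ≤ c := by
    have : 0 ≤ ∫ t in -R..R, ‖g t - g' t‖ :=
      intervalIntegral.integral_nonneg (by linarith) fun t _ => norm_nonneg _
    positivity
  have key := gronwall_abs (n := fun t => ‖Y t - Z t‖) (c := c) (X := R) hDc hw
    (fun t => by positivity) (fun y hy => ?_) (fun t => norm_nonneg _) x hx
  · refine key.trans ?_
    gcongr
    exact hmono _ hw (fun t => by positivity) x hx
  · have hint := (intervalIntegrable_coeff hg hY.continuous 0 y).sub
      (intervalIntegrable_coeff hg' hZ.continuous 0 y)
    have hI1 : IntervalIntegrable (fun t => (1 + ‖g t‖) * ‖Y t - Z t‖) volume 0 y :=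
      (hw 0 y).mul_continuousOn hDc.continuousOn
    have hI2 : IntervalIntegrable (fun t => ‖g t - g' t‖ * ‖Z t‖) volume 0 y :=
      (hd 0 y).mul_continuousOn hZ.continuous.norm.continuousOn
    -- the source term `(g - g') z` carries the perturbation
    have e : Y y - Z y = ∫ t in (0 : ℝ)..y, (((Y t).2, g t * (Y t).1) - ((Z t).2, g' t * (Z t).1)) := by
      rw [intervalIntegral.integral_sub (intervalIntegrable_coeff hg hY.continuous 0 y)
        (intervalIntegrable_coeff hg' hZ.continuous 0 y)]
      have h1 := IsPrim.eq hY y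
      have h2 := IsPrim.eq hZ y
      rw [h1, h2, h0]; abel
    have h1 : ‖Y y - Z y‖ ≤ |∫ t in (0 : ℝ)..y,
        (‖g t - g' t‖ * ‖Z t‖ + (1 + ‖g t‖) * ‖Y t - Z t‖)| := by
      rw [e]
      refine intervalIntegral.norm_integral_le_abs_of_norm_le (Eventually.of_forall fun t => ?_)
        (hI2.add hI1)
      have e2 : (((Y t).2, g t * (Y t).1) - ((Z t).2, g' t * (Z t).1) : ℂ × ℂ) =
          (0, (g t - g' t) * (Z t).1) + ((Y t - Z t).2, g t * (Y t - Z t).1) := by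
        ext <;> simp; ring
      rw [e2]
      refine (norm_add_le _ _).trans (add_le_add ?_ (IsSol.norm_coeff_le t _))
      rw [Prod.norm_mk, norm_zero, norm_mul, max_eq_right (by positivity)]
      gcongr
      exact norm_fst_le _
    rw [intervalIntegral.integral_add hI2 hI1] at h1
    refine (h1.trans (abs_add_le _ _)).trans ?_
    gcongr
    have hb : ∀ t : ℝ, |t| ≤ R → ‖Z t‖ ≤ ‖Y 0‖ * Real.exp (∫ t in -R..R, (1 + ‖g' t‖)) := by
      intro t ht
      refine (hZ.norm_le hg' t).trans ?_
      rw [h0]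
      gcongr
      exact hmono _ hw' (fun t => by positivity) t ht
    calc |∫ t in (0 : ℝ)..y, ‖g t - g' t‖ * ‖Z t‖|
        ≤ |∫ t in (0 : ℝ)..y, ‖g t - g' t‖ * (‖Y 0‖ * Real.exp (∫ t in -R..R, (1 + ‖g' t‖)))| := by
          rw [← Real.norm_eq_abs (∫ t in (0 : ℝ)..y, ‖g t - g' t‖ * ‖Z t‖)]
          refine intervalIntegral.norm_integral_le_abs_of_norm_le ?_ ((hd 0 y).mul_const _)
          refine (ae_restrict_iff' measurableSet_uIoc).2 (Eventually.of_forall fun t ht => ?_)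
          rw [Real.norm_of_nonneg (by positivity)]
          gcongr
          refine hb t ((?_ : |t| ≤ |y|).trans hy)
          rcases mem_uIoc.1 ht with h | h
          · rw [abs_of_pos h.1]; exact h.2.trans (le_abs_self _)
          · rw [abs_of_nonpos h.2]; linarith [neg_le_abs y, h.1]
      _ ≤ c := by
        rw [intervalIntegral.integral_mul_const, abs_mul, abs_of_nonneg (by positivity : 0 ≤ ‖Y 0‖ * _),
          hc, mul_comm]
        gcongr
        exact hmono _ hd (fun t => norm_nonneg _) y hy

/-- The flow depends continuously on the coupling constant, the spectral parameter and the
position. -/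
lemma continuous_hillFlow {V : ℝ → ℝ} (hV : ∀ a b : ℝ, IntervalIntegrable V volume a b)
    (v : ℂ × ℂ) :
    Continuous fun p : (ℝ × ℂ) × ℝ => hillFlow (fun t => p.1.1 * V t) p.1.2 v p.2 := by
  have hV' : ∀ (s : ℝ) (a b : ℝ), IntervalIntegrable (fun t => s * V t) volume a b :=
    fun s a b => (hV a b).const_mul s
  rw [continuous_iff_continuousAt]
  rintro ⟨⟨s₀, l₀⟩, x₀⟩
  -- the constants of the stability estimate are locally bounded in the parameters
  set R := |x₀| + 1 with hR
  have hR0 : -R ≤ R := by have := abs_nonneg x₀; linarith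
  set K : ℝ := ∫ t in -R..R, |V t| with hK
  have hK0 : 0 ≤ K := intervalIntegral.integral_nonneg hR0 fun t _ => abs_nonneg _
  have hVa : ∀ a b : ℝ, IntervalIntegrable (fun t => |V t|) volume a b := fun a b => (hV a b).abs
  have hbd : ∀ (s : ℝ) (l : ℂ),
      ∫ t in -R..R, (1 + ‖hillCoeff (fun t => s * V t) l t‖) ≤ (2 * R) * (1 + ‖l‖) + |s| * K := by
    intro s l
    calc ∫ t in -R..R, (1 + ‖hillCoeff (fun t => s * V t) l t‖)
        ≤ ∫ t in -R..R, ((1 + ‖l‖) + |s| * |V t|) := by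
          refine intervalIntegral.integral_mono hR0
            (intervalIntegrable_const.add (intervalIntegrable_hillCoeff (hV' s) l _ _).norm)
            (intervalIntegrable_const.add ((hVa _ _).const_mul _)) fun t => ?_
          have := norm_sub_le ((s * V t : ℝ) : ℂ) l
          rw [Complex.norm_real, Real.norm_eq_abs, abs_mul] at this
          simp only [hillCoeff]
          linarith
      _ = _ := by
          rw [intervalIntegral.integral_add intervalIntegrable_const ((hVa _ _).const_mul _),
            intervalIntegral.integral_const_mul, intervalIntegral.integral_const, smul_eq_mul]
          ring
  have hdiff : ∀ (s : ℝ) (l : ℂ), ∫ t in -R..R, ‖hillCoeff (fun t => s * V t) l t -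
      hillCoeff (fun t => s₀ * V t) l₀ t‖ ≤ (2 * R) * ‖l - l₀‖ + |s - s₀| * K := by
    intro s l
    calc ∫ t in -R..R, ‖hillCoeff (fun t => s * V t) l t - hillCoeff (fun t => s₀ * V t) l₀ t‖
        ≤ ∫ t in -R..R, (‖l - l₀‖ + |s - s₀| * |V t|) := by
          refine intervalIntegral.integral_mono hR0
            ((intervalIntegrable_hillCoeff (hV' s) l _ _).sub
              (intervalIntegrable_hillCoeff (hV' s₀) l₀ _ _)).norm
            (intervalIntegrable_const.add ((hVa _ _).const_mul _)) fun t => ?_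
          have e : hillCoeff (fun t => s * V t) l t - hillCoeff (fun t => s₀ * V t) l₀ t =
              (((s - s₀) * V t : ℝ) : ℂ) - (l - l₀) := by simp [hillCoeff]; ring
          have := norm_sub_le (((s - s₀) * V t : ℝ) : ℂ) (l - l₀)
          rw [Complex.norm_real, Real.norm_eq_abs, abs_mul] at this
          simp only [e]
          linarith
      _ = _ := by
          rw [intervalIntegral.integral_add intervalIntegrable_const ((hVa _ _).const_mul _),
            intervalIntegral.integral_const_mul, intervalIntegral.integral_const, smul_eq_mul]
          ring
  -- difference to the flow at the base parameters
  have hlim : Tendsto (fun p : (ℝ × ℂ) × ℝ => hillFlow (fun t => p.1.1 * V t) p.1.2 v p.2 -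
      hillFlow (fun t => s₀ * V t) l₀ v p.2) (𝓝 ((s₀, l₀), x₀)) (𝓝 0) := by
    set B : (ℝ × ℂ) × ℝ → ℝ := fun p => (‖v‖ * Real.exp ((2 * R) * (1 + ‖l₀‖) + |s₀| * K) *
      ((2 * R) * ‖p.1.2 - l₀‖ + |p.1.1 - s₀| * K)) *
        Real.exp ((2 * R) * (1 + ‖p.1.2‖) + |p.1.1| * K) with hB
    have hBc : Tendsto B (𝓝 ((s₀, l₀), x₀)) (𝓝 0) := by
      have : Continuous B := by fun_prop
      have h := this.tendsto ((s₀, l₀), x₀)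
      simpa [hB] using h
    refine squeeze_zero_norm' ?_ hBc
    have hnear : ∀ᶠ p : (ℝ × ℂ) × ℝ in 𝓝 ((s₀, l₀), x₀), |p.2| < R := by
      have : Continuous fun p : (ℝ × ℂ) × ℝ => |p.2| := by fun_prop
      exact this.tendsto ((s₀, l₀), x₀) |>.eventually (gt_mem_nhds (by simp [hR]))
    filter_upwards [hnear] with p hp
    have := (isSol_hillFlow (hV' p.1.1) p.1.2 v).norm_sub_le
      (intervalIntegrable_hillCoeff (hV' p.1.1) p.1.2)
      (intervalIntegrable_hillCoeff (hV' s₀) l₀) (isSol_hillFlow (hV' s₀) l₀ v)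
      (by rw [hillFlow_zero (hV' _), hillFlow_zero (hV' _)]) hp.le
    rw [hillFlow_zero (hV' _)] at this
    have hd0 : 0 ≤ ∫ t in -R..R, ‖hillCoeff (fun t => p.1.1 * V t) p.1.2 t -
      hillCoeff (fun t => s₀ * V t) l₀ t‖ :=
        intervalIntegral.integral_nonneg hR0 fun t _ => norm_nonneg _
    refine this.trans ?_
    simp only [hB]
    gcongr
    · exact hbd _ _
    · exact hdiff _ _
    · exact hbd _ _
  have hbase : Tendsto (fun p : (ℝ × ℂ) × ℝ => hillFlow (fun t => s₀ * V t) l₀ v p.2)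
      (𝓝 ((s₀, l₀), x₀)) (𝓝 (hillFlow (fun t => s₀ * V t) l₀ v x₀)) :=
    (((isSol_hillFlow (hV' s₀) l₀ v).continuous).comp continuous_snd).tendsto _
  have := hlim.add hbase
  simpa [ContinuousAt] using this

/-! ### The discriminant -/

/-- The trace of the monodromy matrix of `-y'' + V y = lam y` over `[0, 1]`. -/
noncomputable def hillDisc (V : ℝ → ℝ) (lam : ℂ) : ℂ :=
  (hillFlow V lam (1, 0) 1).1 + (hillFlow V lam (0, 1) 1).2

/-- The bilinear integral `∫ y z` over `[0, 1]` of two solutions. -/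
noncomputable def overlap (Y Z : ℝ → ℂ × ℂ) : ℂ := ∫ t in (0 : ℝ)..1, (Y t).1 * (Z t).1

lemma hasDerivAt_fst {V : ℝ → ℝ} {lam : ℂ} {Y : ℝ → ℂ × ℂ} (hY : IsSol (hillCoeff V lam) Y) (x : ℝ) :
    HasDerivAt (fun t => (Y t).1) (Y x).2 x := by
  have h := hY.fst
  have hc : Continuous fun t => (Y t).2 := continuous_snd.comp hY.continuous
  have : (fun t => (Y t).1) = fun x => (Y 0).1 + ∫ t in (0 : ℝ)..x, (Y t).2 := funext h.eq
  rw [this]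
  exact (hc.integral_hasStrictDerivAt 0 x).hasDerivAt.const_add _

/-- A solution that vanishes on `[0, 1]` has zero initial value. -/
lemma eq_zero_of_fst_eq_zero {V : ℝ → ℝ} {lam : ℂ} {Y : ℝ → ℂ × ℂ} (hY : IsSol (hillCoeff V lam) Y)
    (h : ∀ x ∈ Icc (0 : ℝ) 1, (Y x).1 = 0) : Y 0 = 0 := by
  have hc : Continuous fun t => (Y t).2 := continuous_snd.comp hY.continuous
  have h1 : ∀ x ∈ Ioo (0 : ℝ) 1, (Y x).2 = 0 := by
    intro x hx
    have hd := hasDerivAt_fst hY x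
    have : (fun t => (Y t).1) =ᶠ[𝓝 x] fun _ => 0 := by
      filter_upwards [Ioo_mem_nhds hx.1 hx.2] with t ht using h t ⟨ht.1.le, ht.2.le⟩
    exact (hd.congr_of_eventuallyEq this.symm).unique (hasDerivAt_const x 0)
  have h2 : (Y 0).2 = 0 := by
    have : (0 : ℝ) ∈ closure (Ioo (0 : ℝ) 1) := by
      rw [closure_Ioo (by norm_num)]; simp
    exact (isClosed_eq hc continuous_const).closure_subset_iff.2 h1 this
  exact Prod.ext (h 0 (by simp)) h2

/-- The mass of a nontrivial solution over `[0, 1]` is positive. -/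
lemma integral_normSq_pos {V : ℝ → ℝ} {lam : ℂ} {Y : ℝ → ℂ × ℂ} (hY : IsSol (hillCoeff V lam) Y)
    (h0 : Y 0 ≠ 0) : 0 < ∫ t in (0 : ℝ)..1, ‖(Y t).1‖ ^ 2 := by
  have hc : Continuous fun t => ‖(Y t).1‖ ^ 2 := ((continuous_fst.comp hY.continuous).norm).pow 2
  obtain ⟨x, hx, hne⟩ : ∃ x ∈ Icc (0 : ℝ) 1, (Y x).1 ≠ 0 := by
    by_contra! hcon
    exact h0 (eq_zero_of_fst_eq_zero hY hcon)
  exact intervalIntegral.integral_pos (by norm_num) hc.continuousOn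
    (fun t _ => by positivity) ⟨x, hx, by positivity⟩

section Disc

variable {V : ℝ → ℝ} (hV : ∀ a b : ℝ, IntervalIntegrable V volume a b)
include hV

lemma wronskian_eq_one (lam : ℂ) (x : ℝ) :
    (hillFlow V lam (1, 0) x).1 * (hillFlow V lam (0, 1) x).2 -
      (hillFlow V lam (1, 0) x).2 * (hillFlow V lam (0, 1) x).1 = 1 := by
  have h := wronskian_sub (isSol_hillFlow hV lam (0, 1)) (isSol_hillFlow hV lam (1, 0)) x
  simp only [hillFlow_zero hV, sub_self, neg_zero, zero_mul, mul_zero, mul_one, sub_zero] at h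
  exact sub_eq_zero.1 h

/-- The four Wronskians between the fundamental solutions for two spectral parameters. -/
lemma wronskian_overlap (lam mu : ℂ) (a b c d : ℂ) :
    (hillFlow V mu (a, b) 1).1 * (hillFlow V lam (c, d) 1).2 -
      (hillFlow V mu (a, b) 1).2 * (hillFlow V lam (c, d) 1).1 =
      a * d - b * c - (lam - mu) * overlap (hillFlow V mu (a, b)) (hillFlow V lam (c, d)) := by
  have h := wronskian_sub (isSol_hillFlow hV lam (c, d)) (isSol_hillFlow hV mu (a, b)) 1
  simp only [hillFlow_zero hV] at h
  rw [overlap]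
  linear_combination h

/-- The exact increment of the discriminant between two spectral parameters. Letting them come
together gives the derivative, without differentiating solutions in the spectral parameter. -/
lemma hillDisc_sub (lam mu : ℂ) :
    hillDisc V lam - hillDisc V mu = (lam - mu) *
      ((hillFlow V mu (1, 0) 1).1 * overlap (hillFlow V mu (0, 1)) (hillFlow V lam (1, 0)) -
        (hillFlow V mu (0, 1) 1).1 * overlap (hillFlow V mu (1, 0)) (hillFlow V lam (1, 0)) +
        (hillFlow V mu (1, 0) 1).2 * overlap (hillFlow V mu (0, 1)) (hillFlow V lam (0, 1)) -
        (hillFlow V mu (0, 1) 1).2 * overlap (hillFlow V mu (1, 0)) (hillFlow V lam (0, 1))) := by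
  have h11 := wronskian_overlap hV lam mu 1 0 1 0
  have h12 := wronskian_overlap hV lam mu 1 0 0 1
  have h21 := wronskian_overlap hV lam mu 0 1 1 0
  have h22 := wronskian_overlap hV lam mu 0 1 0 1
  have hw := wronskian_eq_one hV mu 1
  simp only [hillDisc]
  linear_combination (-(hillFlow V lam (1, 0) 1).1 - (hillFlow V lam (0, 1) 1).2) * hw +
    (hillFlow V mu (0, 1) 1).1 * h11 - (hillFlow V mu (1, 0) 1).1 * h21 +
    (hillFlow V mu (0, 1) 1).2 * h12 - (hillFlow V mu (1, 0) 1).2 * h22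

/-- At a point where the monodromy matrix is `σ` times the identity, the discriminant departs from
`2 σ` to second order; this follows from `det = 1`. -/
lemma hillDisc_eq_of_scalar {mu σ : ℂ} (hA : (hillFlow V mu (1, 0) 1).1 = σ)
    (hB : (hillFlow V mu (0, 1) 1).1 = 0) (hC : (hillFlow V mu (1, 0) 1).2 = 0)
    (hD : (hillFlow V mu (0, 1) 1).2 = σ) (lam : ℂ) :
    hillDisc V lam = σ * (2 - (lam - mu) ^ 2 *
      (overlap (hillFlow V mu (1, 0)) (hillFlow V lam (1, 0)) *
          overlap (hillFlow V mu (0, 1)) (hillFlow V lam (0, 1)) -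
        overlap (hillFlow V mu (1, 0)) (hillFlow V lam (0, 1)) *
          overlap (hillFlow V mu (0, 1)) (hillFlow V lam (1, 0)))) := by
  have h11 := wronskian_overlap hV lam mu 1 0 1 0
  have h12 := wronskian_overlap hV lam mu 1 0 0 1
  have h21 := wronskian_overlap hV lam mu 0 1 1 0
  have h22 := wronskian_overlap hV lam mu 0 1 0 1
  have hw := wronskian_eq_one hV mu 1
  have hw' := wronskian_eq_one hV lam 1
  have h := hillDisc_sub hV lam mu
  have hm : hillDisc V mu = σ + σ := by rw [hillDisc, hA, hD]
  rw [hm] at h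
  simp only [hA, hB, hC, hD] at h11 h12 h21 h22 hw h
  set o11 := overlap (hillFlow V mu (1, 0)) (hillFlow V lam (1, 0))
  set o12 := overlap (hillFlow V mu (1, 0)) (hillFlow V lam (0, 1))
  set o21 := overlap (hillFlow V mu (0, 1)) (hillFlow V lam (1, 0))
  set o22 := overlap (hillFlow V mu (0, 1)) (hillFlow V lam (0, 1))
  set y := hillFlow V lam (1, 0) 1
  set z := hillFlow V lam (0, 1) 1
  -- the determinant of the transition matrix is one
  have hdet : (1 - (lam - mu) * o12) * (1 + (lam - mu) * o21) +
      (lam - mu) ^ 2 * (o11 * o22) = 1 := by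
    have e12 : σ * z.2 = 1 - (lam - mu) * o12 := by linear_combination h12
    have e21 : σ * y.1 = 1 + (lam - mu) * o21 := by linear_combination -h21
    have e11 : σ * y.2 = -((lam - mu) * o11) := by linear_combination h11
    have e22 : σ * z.1 = (lam - mu) * o22 := by linear_combination -h22
    rw [← e12, ← e21]
    have : (lam - mu) ^ 2 * (o11 * o22) = -(σ * y.2) * (σ * z.1) := by rw [e11, e22]; ring
    rw [this]
    linear_combination σ ^ 2 * hw' + hw
  linear_combination h + σ * hdet

lemma continuous_overlap (mu : ℂ) (v w : ℂ × ℂ) :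
    Continuous fun lam => overlap (hillFlow V mu v) (hillFlow V lam w) := by
  have h1 : Continuous fun p : ℂ × ℝ => hillFlow V p.1 w p.2 := by
    have := (continuous_hillFlow hV w).comp
      (show Continuous fun p : ℂ × ℝ => (((1 : ℝ), p.1), p.2) by fun_prop)
    simpa [Function.comp_def] using this
  have h2 := (isSol_hillFlow hV mu v).continuous
  unfold overlap
  apply intervalIntegral.continuous_parametric_intervalIntegral_of_continuous'
  simp only [Function.uncurry_def]
  exact ((continuous_fst.comp h2).comp continuous_snd).mul (continuous_fst.comp h1)

lemma hasDerivAt_hillDisc (mu : ℂ) : HasDerivAt (hillDisc V)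
    ((hillFlow V mu (1, 0) 1).1 * overlap (hillFlow V mu (0, 1)) (hillFlow V mu (1, 0)) -
        (hillFlow V mu (0, 1) 1).1 * overlap (hillFlow V mu (1, 0)) (hillFlow V mu (1, 0)) +
        (hillFlow V mu (1, 0) 1).2 * overlap (hillFlow V mu (0, 1)) (hillFlow V mu (0, 1)) -
        (hillFlow V mu (0, 1) 1).2 * overlap (hillFlow V mu (1, 0)) (hillFlow V mu (0, 1))) mu := by
  rw [hasDerivAt_iff_tendsto_slope]
  have h11 := continuous_overlap hV mu (1, 0) (1, 0)
  have h12 := continuous_overlap hV mu (1, 0) (0, 1)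
  have h21 := continuous_overlap hV mu (0, 1) (1, 0)
  have h22 := continuous_overlap hV mu (0, 1) (0, 1)
  have hc : Continuous fun lam => ((hillFlow V mu (1, 0) 1).1 *
      overlap (hillFlow V mu (0, 1)) (hillFlow V lam (1, 0)) -
        (hillFlow V mu (0, 1) 1).1 * overlap (hillFlow V mu (1, 0)) (hillFlow V lam (1, 0)) +
        (hillFlow V mu (1, 0) 1).2 * overlap (hillFlow V mu (0, 1)) (hillFlow V lam (0, 1)) -
        (hillFlow V mu (0, 1) 1).2 * overlap (hillFlow V mu (1, 0)) (hillFlow V lam (0, 1))) := by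
    fun_prop
  refine ((hc.tendsto mu).mono_left nhdsWithin_le_nhds).congr' ?_
  filter_upwards [self_mem_nhdsWithin] with lam hlam
  rw [slope_def_field, hillDisc_sub hV, mul_div_cancel_left₀ _ (sub_ne_zero.2 hlam)]

lemma differentiable_hillDisc : Differentiable ℂ (hillDisc V) :=
  fun mu => (hasDerivAt_hillDisc hV mu).differentiableAt

/-- The discriminant is jointly continuous in the coupling constant and the spectral parameter. -/
lemma continuous_hillDisc : Continuous fun p : ℝ × ℂ => hillDisc (fun t => p.1 * V t) p.2 := by
  have h1 := (continuous_hillFlow hV (1, 0)).comp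
    (show Continuous fun p : ℝ × ℂ => (p, (1 : ℝ)) by fun_prop)
  have h2 := (continuous_hillFlow hV (0, 1)).comp
    (show Continuous fun p : ℝ × ℂ => (p, (1 : ℝ)) by fun_prop)
  exact (continuous_fst.comp h1).add (continuous_snd.comp h2)

lemma hillDisc_im (x : ℝ) : (hillDisc V x).im = 0 := by
  have h1 := hillFlow_im hV x 1 0 1
  have h2 := hillFlow_im hV x 0 1 1
  simp only [Complex.ofReal_one, Complex.ofReal_zero] at h1 h2
  simp [hillDisc, h1.1, h2.2]

/-! ### The discriminant on the real line -/

/-- The fundamental solutions at a real spectral parameter, as real functions. -/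
lemma exists_real_fundamental (x : ℝ) : ∃ y z : ℝ → ℝ, Continuous y ∧ Continuous z ∧
    (∀ t, (hillFlow V x (1, 0) t).1 = y t) ∧ (∀ t, (hillFlow V x (0, 1) t).1 = z t) ∧
    y 0 = 1 ∧ z 0 = 0 ∧ ∀ a b : ℝ, (a, b) ≠ 0 → 0 < ∫ t in (0 : ℝ)..1, (a * y t + b * z t) ^ 2 := by
  have hy : ∀ t, (hillFlow V x (1, 0) t).1 = ((hillFlow V x (1, 0) t).1.re : ℂ) := fun t => by
    have := (hillFlow_im hV x 1 0 t).1
    exact Complex.ext (by simp) (by simpa using this)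
  have hz : ∀ t, (hillFlow V x (0, 1) t).1 = ((hillFlow V x (0, 1) t).1.re : ℂ) := fun t => by
    have := (hillFlow_im hV x 0 1 t).1
    exact Complex.ext (by simp) (by simpa using this)
  refine ⟨fun t => (hillFlow V x (1, 0) t).1.re, fun t => (hillFlow V x (0, 1) t).1.re,
    Complex.continuous_re.comp (continuous_fst.comp (isSol_hillFlow hV _ _).continuous),
    Complex.continuous_re.comp (continuous_fst.comp (isSol_hillFlow hV _ _).continuous),
    hy, hz, by simp [hillFlow_zero hV], by simp [hillFlow_zero hV], fun a b hab => ?_⟩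
  have h := integral_normSq_pos (isSol_hillFlow hV x ((a : ℂ), (b : ℂ))) (by
    rw [hillFlow_zero hV]
    intro h
    apply hab
    rw [Prod.mk_eq_zero] at h ⊢
    exact_mod_cast h)
  convert h using 2
  funext t
  rw [hillFlow_eq_comb hV]
  simp only [Prod.fst_add, Prod.smul_fst, smul_eq_mul]
  rw [hy, hz]
  rw [← Complex.ofReal_mul, ← Complex.ofReal_mul, ← Complex.ofReal_add, Complex.norm_real]
  simp

/-- The discriminant at real spectral parameters: its derivative is the integral of a real
quadratic form in the fundamental solutions whose discriminant is `Δ² - 4`. -/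
lemma exists_deriv_form (x : ℝ) : ∃ A B C D : ℝ, ∃ y z : ℝ → ℝ, Continuous y ∧ Continuous z ∧
    (∀ t, (hillFlow V x (1, 0) t).1 = y t) ∧ (∀ t, (hillFlow V x (0, 1) t).1 = z t) ∧
    y 0 = 1 ∧ z 0 = 0 ∧ (∀ a b : ℝ, (a, b) ≠ 0 → 0 < ∫ t in (0 : ℝ)..1, (a * y t + b * z t) ^ 2) ∧
    (hillFlow V x (1, 0) 1).1 = A ∧ (hillFlow V x (0, 1) 1).1 = B ∧
    (hillFlow V x (1, 0) 1).2 = C ∧ (hillFlow V x (0, 1) 1).2 = D ∧ A * D - C * B = 1 ∧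
    HasDerivAt (fun s : ℝ => (hillDisc V s).re)
      (∫ t in (0 : ℝ)..1, ((A - D) * (y t * z t) - B * (y t) ^ 2 + C * (z t) ^ 2)) x := by
  obtain ⟨y, z, hyc, hzc, hy, hz, hy0, hz0, hpos⟩ := exists_real_fundamental hV x
  have hC : (hillFlow V x (1, 0) 1).2 = ((hillFlow V x (1, 0) 1).2.re : ℂ) := by
    have := (hillFlow_im hV x 1 0 1).2
    exact Complex.ext (by simp) (by simpa using this)
  have hD : (hillFlow V x (0, 1) 1).2 = ((hillFlow V x (0, 1) 1).2.re : ℂ) := by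
    have := (hillFlow_im hV x 0 1 1).2
    exact Complex.ext (by simp) (by simpa using this)
  refine ⟨y 1, z 1, (hillFlow V x (1, 0) 1).2.re, (hillFlow V x (0, 1) 1).2.re, y, z, hyc, hzc,
    hy, hz, hy0, hz0, hpos, hy 1, hz 1, hC, hD, ?_, ?_⟩
  · have := wronskian_eq_one hV (x : ℂ) 1
    rw [hy, hz, hC, hD] at this
    exact_mod_cast this
  · have h := (hasDerivAt_hillDisc hV (x : ℂ)).real_of_complex
    convert h using 1
    rw [hC, hD, hy, hz]
    have o : ∀ u w : ℝ → ℝ, (∫ t in (0 : ℝ)..1, (u t : ℂ) * (w t : ℂ)) =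
        ((∫ t in (0 : ℝ)..1, u t * w t : ℝ) : ℂ) := fun u w => by
      rw [← intervalIntegral.integral_ofReal]; simp
    simp only [overlap, hy, hz, o]
    simp only [← Complex.ofReal_mul, ← Complex.ofReal_sub, ← Complex.ofReal_add, Complex.ofReal_re]
    rw [intervalIntegral.integral_add, intervalIntegral.integral_sub,
      intervalIntegral.integral_const_mul, intervalIntegral.integral_const_mul,
      intervalIntegral.integral_const_mul]
    · have e1 : ∫ t in (0 : ℝ)..1, z t * y t = ∫ t in (0 : ℝ)..1, y t * z t := by
        congr 1; funext t; ring
      have e2 : ∫ t in (0 : ℝ)..1, y t ^ 2 = ∫ t in (0 : ℝ)..1, y t * y t := by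
        congr 1; funext t; ring
      have e3 : ∫ t in (0 : ℝ)..1, z t ^ 2 = ∫ t in (0 : ℝ)..1, z t * z t := by
        congr 1; funext t; ring
      rw [e1, e2, e3]; ring
    all_goals exact Continuous.intervalIntegrable (by fun_prop) _ _

/-- Inside the bands, where `|Δ| < 2`, the discriminant has no critical point. -/
lemma deriv_hillDisc_ne_zero {x : ℝ} (h : |(hillDisc V x).re| < 2) :
    deriv (fun s : ℝ => (hillDisc V s).re) x ≠ 0 := by
  obtain ⟨A, B, C, D, y, z, hyc, hzc, hy, hz, hy0, hz0, hpos, hA, hB, hC, hD, hdet, hd⟩ :=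
    exists_deriv_form hV x
  rw [hd.deriv]
  have hΔ : (hillDisc V x).re = A + D := by simp [hillDisc, hA, hD]
  rw [hΔ] at h
  have h4 : (A + D) ^ 2 < 4 := by nlinarith [abs_lt.1 h, sq_abs (A + D), abs_nonneg (A + D)]
  -- if `B = 0` then `A D = 1` and `(A + D) ^ 2 ≥ 4`
  have hB0 : B ≠ 0 := by
    rintro rfl
    nlinarith [sq_nonneg (A - D)]
  intro h0
  -- completing the square shows that `-4 B` times the quadratic form has a positive integral
  have h1 : 0 < ∫ t in (0 : ℝ)..1, (2 * B * y t + -(A - D) * z t) ^ 2 :=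
    hpos _ _ (by simp [hB0])
  have h2 : ∫ t in (0 : ℝ)..1, (2 * B * y t + -(A - D) * z t) ^ 2 ≤
      ∫ t in (0 : ℝ)..1, -4 * B * ((A - D) * (y t * z t) - B * (y t) ^ 2 + C * (z t) ^ 2) := by
    refine intervalIntegral.integral_mono (by norm_num)
      (Continuous.intervalIntegrable (by fun_prop) _ _)
      (Continuous.intervalIntegrable (by fun_prop) _ _) fun t => ?_
    have : 0 ≤ (4 - (A + D) ^ 2) * z t ^ 2 := mul_nonneg (by linarith) (sq_nonneg _)
    have e : (4 - (A + D) ^ 2) * z t ^ 2 = (4 * (A * D - C * B) - (A + D) ^ 2) * z t ^ 2 := by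
      rw [hdet]; ring
    nlinarith
  rw [intervalIntegral.integral_const_mul, h0, mul_zero] at h2
  linarith

/-- A critical point of the discriminant with value `±2` is a point where the monodromy matrix is
`±1`. -/
lemma monodromy_scalar_of_deriv_eq_zero {x : ℝ} (h : (hillDisc V x).re ^ 2 = 4)
    (h0 : deriv (fun s : ℝ => (hillDisc V s).re) x = 0) :
    ∃ σ : ℝ, σ ^ 2 = 1 ∧ (hillFlow V x (1, 0) 1).1 = σ ∧ (hillFlow V x (0, 1) 1).1 = 0 ∧
      (hillFlow V x (1, 0) 1).2 = 0 ∧ (hillFlow V x (0, 1) 1).2 = σ := by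
  obtain ⟨A, B, C, D, y, z, hyc, hzc, hy, hz, hy0, hz0, hpos, hA, hB, hC, hD, hdet, hd⟩ :=
    exists_deriv_form hV x
  rw [hd.deriv] at h0
  have hΔ : (hillDisc V x).re = A + D := by simp [hillDisc, hA, hD]
  rw [hΔ] at h
  -- now `-4 B` times the quadratic form is a square, so its integral can vanish only if it is zero
  have key : ∫ t in (0 : ℝ)..1, (2 * B * y t + -(A - D) * z t) ^ 2 = 0 := by
    have : ∫ t in (0 : ℝ)..1, (2 * B * y t + -(A - D) * z t) ^ 2 =
      ∫ t in (0 : ℝ)..1, -4 * B * ((A - D) * (y t * z t) - B * (y t) ^ 2 + C * (z t) ^ 2) := by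
      congr 1
      funext t
      linear_combination ((h - 4 * hdet) * z t ^ 2)
    rw [this, intervalIntegral.integral_const_mul, h0, mul_zero]
  have h2 : (2 * B, -(A - D)) = (0 : ℝ × ℝ) := by
    by_contra hne
    exact (hpos _ _ hne).ne' key
  rw [Prod.mk_eq_zero] at h2
  obtain rfl : B = 0 := by linarith [h2.1]
  obtain rfl : A = D := by linarith [h2.2]
  have hC0 : C = 0 := by
    by_contra hne
    have h3 := hpos 0 1 (by simp)
    have e : ∫ t in (0 : ℝ)..1, ((A - A) * (y t * z t) - 0 * (y t) ^ 2 + C * (z t) ^ 2) =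
        C * ∫ t in (0 : ℝ)..1, (0 * y t + 1 * z t) ^ 2 := by
      rw [← intervalIntegral.integral_const_mul]
      congr 1; funext t; ring
    rw [e] at h0
    exact (mul_ne_zero hne h3.ne') h0
  refine ⟨A, by linarith, hA, by simpa using hB, by simpa [hC0] using hC, hD⟩

/-- Near a point where the monodromy matrix is `σ = ±1`, the discriminant is `σ (2 - h² κ)` with
a positive limit of `κ`: the Gram determinant of the fundamental solutions. -/
lemma exists_scalar_expansion {x σ : ℝ} (hA : (hillFlow V x (1, 0) 1).1 = σ)
    (hB : (hillFlow V x (0, 1) 1).1 = 0) (hC : (hillFlow V x (1, 0) 1).2 = 0)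
    (hD : (hillFlow V x (0, 1) 1).2 = σ) :
    ∃ κ : ℂ → ℂ, Continuous κ ∧ (κ x).im = 0 ∧ 0 < (κ x).re ∧
      ∀ lam : ℂ, hillDisc V lam = σ * (2 - (lam - x) ^ 2 * κ lam) := by
  obtain ⟨y, z, hyc, hzc, hy, hz, hy0, hz0, hpos⟩ := exists_real_fundamental hV x
  have h11 := continuous_overlap hV x (1, 0) (1, 0)
  have h12 := continuous_overlap hV x (1, 0) (0, 1)
  have h21 := continuous_overlap hV x (0, 1) (1, 0)
  have h22 := continuous_overlap hV x (0, 1) (0, 1)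
  have o : ∀ u w : ℝ → ℝ, (∫ t in (0 : ℝ)..1, (u t : ℂ) * (w t : ℂ)) =
        ((∫ t in (0 : ℝ)..1, u t * w t : ℝ) : ℂ) := fun u w => by
      rw [← intervalIntegral.integral_ofReal]; simp
  set p := ∫ t in (0 : ℝ)..1, y t * y t with hp
  set r := ∫ t in (0 : ℝ)..1, z t * z t with hr
  set b := ∫ t in (0 : ℝ)..1, y t * z t with hb
  have hexp : ∀ a c : ℝ, ∫ t in (0 : ℝ)..1, (a * y t + c * z t) ^ 2 =
      a ^ 2 * p + 2 * a * c * b + c ^ 2 * r := by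
    intro a c
    rw [hp, hr, hb, ← intervalIntegral.integral_const_mul, ← intervalIntegral.integral_const_mul,
      ← intervalIntegral.integral_const_mul, ← intervalIntegral.integral_add,
      ← intervalIntegral.integral_add]
    · congr 1; funext t; ring
    all_goals exact Continuous.intervalIntegrable (by fun_prop) _ _
  have hr0 : 0 < r := by
    have := hpos 0 1 (by simp)
    rw [hexp] at this; linarith
  -- the strict Cauchy-Schwarz inequality for the independent functions `y` and `z`
  have hdet : 0 < p * r - b * b := by
    have := hpos r (-b) (by simp [hr0.ne'])
    rw [hexp] at this
    have e : r ^ 2 * p + 2 * r * -b * b + (-b) ^ 2 * r = r * (p * r - b * b) := by ring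
    rw [e] at this
    exact (pos_iff_pos_of_mul_pos this).1 hr0
  have hval : overlap (hillFlow V x (1, 0)) (hillFlow V x (1, 0)) *
          overlap (hillFlow V x (0, 1)) (hillFlow V x (0, 1)) -
        overlap (hillFlow V x (1, 0)) (hillFlow V x (0, 1)) *
          overlap (hillFlow V x (0, 1)) (hillFlow V x (1, 0)) = ((p * r - b * b : ℝ) : ℂ) := by
    have e1 : ∫ t in (0 : ℝ)..1, z t * y t = b := by
      rw [hb]; congr 1; funext t; ring
    simp only [overlap, hy, hz, o, e1]
    push_cast
    rfl
  refine ⟨fun lam => overlap (hillFlow V x (1, 0)) (hillFlow V lam (1, 0)) *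
          overlap (hillFlow V x (0, 1)) (hillFlow V lam (0, 1)) -
        overlap (hillFlow V x (1, 0)) (hillFlow V lam (0, 1)) *
          overlap (hillFlow V x (0, 1)) (hillFlow V lam (1, 0)), by fun_prop, ?_, ?_,
    hillDisc_eq_of_scalar hV hA hB hC hD⟩
  · simp only [hval, Complex.ofReal_im]
  · simp only [hval, Complex.ofReal_re, hdet]

/-! ### Reality and semi-boundedness of the periodic spectrum -/

/-- If `Δ = 2 σ` with `σ² = 1`, there is a nontrivial solution with multiplier `σ`: since the
monodromy matrix has determinant one, `σ` is an eigenvalue of it. -/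
lemma exists_multiplier_solution {lam σ : ℂ} (hσ : σ ^ 2 = 1) (h : hillDisc V lam = 2 * σ) :
    ∃ v : ℂ × ℂ, v ≠ 0 ∧ hillFlow V lam v 1 = σ • v := by
  have hw := wronskian_eq_one hV lam 1
  rw [hillDisc] at h
  set A := (hillFlow V lam (1, 0) 1).1 with hA
  set C := (hillFlow V lam (1, 0) 1).2 with hC
  set B := (hillFlow V lam (0, 1) 1).1 with hB
  set D := (hillFlow V lam (0, 1) 1).2 with hD
  have hv : ∀ v : ℂ × ℂ, hillFlow V lam v 1 = (v.1 * A + v.2 * B, v.1 * C + v.2 * D) := fun v => by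
    rw [hillFlow_eq_comb hV]
    ext <;> simp [hA, hB, hC, hD]
  have hfun : ∀ v : ℂ × ℂ, v.1 * A + v.2 * B = σ * v.1 → v.1 * C + v.2 * D = σ * v.2 →
      hillFlow V lam v 1 = σ • v := fun v h1 h2 => by
    rw [hv, h1, h2]; rfl
  by_cases hB0 : B = 0
  · by_cases hC0 : C = 0
    · rw [hB0] at hw
      have hAD : A * D = 1 := by linear_combination hw
      have h1 : A = σ := by
        have : (A - σ) ^ 2 = 0 := by linear_combination hσ + A * h - hAD
        exact sub_eq_zero.1 (pow_eq_zero_iff (by norm_num) |>.1 this)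
      exact ⟨(1, 0), by simp, hfun _ (by simp [h1]) (by simp [hC0])⟩
    · refine ⟨(σ - D, C), by simp [hC0], hfun _ ?_ ?_⟩
      · simp only; linear_combination hσ - hw + σ * h
      · simp only; ring
  · refine ⟨(B, σ - A), by simp [hB0], hfun _ ?_ ?_⟩
    · simp only; ring
    · simp only; linear_combination hσ - hw + σ * h

/-- The energy identity for solutions with multiplier `±1`: the boundary terms of the integration by
parts cancel. -/
lemma energy_identity {lam σ : ℂ} (hσ : σ = 1 ∨ σ = -1) {Y : ℝ → ℂ × ℂ}
    (hY : IsSol (hillCoeff V lam) Y) (h1 : Y 1 = σ • Y 0) :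
    (∫ t in (0 : ℝ)..1, (‖(Y t).2‖ ^ 2 + V t * ‖(Y t).1‖ ^ 2) : ℝ) =
      lam * (∫ t in (0 : ℝ)..1, ‖(Y t).1‖ ^ 2 : ℝ) := by
  have hc : IsPrim (fun t => starRingEnd ℂ (Y t).2) (fun t => starRingEnd ℂ (Y t).1) := by
    simpa using hY.fst.clm (Complex.conjCLE : ℂ →L[ℝ] ℂ)
  have hp := (hc.mul hY.snd).sub_eq 0 1
  have hb : starRingEnd ℂ (Y 1).1 * (Y 1).2 = starRingEnd ℂ (Y 0).1 * (Y 0).2 := by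
    rw [h1]
    rcases hσ with rfl | rfl <;> simp
  simp only [hb, sub_self] at hp
  have hn1 : Continuous fun t => ‖(Y t).1‖ ^ 2 := ((continuous_fst.comp hY.continuous).norm).pow 2
  have hn2 : Continuous fun t => ‖(Y t).2‖ ^ 2 := ((continuous_snd.comp hY.continuous).norm).pow 2
  have hI : IntervalIntegrable (fun t => ‖(Y t).2‖ ^ 2 + V t * ‖(Y t).1‖ ^ 2) volume 0 1 :=
    (hn2.intervalIntegrable _ _).add ((hV 0 1).mul_continuousOn hn1.continuousOn)
  have hI1 : IntervalIntegrable (fun t => ‖(Y t).1‖ ^ 2) volume 0 1 := hn1.intervalIntegrable _ _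
  have hI' : IntervalIntegrable (fun t => ((‖(Y t).2‖ ^ 2 + V t * ‖(Y t).1‖ ^ 2 : ℝ) : ℂ))
    volume 0 1 := ⟨hI.1.ofReal, hI.2.ofReal⟩
  have hI1' : IntervalIntegrable (fun t => ((‖(Y t).1‖ ^ 2 : ℝ) : ℂ)) volume 0 1 :=
    ⟨hI1.1.ofReal, hI1.2.ofReal⟩
  rw [← intervalIntegral.integral_ofReal, ← intervalIntegral.integral_ofReal,
    ← intervalIntegral.integral_const_mul, ← sub_eq_zero,
    ← intervalIntegral.integral_sub hI' (hI1'.const_mul _), hp]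
  congr 1
  funext t
  have e1 := Complex.conj_mul' (Y t).1
  have e2 := Complex.conj_mul' (Y t).2
  simp only [hillCoeff]
  push_cast
  rw [← e1, ← e2]
  ring

/-- Points where `Δ = ±2` are real and bounded below. The imaginary part of the energy identity gives
the first claim. For the second the potential energy is absorbed in the kinetic one, as
`sup |y|² ≤ ∫ |y|² + 2 ∫ |y y'|`. -/
lemma real_of_hillDisc_sq {lam : ℂ} (h : hillDisc V lam ^ 2 = 4) :
    lam.im = 0 ∧ -((∫ t in (0 : ℝ)..1, |V t|) + (∫ t in (0 : ℝ)..1, |V t|) ^ 2) ≤ lam.re := by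
  obtain ⟨σ, hσ, hΔ⟩ : ∃ σ : ℂ, (σ = 1 ∨ σ = -1) ∧ hillDisc V lam = 2 * σ := by
    have : (hillDisc V lam - 2) * (hillDisc V lam + 2) = 0 := by linear_combination h
    rcases mul_eq_zero.1 this with h1 | h1
    · exact ⟨1, Or.inl rfl, by linear_combination h1⟩
    · exact ⟨-1, Or.inr rfl, by linear_combination h1⟩
  obtain ⟨v, hv0, hv⟩ := exists_multiplier_solution hV
    (by rcases hσ with rfl | rfl <;> norm_num) hΔ
  set Y := hillFlow V lam v with hYd
  have hY : IsSol (hillCoeff V lam) Y := isSol_hillFlow hV lam v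
  have hY0 : Y 0 = v := hillFlow_zero hV lam v
  have hE := energy_identity hV hσ hY (by rw [hY0, hv])
  have hm := integral_normSq_pos hY (by rw [hY0]; exact hv0)
  set m := ∫ t in (0 : ℝ)..1, ‖(Y t).1‖ ^ 2 with hmd
  have hre := congrArg Complex.re hE
  have him := congrArg Complex.im hE
  simp only [Complex.ofReal_re, Complex.ofReal_im, Complex.mul_re, Complex.mul_im, mul_zero,
    sub_zero, zero_add] at hre him
  refine ⟨by rcases mul_eq_zero.1 him.symm with h | h; exacts [h, absurd h hm.ne'], ?_⟩
  set K := ∫ t in (0 : ℝ)..1, |V t| with hK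
  have hn1 : Continuous fun t => ‖(Y t).1‖ := (continuous_fst.comp hY.continuous).norm
  have hn2 : Continuous fun t => ‖(Y t).2‖ := (continuous_snd.comp hY.continuous).norm
  set d := ∫ t in (0 : ℝ)..1, 2 * (‖(Y t).1‖ * ‖(Y t).2‖) with hd
  have hK0 : 0 ≤ K := intervalIntegral.integral_nonneg (by norm_num) fun t _ => abs_nonneg _
  -- a pointwise bound by averaging over the base point
  have hsup : ∀ x ∈ Icc (0 : ℝ) 1, ‖(Y x).1‖ ^ 2 ≤ m + d := by
    intro x hx
    have hc : IsPrim (fun t => starRingEnd ℂ (Y t).2) (fun t => starRingEnd ℂ (Y t).1) := by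
      simpa using hY.fst.clm (Complex.conjCLE : ℂ →L[ℝ] ℂ)
    have hp := hc.mul hY.fst
    have hz : ∀ s ∈ Icc (0 : ℝ) 1, ‖(Y x).1‖ ^ 2 ≤ ‖(Y s).1‖ ^ 2 + d := by
      intro s hs
      have e := hp.sub_eq s x
      rw [Complex.conj_mul', Complex.conj_mul'] at e
      have h1 : ‖(((‖(Y x).1‖ : ℂ)) ^ 2 - ((‖(Y s).1‖ : ℂ)) ^ 2)‖ ≤
          |∫ t in s..x, 2 * (‖(Y t).1‖ * ‖(Y t).2‖)| := by
        rw [e]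
        refine intervalIntegral.norm_integral_le_abs_of_norm_le (Eventually.of_forall fun t => ?_)
          (Continuous.intervalIntegrable (by fun_prop) _ _)
        refine (norm_add_le _ _).trans (le_of_eq ?_)
        rw [norm_mul, norm_mul, RCLike.norm_conj, RCLike.norm_conj]
        ring
      have h2 : |∫ t in s..x, 2 * (‖(Y t).1‖ * ‖(Y t).2‖)| ≤ d := by
        rw [hd, ← abs_of_nonneg (intervalIntegral.integral_nonneg (by norm_num)
          (fun t _ => by positivity) : 0 ≤ ∫ t in (0 : ℝ)..1, 2 * (‖(Y t).1‖ * ‖(Y t).2‖))]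
        refine intervalIntegral.abs_integral_mono_interval ?_
          (Eventually.of_forall fun t => by positivity) (Continuous.intervalIntegrable (by fun_prop) _ _)
        intro t ht
        rw [uIoc_of_le (by norm_num)]
        rcases mem_uIoc.1 ht with h | h <;> constructor <;> linarith [h.1, h.2, hs.1, hs.2, hx.1, hx.2]
      have h3 : ‖(Y x).1‖ ^ 2 - ‖(Y s).1‖ ^ 2 ≤ d := by
        refine le_trans (le_trans (le_abs_self _) (le_of_eq ?_)) (h1.trans h2)
        rw [← Complex.ofReal_pow, ← Complex.ofReal_pow, ← Complex.ofReal_sub, Complex.norm_real,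
          Real.norm_eq_abs]
      linarith
    have := intervalIntegral.integral_mono_on (μ := volume) (zero_le_one' ℝ)
      (intervalIntegrable_const (c := ‖(Y x).1‖ ^ 2))
      (Continuous.intervalIntegrable (by fun_prop) 0 1) hz
    rw [intervalIntegral.integral_add (Continuous.intervalIntegrable (by fun_prop) _ _)
      intervalIntegrable_const] at this
    simpa using this
  have hm0 := hm.le
  have hd0 : 0 ≤ d := intervalIntegral.integral_nonneg (by norm_num) fun t _ => by positivity
  have hVa : IntervalIntegrable (fun t => |V t|) volume 0 1 := (hV 0 1).abs
  set S := ∫ t in (0 : ℝ)..1, ‖(Y t).2‖ ^ 2 with hS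
  -- pointwise `2 K |y| |y'| ≤ K² |y|² + |y'|²`
  have hKd : K * d ≤ K ^ 2 * m + S := by
    rw [hd, hmd, hS, ← intervalIntegral.integral_const_mul, ← intervalIntegral.integral_const_mul,
      ← intervalIntegral.integral_add (Continuous.intervalIntegrable (by fun_prop) _ _)
        (Continuous.intervalIntegrable (by fun_prop) _ _)]
    refine intervalIntegral.integral_mono (by norm_num)
      (Continuous.intervalIntegrable (by fun_prop) _ _)
      (Continuous.intervalIntegrable (by fun_prop) _ _) fun t => ?_
    simp only
    nlinarith [sq_nonneg (K * ‖(Y t).1‖ - ‖(Y t).2‖)]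
  have hlow : S - K * (m + d) ≤ ∫ t in (0 : ℝ)..1, (‖(Y t).2‖ ^ 2 + V t * ‖(Y t).1‖ ^ 2) := by
    have hIm : IntervalIntegrable (fun t => |V t| * (m + d)) volume 0 1 := hVa.mul_const _
    have hIs : IntervalIntegrable (fun t => ‖(Y t).2‖ ^ 2) volume 0 1 :=
      Continuous.intervalIntegrable (by fun_prop) _ _
    have hIv : IntervalIntegrable (fun t => V t * ‖(Y t).1‖ ^ 2) volume 0 1 :=
      (hV 0 1).mul_continuousOn (hn1.pow 2).continuousOn
    rw [hS, hK, ← intervalIntegral.integral_mul_const, ← intervalIntegral.integral_sub hIs hIm]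
    refine intervalIntegral.integral_mono_on (by norm_num) (hIs.sub hIm) (hIs.add hIv)
      fun t ht => ?_
    have h1 := hsup t ht
    have h2 : -(|V t| * ‖(Y t).1‖ ^ 2) ≤ V t * ‖(Y t).1‖ ^ 2 := by
      have := mul_le_mul_of_nonneg_right (neg_abs_le (V t)) (sq_nonneg ‖(Y t).1‖)
      linarith
    have h3 : |V t| * ‖(Y t).1‖ ^ 2 ≤ |V t| * (m + d) := by gcongr
    linarith
  rw [hre] at hlow
  have : -(K + K ^ 2) * m ≤ lam.re * m := by linarith
  exact le_of_mul_le_mul_right this hm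

end Disc

/-! ### Comparison with the free discriminant -/

lemma Complex.norm_cos_le_exp (z : ℂ) : ‖Complex.cos z‖ ≤ Real.exp |z.im| := by
  have h1 : ‖Complex.exp (z * Complex.I)‖ ≤ Real.exp |z.im| := by
    rw [Complex.norm_exp]; simp [neg_le_abs]
  have h2 : ‖Complex.exp (-z * Complex.I)‖ ≤ Real.exp |z.im| := by
    rw [Complex.norm_exp]; simp [le_abs_self]
  rw [Complex.cos, norm_div]
  have := norm_add_le (Complex.exp (z * Complex.I)) (Complex.exp (-z * Complex.I))
  simp only [Complex.norm_ofNat]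
  linarith

lemma Complex.norm_sin_le_exp (z : ℂ) : ‖Complex.sin z‖ ≤ Real.exp |z.im| := by
  have h1 : ‖Complex.exp (z * Complex.I)‖ ≤ Real.exp |z.im| := by
    rw [Complex.norm_exp]; simp [neg_le_abs]
  have h2 : ‖Complex.exp (-z * Complex.I)‖ ≤ Real.exp |z.im| := by
    rw [Complex.norm_exp]; simp [le_abs_self]
  rw [Complex.sin, norm_div, norm_mul, Complex.norm_I]
  have := norm_sub_le (Complex.exp (-z * Complex.I)) (Complex.exp (z * Complex.I))
  simp only [Complex.norm_ofNat]
  linarith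

section Free

variable {V : ℝ → ℝ} {ν : ℂ}

lemma isPrim_sin_comp (x : ℝ) :
    IsPrim (fun t : ℝ => -(ν * Complex.cos (ν * (x - t)))) (fun t : ℝ => Complex.sin (ν * (x - t))) := by
  refine IsPrim.of_hasDerivAt (fun t => ?_) (by fun_prop)
  have h : HasDerivAt (fun t : ℝ => ν * ((x : ℂ) - t)) (ν * -1) t :=
    ((Complex.ofRealCLM.hasDerivAt (x := t)).const_sub (x : ℂ)).const_mul ν
  have h2 : HasDerivAt (fun t : ℝ => Complex.sin (ν * (x - t))) (Complex.cos (ν * (x - t)) * (ν * -1)) t :=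
    (Complex.hasDerivAt_sin (ν * ((x : ℂ) - t))).comp_of_eq t h rfl
  exact h2.congr_deriv (by ring)

lemma isPrim_cos_comp (x : ℝ) :
    IsPrim (fun t : ℝ => ν * Complex.sin (ν * (x - t))) (fun t : ℝ => Complex.cos (ν * (x - t))) := by
  refine IsPrim.of_hasDerivAt (fun t => ?_) (by fun_prop)
  have h : HasDerivAt (fun t : ℝ => ν * ((x : ℂ) - t)) (ν * -1) t :=
    ((Complex.ofRealCLM.hasDerivAt (x := t)).const_sub (x : ℂ)).const_mul ν
  have h2 : HasDerivAt (fun t : ℝ => Complex.cos (ν * (x - t))) (-Complex.sin (ν * (x - t)) * (ν * -1)) t :=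
    (Complex.hasDerivAt_cos (ν * ((x : ℂ) - t))).comp_of_eq t h rfl
  exact h2.congr_deriv (by ring)

/-- Variation of constants for the solution. -/
lemma fst_eq_free_add (hν : ν ≠ 0) {Y : ℝ → ℂ × ℂ} (hY : IsSol (hillCoeff V (ν ^ 2)) Y) (x : ℝ) :
    (Y x).1 = (Y 0).1 * Complex.cos (ν * x) + (Y 0).2 * (Complex.sin (ν * x) / ν) +
      ∫ t in (0 : ℝ)..x, Complex.sin (ν * (x - t)) / ν * (V t * (Y t).1) := by
  have h := (((isPrim_sin_comp (ν := ν) x).mul hY.snd).sub (((isPrim_cos_comp (ν := ν) x).mul hY.fst).clm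
    ((-ν) • ContinuousLinearMap.id ℝ ℂ))).sub_eq 0 x
  have e : ∀ t : ℝ, Complex.sin (ν * (x - t)) / ν * (V t * (Y t).1) =
      ν⁻¹ * (-(ν * Complex.cos (ν * (x - t))) * (Y t).2 +
        Complex.sin (ν * (x - t)) * (hillCoeff V (ν ^ 2) t * (Y t).1) -
        ((-ν) • ContinuousLinearMap.id ℝ ℂ) (ν * Complex.sin (ν * (x - t)) * (Y t).1 +
          Complex.cos (ν * (x - t)) * (Y t).2)) := fun t => by
    simp [hillCoeff]; field_simp; ring
  simp only [e]
  rw [intervalIntegral.integral_const_mul, ← h]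
  simp
  field_simp
  ring

/-- Variation of constants for the derivative of the solution. -/
lemma snd_eq_free_add {Y : ℝ → ℂ × ℂ} (hY : IsSol (hillCoeff V (ν ^ 2)) Y) (x : ℝ) :
    (Y x).2 = (Y 0).2 * Complex.cos (ν * x) - (Y 0).1 * (ν * Complex.sin (ν * x)) +
      ∫ t in (0 : ℝ)..x, Complex.cos (ν * (x - t)) * (V t * (Y t).1) := by
  have h := (((isPrim_cos_comp (ν := ν) x).mul hY.snd).sub (((isPrim_sin_comp (ν := ν) x).mul hY.fst).clm
    (ν • ContinuousLinearMap.id ℝ ℂ))).sub_eq 0 x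
  have e : ∀ t : ℝ, Complex.cos (ν * (x - t)) * (V t * (Y t).1) =
      (ν * Complex.sin (ν * (x - t)) * (Y t).2 +
        Complex.cos (ν * (x - t)) * (hillCoeff V (ν ^ 2) t * (Y t).1) -
        (ν • ContinuousLinearMap.id ℝ ℂ) (-(ν * Complex.cos (ν * (x - t))) * (Y t).1 +
          Complex.sin (ν * (x - t)) * (Y t).2)) := fun t => by
    simp [hillCoeff]; ring
  simp only [e]
  rw [← h]
  simp
  ring

variable (hV : ∀ a b : ℝ, IntervalIntegrable V volume a b)
include hV

/-- If the solution for the zero potential grows at most like `c exp (|Im ν| x)`, the solution with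
the same initial values does so with a larger constant. Grönwall's inequality is applied after
removal of the exponential factor. -/
lemma norm_fst_le_exp (hν : ν ≠ 0) {Y : ℝ → ℂ × ℂ} (hY : IsSol (hillCoeff V (ν ^ 2)) Y) {c : ℝ}
    (hc : ∀ x : ℝ, 0 ≤ x → ‖(Y 0).1 * Complex.cos (ν * x) + (Y 0).2 * (Complex.sin (ν * x) / ν)‖ ≤
      c * Real.exp (|ν.im| * x)) {x : ℝ} (hx : x ∈ Icc (0 : ℝ) 1) :
    ‖(Y x).1‖ ≤ c * Real.exp ((∫ t in (0 : ℝ)..1, |V t|) / ‖ν‖) * Real.exp (|ν.im| * x) := by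
  set η := |ν.im|
  have hν' : 0 < ‖ν‖ := norm_pos_iff.2 hν
  have hc0 : 0 ≤ c := by simpa using (norm_nonneg _).trans (hc 0 le_rfl)
  have hy : Continuous fun t => ‖(Y t).1‖ := (continuous_fst.comp hY.continuous).norm
  have hVa : ∀ a b : ℝ, IntervalIntegrable (fun t => |V t| / ‖ν‖) volume a b := fun a b =>
    (hV a b).abs.div_const _
  have key := gronwall_right (n := fun t => ‖(Y t).1‖ * Real.exp (-(η * t))) (c := c) (X := 1)
    (by fun_prop) hVa (fun t => by positivity) (fun y hy0 => ?_) x hx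
  · have h1 : ∫ t in (0 : ℝ)..x, |V t| / ‖ν‖ ≤ (∫ t in (0 : ℝ)..1, |V t|) / ‖ν‖ := by
      rw [← intervalIntegral.integral_div]
      exact intervalIntegral.integral_mono_interval le_rfl hx.1 hx.2
        (Eventually.of_forall fun t => by positivity) (hVa 0 1)
    calc ‖(Y x).1‖ = ‖(Y x).1‖ * Real.exp (-(η * x)) * Real.exp (η * x) := by
          rw [mul_assoc, ← Real.exp_add]; simp
      _ ≤ c * Real.exp (∫ t in (0 : ℝ)..x, |V t| / ‖ν‖) * Real.exp (η * x) := by gcongr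
      _ ≤ _ := by gcongr
  · have hI : IntervalIntegrable (fun t => |V t| / ‖ν‖ * (‖(Y t).1‖ * Real.exp (-(η * t)))) volume 0 y :=
      (hVa 0 y).mul_continuousOn (by fun_prop)
    have h2 : ‖∫ t in (0 : ℝ)..y, Complex.sin (ν * (y - t)) / ν * (V t * (Y t).1)‖ ≤
        Real.exp (η * y) * ∫ t in (0 : ℝ)..y, |V t| / ‖ν‖ * (‖(Y t).1‖ * Real.exp (-(η * t))) := by
      rw [← intervalIntegral.integral_const_mul]
      refine intervalIntegral.norm_integral_le_of_norm_le hy0.1 (Eventually.of_forall fun t ht => ?_)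
        (hI.const_mul _)
      have h3 : ‖Complex.sin (ν * (y - t))‖ ≤ Real.exp (η * y) * Real.exp (-(η * t)) := by
        refine (Complex.norm_sin_le_exp _).trans (le_of_eq ?_)
        rw [← Real.exp_add, ← Complex.ofReal_sub, Complex.im_mul_ofReal, abs_mul,
          abs_of_nonneg (by linarith [ht.2] : 0 ≤ y - t)]
        congr 1; ring
      rw [norm_mul, norm_div, norm_mul, Complex.norm_real, Real.norm_eq_abs]
      calc ‖Complex.sin (ν * (y - t))‖ / ‖ν‖ * (|V t| * ‖(Y t).1‖)
          ≤ (Real.exp (η * y) * Real.exp (-(η * t))) / ‖ν‖ * (|V t| * ‖(Y t).1‖) := by gcongr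
        _ = _ := by ring
    have h4 : ‖(Y y).1‖ ≤ c * Real.exp (η * y) + Real.exp (η * y) *
        ∫ t in (0 : ℝ)..y, |V t| / ‖ν‖ * (‖(Y t).1‖ * Real.exp (-(η * t))) := by
      rw [fst_eq_free_add hν hY y]
      exact (norm_add_le _ _).trans (add_le_add (hc y hy0.1) h2)
    calc ‖(Y y).1‖ * Real.exp (-(η * y)) ≤ (c * Real.exp (η * y) + Real.exp (η * y) *
        ∫ t in (0 : ℝ)..y, |V t| / ‖ν‖ * (‖(Y t).1‖ * Real.exp (-(η * t)))) * Real.exp (-(η * y)) := by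
          gcongr
      _ = (c + ∫ t in (0 : ℝ)..y, |V t| / ‖ν‖ * (‖(Y t).1‖ * Real.exp (-(η * t)))) *
          (Real.exp (η * y) * Real.exp (-(η * y))) := by ring
      _ = _ := by rw [← Real.exp_add]; simp

/-- The discriminant at `ν²` differs little from its value `2 cos ν` for the zero potential, by
variation of constants at `x = 1`. -/
lemma norm_hillDisc_sub_cos_le (hν : ν ≠ 0) : ‖hillDisc V (ν ^ 2) - 2 * Complex.cos ν‖ ≤
    2 * ((∫ t in (0 : ℝ)..1, |V t|) / ‖ν‖ * Real.exp ((∫ t in (0 : ℝ)..1, |V t|) / ‖ν‖)) *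
      Real.exp |ν.im| := by
  set k := (∫ t in (0 : ℝ)..1, |V t|) / ‖ν‖ with hk
  set η := |ν.im| with hη
  have hν' : 0 < ‖ν‖ := norm_pos_iff.2 hν
  have hVa : IntervalIntegrable (fun t => |V t|) volume 0 1 := (hV 0 1).abs
  have hcos : ∀ x : ℝ, 0 ≤ x → ‖Complex.cos (ν * x)‖ ≤ Real.exp (η * x) := fun x hx => by
    refine (Complex.norm_cos_le_exp _).trans (le_of_eq ?_)
    rw [Complex.im_mul_ofReal, abs_mul, abs_of_nonneg hx]
  have hsin : ∀ x : ℝ, 0 ≤ x → ‖Complex.sin (ν * x)‖ ≤ Real.exp (η * x) := fun x hx => by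
    refine (Complex.norm_sin_le_exp _).trans (le_of_eq ?_)
    rw [Complex.im_mul_ofReal, abs_mul, abs_of_nonneg hx]
  have h1 := isSol_hillFlow hV (ν ^ 2) (1, 0)
  have h2 := isSol_hillFlow hV (ν ^ 2) (0, 1)
  have b1 : ∀ t ∈ Icc (0 : ℝ) 1, ‖(hillFlow V (ν ^ 2) (1, 0) t).1‖ ≤
      1 * Real.exp k * Real.exp (η * t) := fun t ht =>
    norm_fst_le_exp hV hν h1 (fun x hx => by simpa [hillFlow_zero hV] using hcos x hx) ht
  have b2 : ∀ t ∈ Icc (0 : ℝ) 1, ‖(hillFlow V (ν ^ 2) (0, 1) t).1‖ ≤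
      1 / ‖ν‖ * Real.exp k * Real.exp (η * t) := fun t ht =>
    norm_fst_le_exp hV hν h2 (fun x hx => by
      rw [hillFlow_zero hV]
      simp only [zero_mul, one_mul, zero_add, norm_div]
      rw [div_mul_eq_mul_div, one_mul]
      gcongr
      exact hsin x hx) ht
  -- both integrals gain one factor `1 / ‖ν‖`, from the kernel or from the solution
  have hint : ∀ (f : ℝ → ℂ) (Y : ℝ → ℂ × ℂ) (c d : ℝ), 0 ≤ c → 0 ≤ d → c * d = 1 / ‖ν‖ →
      (∀ t ∈ Icc (0 : ℝ) 1, ‖f t‖ ≤ c * Real.exp (η * (1 - t))) →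
      (∀ t ∈ Icc (0 : ℝ) 1, ‖(Y t).1‖ ≤ d * Real.exp k * Real.exp (η * t)) →
      ‖∫ t in (0 : ℝ)..1, f t * (V t * (Y t).1)‖ ≤ k * Real.exp k * Real.exp η := by
    intro f Y c d hc hd hcd hf hY
    have e : k * Real.exp k * Real.exp η =
        ∫ t in (0 : ℝ)..1, |V t| * (1 / ‖ν‖ * Real.exp k * Real.exp η) := by
      rw [intervalIntegral.integral_mul_const, hk]; ring
    rw [e]
    refine intervalIntegral.norm_integral_le_of_norm_le zero_le_one
      (Eventually.of_forall fun t ht => ?_) (hVa.mul_const _)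
    have ht' : t ∈ Icc (0 : ℝ) 1 := ⟨ht.1.le, ht.2⟩
    rw [norm_mul, norm_mul, Complex.norm_real, Real.norm_eq_abs]
    calc ‖f t‖ * (|V t| * ‖(Y t).1‖)
        ≤ (c * Real.exp (η * (1 - t))) * (|V t| * (d * Real.exp k * Real.exp (η * t))) := by
          gcongr
          exacts [hf t ht', hY t ht']
      _ = |V t| * ((c * d) * Real.exp k * (Real.exp (η * (1 - t)) * Real.exp (η * t))) := by ring
      _ = _ := by
        rw [hcd, ← Real.exp_add]
        congr 3; ring_nf
  have e1 := fst_eq_free_add hν h1 1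
  have e2 := snd_eq_free_add h2 1
  simp only [hillFlow_zero hV, Complex.ofReal_one, mul_one, one_mul, zero_mul, add_zero,
    sub_zero] at e1 e2
  have i1 := hint (fun t => Complex.sin (ν * (1 - t)) / ν) (hillFlow V (ν ^ 2) (1, 0)) (1 / ‖ν‖) 1
    (by positivity) zero_le_one (by ring) (fun t ht => by
      rw [norm_div, div_mul_eq_mul_div, one_mul]
      gcongr
      have := hsin (1 - t) (by linarith [ht.2])
      simpa using this) b1
  have i2 := hint (fun t => Complex.cos (ν * (1 - t))) (hillFlow V (ν ^ 2) (0, 1)) 1 (1 / ‖ν‖)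
    zero_le_one (by positivity) (by ring) (fun t ht => by
      have := hcos (1 - t) (by linarith [ht.2])
      simpa using this) b2
  have e : hillDisc V (ν ^ 2) - 2 * Complex.cos ν =
      (∫ t in (0 : ℝ)..1, Complex.sin (ν * (1 - t)) / ν * (V t * (hillFlow V (ν ^ 2) (1, 0) t).1)) +
      ∫ t in (0 : ℝ)..1, Complex.cos (ν * (1 - t)) * (V t * (hillFlow V (ν ^ 2) (0, 1) t).1) := by
    rw [hillDisc, e1, e2]; ring
  rw [e]
  refine (norm_add_le _ _).trans ((add_le_add i1 i2).trans (le_of_eq (by ring)))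

/-- For the zero potential the discriminant is `2 cos √lam`. -/
lemma hillDisc_zero_mul (hν : ν ≠ 0) : hillDisc (fun t => 0 * V t) (ν ^ 2) = 2 * Complex.cos ν := by
  have := norm_hillDisc_sub_cos_le (V := fun t => 0 * V t) (fun a b => (hV a b).const_mul 0) hν
  simpa [sub_eq_zero] using this

/-- Below the periodic spectrum the discriminant exceeds two: this holds for the zero potential, and
the value two is never taken while the coupling constant `s` grows from zero to one. -/
lemma two_lt_hillDisc {x : ℝ}
    (hx : x < -((∫ t in (0 : ℝ)..1, |V t|) + (∫ t in (0 : ℝ)..1, |V t|) ^ 2)) :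
    2 < (hillDisc V x).re := by
  set K := ∫ t in (0 : ℝ)..1, |V t| with hK
  have hK0 : 0 ≤ K := intervalIntegral.integral_nonneg (by norm_num) fun t _ => abs_nonneg _
  have hV' : ∀ (s : ℝ) (a b : ℝ), IntervalIntegrable (fun t => s * V t) volume a b :=
    fun s a b => (hV a b).const_mul s
  set F : ℝ → ℝ := fun s => (hillDisc (fun t => s * V t) x).re with hF
  have hFc : Continuous F := Complex.continuous_re.comp ((continuous_hillDisc hV).comp
    (show Continuous fun s : ℝ => (s, (x : ℂ)) by fun_prop))
  have hne : ∀ s ∈ Icc (0 : ℝ) 1, F s ≠ 2 := by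
    intro s hs h2
    have hre : hillDisc (fun t => s * V t) x = 2 := by
      apply Complex.ext
      · simpa [hF] using h2
      · simpa using hillDisc_im (hV' s) x
    have := (real_of_hillDisc_sq (hV' s) (by rw [hre]; norm_num)).2
    have e : ∫ t in (0 : ℝ)..1, |s * V t| = s * K := by
      simp only [abs_mul, abs_of_nonneg hs.1]
      rw [intervalIntegral.integral_const_mul]
    rw [e, Complex.ofReal_re] at this
    have h1 : s * K ≤ K := by nlinarith [hs.2]
    have h3 : 0 ≤ s * K := mul_nonneg hs.1 hK0
    nlinarith
  have h0 : 2 < F 0 := by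
    have hx0 : 0 < -x := by nlinarith [sq_nonneg K]
    have hsq : (x : ℂ) = ((Real.sqrt (-x) : ℂ) * Complex.I) ^ 2 := by
      rw [mul_pow, Complex.I_sq, ← Complex.ofReal_pow, Real.sq_sqrt hx0.le]; simp
    have hpos := Real.sqrt_pos.2 hx0
    have hne0 : ((Real.sqrt (-x) : ℂ) * Complex.I) ≠ 0 :=
      mul_ne_zero (by exact_mod_cast hpos.ne') Complex.I_ne_zero
    have : F 0 = 2 * Real.cosh (Real.sqrt (-x)) := by
      simp only [hF]
      rw [hsq, hillDisc_zero_mul hV hne0, Complex.cos_mul_I, ← Complex.ofReal_cosh]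
      simp
    rw [this]
    have := Real.one_lt_cosh.2 hpos.ne'
    linarith
  have h1 : 2 < F 1 := by
    by_contra! hcon
    obtain ⟨s, hs, hs2⟩ := intermediate_value_Icc' (zero_le_one' ℝ) hFc.continuousOn ⟨hcon, h0.le⟩
    exact hne s hs hs2
  simpa [hF] using h1

end Free

/-! ### Counting the zeros of the discriminant -/

section Homotopy

variable {F : ℝ → ℝ → ℝ} {A X : ℝ}

/-- Along a continuous family of functions without critical points in the strip `|F| < 2`, distinct
zeros keep a uniform distance, because two of them enclose a point where `|F| ≥ 2`. -/
lemma exists_zero_separation (hF : Continuous fun p : ℝ × ℝ => F p.1 p.2)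
    (hd : ∀ s, Differentiable ℝ (F s)) (hne : ∀ s x, |F s x| < 2 → deriv (F s) x ≠ 0) :
    ∃ δ > 0, ∀ s ∈ Icc (0 : ℝ) 1, ∀ x ∈ Icc A X, ∀ y ∈ Icc A X, F s x = 0 → F s y = 0 →
      |x - y| < δ → x = y := by
  have hK : IsCompact (Icc (0 : ℝ) 1 ×ˢ Icc A X) := isCompact_Icc.prod isCompact_Icc
  have hu := hK.uniformContinuousOn_of_continuous hF.continuousOn
  obtain ⟨δ, hδ, h⟩ := Metric.uniformContinuousOn_iff.1 hu 2 (by norm_num)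
  refine ⟨δ, hδ, fun s hs x hx y hy hx0 hy0 hxy => ?_⟩
  wlog hlt : x < y generalizing x y
  · rcases lt_trichotomy x y with h1 | h1 | h1
    · exact absurd h1 hlt
    · exact h1
    · exact (this y hy x hx hy0 hx0 (by rwa [abs_sub_comm]) h1).symm
  exfalso
  obtain ⟨c, hc, hc0⟩ := exists_deriv_eq_zero hlt ((hd s).continuous.continuousOn)
    (by rw [hx0, hy0])
  refine hne s c ?_ hc0
  rw [abs_sub_comm, abs_of_pos (by linarith)] at hxy
  have := h (s, c) ⟨hs, hx.1.trans hc.1.le, hc.2.le.trans hy.2⟩ (s, x) ⟨hs, hx⟩ (by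
    rw [Prod.dist_eq]
    simp only [dist_self, Real.dist_eq]
    rw [abs_of_pos (by linarith [hc.1]), max_eq_right (by linarith [hc.1])]
    linarith [hc.2])
  simpa [hx0, Real.dist_eq] using this

lemma finite_of_separated {S : Set ℝ} {δ : ℝ} (hδ : 0 < δ) (hS : S ⊆ Icc A X)
    (h : ∀ x ∈ S, ∀ y ∈ S, |x - y| < δ → x = y) : S.Finite := by
  refine Set.Finite.of_finite_image (f := fun x => ⌊x / δ⌋)
    ((Set.finite_Icc ⌊A / δ⌋ ⌊X / δ⌋).subset ?_) ?_
  · rintro _ ⟨x, hx, rfl⟩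
    exact ⟨Int.floor_le_floor (by gcongr; exact (hS hx).1),
      Int.floor_le_floor (by gcongr; exact (hS hx).2)⟩
  · intro x hx y hy hxy
    refine h x hx y hy ?_
    have := Int.abs_sub_lt_one_of_floor_eq_floor hxy
    rwa [← sub_div, abs_div, abs_of_pos hδ, div_lt_one hδ] at this

/-- The number of zeros below `X` does not change along a homotopy during which no zero passes `X`
and no zero comes in from `-∞`. All zeros are simple and uniformly separated, so the number is
locally constant in `s`. -/
theorem ncard_zeros_eq_of_homotopy (hF : Continuous fun p : ℝ × ℝ => F p.1 p.2)
    (hd : ∀ s, Differentiable ℝ (F s)) (hne : ∀ s x, |F s x| < 2 → deriv (F s) x ≠ 0)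
    (hA : ∀ s ∈ Icc (0 : ℝ) 1, ∀ x ≤ A, F s x ≠ 0) (hX : ∀ s ∈ Icc (0 : ℝ) 1, F s X ≠ 0) :
    {x | F 1 x = 0 ∧ x < X}.Finite ∧
      {x | F 1 x = 0 ∧ x < X}.ncard = {x | F 0 x = 0 ∧ x < X}.ncard := by
  obtain ⟨δ, hδ, hsep⟩ := exists_zero_separation (A := A) (X := X) hF hd hne
  have hsub : ∀ s ∈ Icc (0 : ℝ) 1, ∀ x, F s x = 0 → x < X → x ∈ Icc A X := fun s hs x h0 hx =>
    ⟨by by_contra! hcon; exact hA s hs x hcon.le h0, hx.le⟩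
  have hfin : ∀ s ∈ Icc (0 : ℝ) 1, {x | F s x = 0 ∧ x < X}.Finite := fun s hs =>
    finite_of_separated hδ (fun x hx => hsub s hs x hx.1 hx.2) fun x hx y hy =>
      hsep s hs x (hsub s hs x hx.1 hx.2) y (hsub s hs y hy.1 hy.2) hx.1 hy.1
  refine ⟨hfin 1 (by simp), ?_⟩
  have hloc : ContinuousOn (fun s => {x | F s x = 0 ∧ x < X}.ncard) (Icc (0 : ℝ) 1) := by
    intro s₀ hs₀
    have : ∀ᶠ s in 𝓝[Icc (0 : ℝ) 1] s₀,
        {x | F s₀ x = 0 ∧ x < X}.ncard = {x | F s x = 0 ∧ x < X}.ncard := by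
      -- each zero persists nearby
      have h1 : ∀ z ∈ {x | F s₀ x = 0 ∧ x < X}, ∀ᶠ s in 𝓝[Icc (0 : ℝ) 1] s₀,
          ∃ w, (F s w = 0 ∧ w < X) ∧ |w - z| < δ / 3 := by
        rintro z ⟨hz0, hzX⟩
        obtain ⟨p, q, hpz, hzq, hp, hq, hqX, hpq⟩ : ∃ p q, p < z ∧ z < q ∧ z - δ / 3 < p ∧
            q < z + δ / 3 ∧ q < X ∧ F s₀ p * F s₀ q < 0 := by
          have hl : ∀ᶠ p in 𝓝[<] z, p < z ∧ z - δ / 3 < p :=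
            eventually_mem_nhdsWithin.and (nhdsWithin_le_nhds (lt_mem_nhds (by linarith)))
          have hr : ∀ᶠ q in 𝓝[>] z, z < q ∧ q < z + δ / 3 ∧ q < X :=
            eventually_mem_nhdsWithin.and (nhdsWithin_le_nhds
              ((eventually_lt_nhds (by linarith : z < z + δ / 3)).and (eventually_lt_nhds hzX)))
          rcases lt_or_gt_of_ne (hne s₀ z (by simp [hz0])) with hneg | hpos
          · have hs := eventually_nhdsWithin_sign_eq_of_deriv_neg hneg hz0
            obtain ⟨p, ⟨hp1, hp2⟩, hp3⟩ := (hl.and (nhdsWithin_le_nhds hs)).exists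
            obtain ⟨q, ⟨hq1, hq2, hq3⟩, hq4⟩ := (hr.and (nhdsWithin_le_nhds hs)).exists
            refine ⟨p, q, hp1, hq1, hp2, hq2, hq3, mul_neg_of_pos_of_neg ?_ ?_⟩
            · rw [← sign_eq_one_iff, hp3, sign_eq_one_iff]; linarith
            · rw [← sign_eq_neg_one_iff, hq4, sign_eq_neg_one_iff]; linarith
          · have hs := eventually_nhdsWithin_sign_eq_of_deriv_pos hpos hz0
            obtain ⟨p, ⟨hp1, hp2⟩, hp3⟩ := (hl.and (nhdsWithin_le_nhds hs)).exists
            obtain ⟨q, ⟨hq1, hq2, hq3⟩, hq4⟩ := (hr.and (nhdsWithin_le_nhds hs)).exists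
            refine ⟨p, q, hp1, hq1, hp2, hq2, hq3, mul_neg_of_neg_of_pos ?_ ?_⟩
            · rw [← sign_eq_neg_one_iff, hp3, sign_eq_neg_one_iff]; linarith
            · rw [← sign_eq_one_iff, hq4, sign_eq_one_iff]; linarith
        have hc : Continuous fun s => F s p * F s q :=
          (hF.comp (by fun_prop : Continuous fun s : ℝ => (s, p))).mul
            (hF.comp (by fun_prop : Continuous fun s : ℝ => (s, q)))
        have hev : ∀ᶠ s in 𝓝[Icc (0 : ℝ) 1] s₀, F s p * F s q < 0 :=
          nhdsWithin_le_nhds ((hc.tendsto s₀).eventually (gt_mem_nhds hpq))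
        filter_upwards [hev] with s hs
        have hcs : ContinuousOn (F s) (Icc p q) := (hd s).continuous.continuousOn
        obtain ⟨w, hw, hw0⟩ : ∃ w ∈ Icc p q, F s w = 0 := by
          rcases mul_neg_iff.1 hs with h | h
          · exact intermediate_value_Icc' (by linarith) hcs ⟨h.2.le, h.1.le⟩
          · exact intermediate_value_Icc (by linarith) hcs ⟨h.1.le, h.2.le⟩
        exact ⟨w, ⟨hw0, hw.2.trans_lt hqX⟩, by rw [abs_lt]; constructor <;> linarith [hw.1, hw.2]⟩
      have h1' := (eventually_all_finite (hfin s₀ hs₀)).2 h1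
      -- no zero appears elsewhere
      have h2 : ∀ᶠ s in 𝓝[Icc (0 : ℝ) 1] s₀, ∀ x ∈ Icc A X \
          ⋃ z ∈ {x | F s₀ x = 0 ∧ x < X}, Ioo (z - δ / 3) (z + δ / 3), F s x ≠ 0 := by
        have hC : IsCompact (Icc A X \ ⋃ z ∈ {x | F s₀ x = 0 ∧ x < X}, Ioo (z - δ / 3) (z + δ / 3)) :=
          isCompact_Icc.diff (isOpen_biUnion fun z _ => isOpen_Ioo)
        refine nhdsWithin_le_nhds (hC.eventually_forall_of_forall_eventually fun x hx => ?_)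
        have hx0 : F s₀ x ≠ 0 := by
          intro h0
          rcases eq_or_lt_of_le hx.1.2 with h | h
          · exact hX s₀ hs₀ (h ▸ h0)
          · exact hx.2 (mem_biUnion (show x ∈ {x | F s₀ x = 0 ∧ x < X} from ⟨h0, h⟩)
              ⟨by linarith, by linarith⟩)
        exact (hF.tendsto (s₀, x)).eventually_ne hx0
      filter_upwards [h1', h2, self_mem_nhdsWithin] with s hs1 hs2 hs
      choose! f hf using hs1
      refine (Set.ncard_congr (fun z _ => f z) (fun z hz => (hf z hz).1) ?_ ?_)
      · intro z w hz hw hzw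
        refine hsep s₀ hs₀ z (hsub s₀ hs₀ z hz.1 hz.2) w (hsub s₀ hs₀ w hw.1 hw.2) hz.1 hw.1 ?_
        have a := abs_lt.1 (hf z hz).2
        have b := abs_lt.1 (hf w hw).2
        rw [abs_lt]; constructor <;> linarith
      · intro w hw
        have hwI := hsub s hs w hw.1 hw.2
        obtain ⟨z, hz, hzw⟩ : ∃ z ∈ {x | F s₀ x = 0 ∧ x < X}, w ∈ Ioo (z - δ / 3) (z + δ / 3) := by
          by_contra! hcon
          refine hs2 w ⟨hwI, fun hmem => ?_⟩ hw.1
          obtain ⟨z, hz, hz'⟩ := mem_iUnion₂.1 hmem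
          exact hcon z hz hz'
        refine ⟨z, hz, ?_⟩
        have hfz := hf z hz
        refine hsep s hs (f z) (hsub s hs _ hfz.1.1 hfz.1.2) w hwI hfz.1.1 hw.1 ?_
        have a := abs_lt.1 hfz.2
        rw [abs_lt]; constructor <;> linarith [hzw.1, hzw.2]
    exact (tendsto_const_nhds (x := {x | F s₀ x = 0 ∧ x < X}.ncard)).congr' this
  exact isPreconnected_Icc.constant hloc (by simp) (by simp)

end Homotopy

/-- For the zero potential there are exactly `n` zeros `((j + 1/2) π)²`, `j < n`, below `ν²` when `ν`
lies between `(n - 1/2) π` and `(n + 1/2) π`. -/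
lemma ncard_free_zeros {V : ℝ → ℝ} (hV : ∀ a b : ℝ, IntervalIntegrable V volume a b) {n : ℕ} {ν : ℝ}
    (h0 : 0 < ν) (h1 : ((n : ℝ) - 1 / 2) * Real.pi < ν) (h2 : ν < ((n : ℝ) + 1 / 2) * Real.pi) :
    {x : ℝ | (hillDisc (fun t => 0 * V t) x).re = 0 ∧ x < ν ^ 2}.ncard = n := by
  have hpi := Real.pi_pos
  have hV0 : ∀ a b : ℝ, IntervalIntegrable (fun t => 0 * V t) volume a b :=
    fun a b => (hV a b).const_mul 0
  have hval : ∀ μ : ℝ, 0 < μ → (hillDisc (fun t => 0 * V t) ((μ ^ 2 : ℝ) : ℂ)).re = 2 * Real.cos μ := by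
    intro μ hμ
    rw [Complex.ofReal_pow, hillDisc_zero_mul hV (by exact_mod_cast hμ.ne')]
    simp [Complex.cos_ofReal_re]
  have hneg : ∀ x : ℝ, x ≤ 0 → 2 ≤ (hillDisc (fun t => 0 * V t) x).re := by
    have hlt : ∀ x : ℝ, x < 0 → 2 < (hillDisc (fun t => 0 * V t) x).re := fun x hx =>
      two_lt_hillDisc hV0 (by simpa using hx)
    intro x hx
    have hc : Continuous fun x : ℝ => (hillDisc (fun t => 0 * V t) x).re :=
      Complex.continuous_re.comp ((differentiable_hillDisc hV0).continuous.comp Complex.continuous_ofReal)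
    have : x ∈ closure (Iio (0 : ℝ)) := by rw [closure_Iio]; exact hx
    exact (isClosed_le continuous_const hc).closure_subset_iff.2 (fun y hy => (hlt y hy).le) this
  have hset : {x : ℝ | (hillDisc (fun t => 0 * V t) x).re = 0 ∧ x < ν ^ 2} =
      (fun j : ℕ => (((j : ℝ) + 1 / 2) * Real.pi) ^ 2) '' (Iio n) := by
    ext x
    constructor
    · rintro ⟨hx0, hxν⟩
      have hx : 0 < x := by
        by_contra! hcon
        linarith [hneg x hcon]
      have hs := Real.sqrt_pos.2 hx
      have e := hval _ hs
      rw [Real.sq_sqrt hx.le, hx0] at e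
      obtain ⟨k, hk⟩ := Real.cos_eq_zero_iff.1 (by linarith : Real.cos (Real.sqrt x) = 0)
      have hsν : Real.sqrt x < ν := (Real.sqrt_lt' h0).2 hxν
      have hk0 : 0 ≤ k := by
        by_contra! hcon
        have : (k : ℝ) ≤ -1 := by exact_mod_cast (by omega : k ≤ -1)
        nlinarith
      lift k to ℕ using hk0
      have hkn : k < n := by
        by_contra! hcon
        have : (n : ℝ) ≤ k := by exact_mod_cast hcon
        push_cast at hk
        nlinarith
      refine ⟨k, hkn, ?_⟩
      simp only
      rw [← Real.sq_sqrt hx.le, hk]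
      push_cast
      ring
    · rintro ⟨j, hj, rfl⟩
      have hj' : (j : ℝ) + 1 ≤ n := by exact_mod_cast hj
      have hpos : 0 < ((j : ℝ) + 1 / 2) * Real.pi := by positivity
      refine ⟨?_, ?_⟩
      · rw [hval _ hpos, Real.cos_eq_zero_iff.2 ⟨j, by push_cast; ring⟩, mul_zero]
      · refine pow_lt_pow_left₀ ?_ hpos.le (by norm_num)
        nlinarith
  rw [hset, Set.ncard_image_of_injective]
  · simp [← Finset.coe_Iio, Set.ncard_coe_finset]
  · intro i j hij
    have hi : 0 ≤ ((i : ℝ) + 1 / 2) * Real.pi := by positivity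
    have hj : 0 ≤ ((j : ℝ) + 1 / 2) * Real.pi := by positivity
    have := (pow_left_inj₀ hi hj (by norm_num)).1 hij
    have := mul_right_cancel₀ hpi.ne' this
    exact_mod_cast (by linarith : (i : ℝ) = j)

section Count

variable {V : ℝ → ℝ} (hV : ∀ a b : ℝ, IntervalIntegrable V volume a b)
include hV

/-- At energies `ν²` with `ν` large compared to the potential, the discriminant is close to
`2 cos ν`. -/
lemma abs_hillDisc_sub_cos_le {ν : ℝ} (h0 : 0 < ν) (h : 5 * (∫ t in (0 : ℝ)..1, |V t|) ≤ ν) :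
    |(hillDisc V ((ν ^ 2 : ℝ) : ℂ)).re - 2 * Real.cos ν| < 1 / 2 := by
  set K := ∫ t in (0 : ℝ)..1, |V t| with hK
  have hK0 : 0 ≤ K := intervalIntegral.integral_nonneg (by norm_num) fun t _ => abs_nonneg _
  have hν : (ν : ℂ) ≠ 0 := by exact_mod_cast h0.ne'
  have hb := norm_hillDisc_sub_cos_le hV hν
  rw [Complex.norm_real, Real.norm_eq_abs, abs_of_pos h0, Complex.ofReal_im, abs_zero,
    Real.exp_zero, mul_one, ← hK] at hb
  have hk : K / ν ≤ 1 / 5 := by rw [div_le_iff₀ h0]; linarith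
  have hk0 : 0 ≤ K / ν := by positivity
  have he : Real.exp (1 / 5) < 5 / 4 := by
    have := Real.exp_bound_div_one_sub_of_interval' (x := 1 / 5) (by norm_num) (by norm_num)
    norm_num at this ⊢
    exact this
  have h1 : K / ν * Real.exp (K / ν) < 1 / 4 := by
    calc K / ν * Real.exp (K / ν) ≤ 1 / 5 * Real.exp (1 / 5) := by gcongr
      _ < 1 / 4 := by linarith
  have h2 : |(hillDisc V ((ν : ℂ) ^ 2) - 2 * Complex.cos ν).re| < 1 / 2 :=
    (Complex.abs_re_le_norm _).trans_lt (by linarith)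
  simpa [Complex.cos_ofReal_re] using h2

lemma differentiable_hillDisc_re : Differentiable ℝ fun x : ℝ => (hillDisc V x).re := fun x =>
  ((differentiable_hillDisc hV).differentiableAt.hasDerivAt (x := (x : ℂ))).real_of_complex.differentiableAt

/-- The number of zeros of the discriminant below `ν²` is the one for the zero potential: while the
coupling constant grows from zero to one, the zeros stay above the bottom of the spectrum and do not
pass `ν²`, where the discriminant is close to `2 cos ν ≠ 0`. -/
theorem ncard_hillDisc_zeros {n : ℕ} {ν : ℝ} (h0 : 0 < ν) (h1 : ((n : ℝ) - 1 / 2) * Real.pi < ν)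
    (h2 : ν < ((n : ℝ) + 1 / 2) * Real.pi) (h5 : 5 * (∫ t in (0 : ℝ)..1, |V t|) ≤ ν)
    (hcos : 1 / 4 ≤ |Real.cos ν|) :
    {x : ℝ | (hillDisc V x).re = 0 ∧ x < ν ^ 2}.Finite ∧
      {x : ℝ | (hillDisc V x).re = 0 ∧ x < ν ^ 2}.ncard = n := by
  set K := ∫ t in (0 : ℝ)..1, |V t| with hK
  have hK0 : 0 ≤ K := intervalIntegral.integral_nonneg (by norm_num) fun t _ => abs_nonneg _
  have hV' : ∀ (s : ℝ) (a b : ℝ), IntervalIntegrable (fun t => s * V t) volume a b :=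
    fun s a b => (hV a b).const_mul s
  have hKs : ∀ s ∈ Icc (0 : ℝ) 1, ∫ t in (0 : ℝ)..1, |s * V t| = s * K := fun s hs => by
    simp only [abs_mul, abs_of_nonneg hs.1]
    rw [intervalIntegral.integral_const_mul]
  obtain ⟨F, hF⟩ : ∃ F : ℝ → ℝ → ℝ, ∀ s x, F s x = (hillDisc (fun t => s * V t) x).re :=
    ⟨fun s x => (hillDisc (fun t => s * V t) x).re, fun _ _ => rfl⟩
  have hFs : ∀ s, F s = fun x : ℝ => (hillDisc (fun t => s * V t) x).re := fun s => funext (hF s)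
  have hFc : Continuous fun p : ℝ × ℝ => F p.1 p.2 := by
    have h := (continuous_hillDisc hV).comp
      (show Continuous fun p : ℝ × ℝ => (p.1, (p.2 : ℂ)) by fun_prop)
    simp only [Function.comp_def] at h
    simp only [hF]
    exact Complex.continuous_re.comp h
  have hd : ∀ s, Differentiable ℝ (F s) := fun s => by
    rw [hFs]; exact differentiable_hillDisc_re (hV' s)
  have hne : ∀ s x, |F s x| < 2 → deriv (F s) x ≠ 0 := fun s x hx => by
    rw [hF] at hx
    rw [hFs]
    exact deriv_hillDisc_ne_zero (hV' s) hx
  have hA : ∀ s ∈ Icc (0 : ℝ) 1, ∀ x ≤ -(K + K ^ 2) - 1, F s x ≠ 0 := fun s hs x hx => by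
    have h3 : s * K ≤ K := by nlinarith [hs.2]
    have h4 : 0 ≤ s * K := mul_nonneg hs.1 hK0
    have h6 : x < -(∫ t in (0 : ℝ)..1, |s * V t|) - (∫ t in (0 : ℝ)..1, |s * V t|) ^ 2 := by
      rw [hKs s hs]
      nlinarith
    have : 2 < F s x := by rw [hF]; exact two_lt_hillDisc (hV' s) (x := x) (by linarith)
    linarith
  have hX : ∀ s ∈ Icc (0 : ℝ) 1, F s (ν ^ 2) ≠ 0 := fun s hs => by
    have : |F s (ν ^ 2) - 2 * Real.cos ν| < 1 / 2 := by
     rw [hF]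
     exact abs_hillDisc_sub_cos_le (hV' s) h0 (by
      rw [hKs s hs]; nlinarith [hs.2])
    intro h
    rw [h, zero_sub, abs_neg, abs_mul, abs_two] at this
    linarith
  have key := ncard_zeros_eq_of_homotopy hFc hd hne hA hX
  have hF1 : ∀ x, F 1 x = (hillDisc V x).re := fun x => by simp only [hF, one_mul]
  have hF0 : {x : ℝ | F 0 x = 0 ∧ x < ν ^ 2}.ncard = n := by
    simp only [hF]
    exact ncard_free_zeros hV h0 h1 h2
  rw [hF0] at key
  simpa only [hF1] using key

end Count

/-- A set of reals that is finite below every point and unbounded above is the range of a strictly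
increasing sequence. -/
lemma exists_strictMono_range_eq {S : Set ℝ} (hfin : ∀ X, (S ∩ Iio X).Finite)
    (hunb : ∀ X, ∃ x ∈ S, X ≤ x) : ∃ κ : ℕ → ℝ, StrictMono κ ∧ range κ = S := by
  classical
  obtain ⟨x₀, hx₀, -⟩ := hunb 0
  obtain ⟨b, hb, hbmin⟩ : ∃ b ∈ S, ∀ x ∈ S, b ≤ x := by
    have hne : (S ∩ Iio (x₀ + 1)).Nonempty := ⟨x₀, hx₀, by simp⟩
    obtain ⟨b, hb, hmin⟩ := Set.exists_min_image _ id (hfin (x₀ + 1)) hne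
    refine ⟨b, hb.1, fun x hx => ?_⟩
    rcases lt_or_ge x (x₀ + 1) with h | h
    · exact hmin x ⟨hx, h⟩
    · exact (le_of_lt hb.2).trans h
  let _ : LocallyFiniteOrder S := LocallyFiniteOrder.ofFiniteIcc fun x y => by
    refine Set.Finite.of_finite_image (f := Subtype.val) ((hfin (y.1 + 1)).subset ?_)
      Subtype.val_injective.injOn
    rintro _ ⟨z, hz, rfl⟩
    exact ⟨z.2, show z.1 < y.1 + 1 by have : z.1 ≤ y.1 := hz.2; linarith⟩
  let _ : OrderBot S := { bot := ⟨b, hb⟩, bot_le := fun x => hbmin x.1 x.2 }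
  have : NoMaxOrder S := ⟨fun x => by
    obtain ⟨y, hy, hxy⟩ := hunb (x.1 + 1)
    exact ⟨⟨y, hy⟩, show x.1 < y by linarith⟩⟩
  let _ : SuccOrder S := LinearLocallyFiniteOrder.succOrder S
  let _ : PredOrder S := LinearLocallyFiniteOrder.predOrder S
  let e : S ≃o ℕ := orderIsoNatOfLinearSuccPredArch
  refine ⟨fun n => (e.symm n).1, fun m n hmn => e.symm.strictMono hmn, ?_⟩
  ext x
  exact ⟨fun ⟨n, hn⟩ => hn ▸ (e.symm n).2, fun hx => ⟨e ⟨x, hx⟩, by simp⟩⟩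

/-- The position of a point relative to an increasing sequence is given by a count. -/
lemma lt_iff_lt_ncard {κ : ℕ → ℝ} (hκ : StrictMono κ) {X : ℝ} {n : ℕ}
    (hfin : {x | x ∈ range κ ∧ x < X}.Finite) (hn : {x | x ∈ range κ ∧ x < X}.ncard = n) (j : ℕ) :
    κ j < X ↔ j < n := by
  have e : {x | x ∈ range κ ∧ x < X} = κ '' {j | κ j < X} := by
    ext x
    constructor
    · rintro ⟨⟨j, rfl⟩, hj⟩; exact ⟨j, hj, rfl⟩
    · rintro ⟨j, hj, rfl⟩; exact ⟨⟨j, rfl⟩, hj⟩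
  rw [e, Set.ncard_image_of_injective _ hκ.injective] at hn
  rw [e] at hfin
  have hf : {j | κ j < X}.Finite := hfin.of_finite_image hκ.injective.injOn
  constructor
  · intro hj
    have hsub : Iic j ⊆ {j | κ j < X} := fun i hi => (hκ.monotone hi).trans_lt hj
    have := Set.ncard_le_ncard hsub hf
    rw [hn, show (Iic j).ncard = j + 1 by simp [← Finset.coe_Iic, Set.ncard_coe_finset]] at this
    omega
  · intro hj
    by_contra! hcon
    have hsub : {j | κ j < X} ⊆ Iio j := fun i hi => by
      by_contra! h
      exact absurd ((hcon.trans (hκ.monotone (not_lt.1 h)))) (not_le.2 hi)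
    have := Set.ncard_le_ncard hsub (Set.finite_Iio j)
    rw [hn, show (Iio j).ncard = j by simp [← Finset.coe_Iio, Set.ncard_coe_finset]] at this
    omega

/-! ### Bands and gaps -/

section Gaps

variable {D : ℝ → ℝ}

/-- Between two points where `s D ≥ 2` without a zero in between, `s D` exceeds two: an interior
minimum would be a critical point inside a band or at a point of multiplicity two. -/
lemma two_lt_of_mem_gap (hd : Differentiable ℝ D) (hb : ∀ x, |D x| < 2 → deriv D x ≠ 0)
    (hloc : ∀ x, |D x| = 2 → deriv D x = 0 → ∀ᶠ y in 𝓝[≠] x, |D y| < 2)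
    {s : ℝ} (hs : |s| = 1) {a b : ℝ} (ha : 2 ≤ s * D a) (hb2 : 2 ≤ s * D b)
    (hpos : ∀ x ∈ Icc a b, 0 < s * D x) : ∀ x ∈ Ioo a b, 2 < s * D x := by
  have hsabs : ∀ x, |s * D x| = |D x| := fun x => by rw [abs_mul, hs, one_mul]
  have hcont : Continuous fun x => s * D x := continuous_const.mul hd.continuous
  have hs0 : s ≠ 0 := by rintro rfl; simp at hs
  have key : ∀ c ∈ Ioo a b, 2 ≤ s * D c := by
    by_contra! hcon
    obtain ⟨c, hc, hc2⟩ := hcon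
    obtain ⟨m, hm, hmin⟩ := isCompact_Icc.exists_isMinOn (nonempty_Icc.2 (hc.1.trans hc.2).le)
      hcont.continuousOn
    have hmc : s * D m ≤ s * D c := hmin ⟨hc.1.le, hc.2.le⟩
    have hmI : m ∈ Ioo a b := by
      refine ⟨lt_of_le_of_ne hm.1 ?_, lt_of_le_of_ne hm.2 ?_⟩ <;> rintro rfl <;> linarith
    have hlm : IsLocalMin (fun x => s * D x) m := hmin.isLocalMin (Icc_mem_nhds hmI.1 hmI.2)
    have h0 := hlm.deriv_eq_zero
    rw [deriv_const_mul _ (hd m)] at h0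
    refine hb m ?_ ((mul_eq_zero.1 h0).resolve_left hs0)
    rw [← hsabs, abs_of_pos (hpos m hm)]
    linarith
  intro x hx
  refine lt_of_le_of_ne (key x hx) fun heq => ?_
  have hlm : IsLocalMin (fun x => s * D x) x := by
    filter_upwards [Ioo_mem_nhds hx.1 hx.2] with y hy
    rw [← heq]; exact key y hy
  have h0 := hlm.deriv_eq_zero
  rw [deriv_const_mul _ (hd x)] at h0
  have hev := hloc x (by rw [← hsabs, ← heq]; norm_num) ((mul_eq_zero.1 h0).resolve_left hs0)
  obtain ⟨y, hy, hyI⟩ := (hev.and (nhdsWithin_le_nhds (Ioo_mem_nhds hx.1 hx.2))).exists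
  have := key y hyI
  rw [← hsabs] at hy
  linarith [le_abs_self (s * D y)]

lemma exists_sign_of_ne_zero (hd : Differentiable ℝ D) {S : Set ℝ} (hS : IsPreconnected S)
    (hne : ∀ x ∈ S, D x ≠ 0) : ∃ s : ℝ, |s| = 1 ∧ ∀ x ∈ S, 0 < s * D x := by
  rcases S.eq_empty_or_nonempty with rfl | ⟨x₀, hx₀⟩
  · exact ⟨1, by simp, by simp⟩
  have key : ∀ x ∈ S, ∀ y ∈ S, 0 < D x → 0 < D y := by
    intro x hx y hy h
    by_contra! hcon
    obtain ⟨z, hz, hz0⟩ := hS.intermediate_value hy hx hd.continuous.continuousOn ⟨hcon, h.le⟩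
    exact hne z hz hz0
  rcases lt_or_gt_of_ne (hne x₀ hx₀) with h | h
  · refine ⟨-1, by simp, fun x hx => ?_⟩
    rcases lt_or_gt_of_ne (hne x hx) with h1 | h1
    · linarith
    · linarith [key x hx x₀ hx₀ h1]
  · exact ⟨1, by simp, fun x hx => by simpa using key x₀ hx₀ x hx h⟩

/-- Between two consecutive zeros there is exactly one gap `[a, b]`, possibly a single point. There is
a critical point between the zeros, where `|D| ≥ 2`; the gap runs from the first to the last point with
`|D| ≥ 2`. A critical point with `|D| = 2` has band points on both sides, so it is a gap by itself. -/
lemma exists_gap (hd : Differentiable ℝ D) (hb : ∀ x, |D x| < 2 → deriv D x ≠ 0)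
    (hloc : ∀ x, |D x| = 2 → deriv D x = 0 → ∀ᶠ y in 𝓝[≠] x, |D y| < 2)
    {p q : ℝ} (hpq : p < q) (hp : D p = 0) (hq : D q = 0) (hne : ∀ x ∈ Ioo p q, D x ≠ 0) :
    ∃ a b, p < a ∧ a ≤ b ∧ b < q ∧ |D a| = 2 ∧ |D b| = 2 ∧
      (∀ x ∈ Ioo p q, |D x| = 2 → x = a ∨ x = b) ∧ (∀ x ∈ Ioo a b, 2 < |D x|) ∧
      (a = b → deriv D a = 0) ∧ (a < b → deriv D a ≠ 0 ∧ deriv D b ≠ 0) := by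
  obtain ⟨s, hs, hpos⟩ := exists_sign_of_ne_zero hd isPreconnected_Ioo hne
  have hsabs : ∀ x, |s * D x| = |D x| := fun x => by rw [abs_mul, hs, one_mul]
  have hcont : Continuous fun x => |D x| := hd.continuous.abs
  set G := Icc p q ∩ {x | 2 ≤ |D x|} with hG
  have hGc : IsCompact G := isCompact_Icc.inter_right (isClosed_le continuous_const hcont)
  have hGne : G.Nonempty := by
    obtain ⟨c, hc, hc0⟩ := exists_deriv_eq_zero hpq hd.continuous.continuousOn (by rw [hp, hq])
    exact ⟨c, ⟨hc.1.le, hc.2.le⟩, not_lt.1 fun h => hb c h hc0⟩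
  obtain ⟨a, haG, ha⟩ := hGc.exists_isMinOn hGne continuousOn_id
  obtain ⟨b, hbG, hbm⟩ := hGc.exists_isMaxOn hGne continuousOn_id
  have ha' : ∀ x ∈ G, a ≤ x := fun x hx => ha hx
  have hb' : ∀ x ∈ G, x ≤ b := fun x hx => hbm hx
  have hGI : ∀ x ∈ G, x ∈ Ioo p q := by
    rintro x ⟨hx, hx2⟩
    refine ⟨lt_of_le_of_ne hx.1 ?_, lt_of_le_of_ne hx.2 ?_⟩
    · rintro rfl; simp [hp] at hx2; linarith
    · rintro rfl; simp [hq] at hx2; linarith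
  have haI := hGI a haG
  have hbI := hGI b hbG
  have hab : a ≤ b := ha' b hbG
  have hDa : |D a| = 2 := by
    refine le_antisymm ?_ haG.2
    have hcl : a ∈ closure (Ioo p a) := by rw [closure_Ioo haI.1.ne]; exact ⟨haI.1.le, le_rfl⟩
    refine (isClosed_le hcont continuous_const).closure_subset_iff.2 (fun x hx => ?_) hcl
    by_contra! hcon
    exact absurd (ha' x ⟨⟨hx.1.le, (hx.2.trans haI.2).le⟩, (not_le.1 (show ¬ |D x| ≤ 2 from hcon)).le⟩)
      (not_le.2 hx.2)
  have hDb : |D b| = 2 := by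
    refine le_antisymm ?_ hbG.2
    have hcl : b ∈ closure (Ioo b q) := by rw [closure_Ioo hbI.2.ne]; exact ⟨le_rfl, hbI.2.le⟩
    refine (isClosed_le hcont continuous_const).closure_subset_iff.2 (fun x hx => ?_) hcl
    by_contra! hcon
    exact absurd (hb' x ⟨⟨(hbI.1.trans hx.1).le, hx.2.le⟩, (not_le.1 (show ¬ |D x| ≤ 2 from hcon)).le⟩)
      (not_le.2 hx.1)
  have hsD : ∀ x ∈ Ioo p q, s * D x = |D x| := fun x hx => by
    rw [← hsabs, abs_of_pos (hpos x hx)]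
  have hgap : ∀ x ∈ Ioo a b, 2 < |D x| := fun x hx => by
    rw [← hsD x ⟨haI.1.trans hx.1, hx.2.trans hbI.2⟩]
    refine two_lt_of_mem_gap hd hb hloc hs (by rw [hsD a haI, hDa]) (by rw [hsD b hbI, hDb])
      (fun y hy => hpos y ⟨haI.1.trans_le hy.1, hy.2.trans_lt hbI.2⟩) x hx
  refine ⟨a, b, haI.1, hab, hbI.2, hDa, hDb, fun x hx hx2 => ?_, hgap, fun heq => ?_, fun hlt => ?_⟩
  · have hxG : x ∈ G := ⟨⟨hx.1.le, hx.2.le⟩, hx2.ge⟩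
    by_contra! hcon
    have := hgap x ⟨lt_of_le_of_ne (ha' x hxG) hcon.1.symm, lt_of_le_of_ne (hb' x hxG) hcon.2⟩
    linarith
  -- in a gap that is a single point, `|D|` has a local maximum
  · have hlm : IsLocalMax (fun x => s * D x) a := by
      filter_upwards [Ioo_mem_nhds haI.1 haI.2] with y hy
      rw [hsD y hy, hsD a haI, hDa]
      by_contra! hcon
      have hyG : y ∈ G := ⟨⟨hy.1.le, hy.2.le⟩, hcon.le⟩
      have : y = a := le_antisymm (heq ▸ hb' y hyG) (ha' y hyG)
      rw [this] at hcon; linarith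
    have h0 := hlm.deriv_eq_zero
    rw [deriv_const_mul _ (hd a)] at h0
    exact (mul_eq_zero.1 h0).resolve_left (by rintro rfl; simp at hs)
  · constructor
    · intro h0
      have hev := (hloc a hDa h0).filter_mono (nhdsWithin_mono a (show Ioi a ⊆ {a}ᶜ by
        intro y hy; exact ne_of_gt hy))
      obtain ⟨y, hy, hyI⟩ := (hev.and (Ioo_mem_nhdsGT hlt)).exists
      linarith [hgap y hyI]
    · intro h0
      have hev := (hloc b hDb h0).filter_mono (nhdsWithin_mono b (show Iio b ⊆ {b}ᶜ by
        intro y hy; exact ne_of_lt hy))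
      obtain ⟨y, hy, hyI⟩ := (hev.and (Ioo_mem_nhdsLT hlt)).exists
      linarith [hgap y hyI]

/-- Below the first zero there is exactly one point where `|D| = 2`. -/
lemma exists_bottom (hd : Differentiable ℝ D) (hb : ∀ x, |D x| < 2 → deriv D x ≠ 0)
    (hloc : ∀ x, |D x| = 2 → deriv D x = 0 → ∀ᶠ y in 𝓝[≠] x, |D y| < 2)
    {A q : ℝ} (hA : ∀ x ≤ A, 2 < D x) (hq : D q = 0) (hne : ∀ x < q, D x ≠ 0) :
    ∃ b < q, D b = 2 ∧ (∀ x < q, |D x| = 2 → x = b) ∧ (∀ x < b, 2 < D x) ∧ deriv D b ≠ 0 := by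
  have hAq : A < q := by
    by_contra! hcon
    linarith [hA q hcon]
  have hpos : ∀ x < q, 0 < D x := by
    intro x hx
    by_contra! hcon
    have hlt : A < x := by
      by_contra! h
      linarith [hA x h]
    obtain ⟨z, hz, hz0⟩ := intermediate_value_Icc' hlt.le hd.continuous.continuousOn
      ⟨hcon, (by linarith [hA A le_rfl] : (0 : ℝ) ≤ D A)⟩
    exact hne z (hz.2.trans_lt hx) hz0
  set G := Icc A q ∩ {x | 2 ≤ D x} with hG
  have hGc : IsCompact G := isCompact_Icc.inter_right (isClosed_le continuous_const hd.continuous)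
  obtain ⟨b, hbG, hbm⟩ := hGc.exists_isMaxOn ⟨A, ⟨le_rfl, hAq.le⟩, (hA A le_rfl).le⟩ continuousOn_id
  have hb' : ∀ x ∈ G, x ≤ b := fun x hx => hbm hx
  have hbq : b < q := by
    refine lt_of_le_of_ne hbG.1.2 ?_
    rintro rfl
    have : 2 ≤ D b := hbG.2
    linarith
  have hDb : D b = 2 := by
    refine le_antisymm ?_ hbG.2
    have hcl : b ∈ closure (Ioo b q) := by rw [closure_Ioo hbq.ne]; exact ⟨le_rfl, hbq.le⟩
    refine (isClosed_le hd.continuous continuous_const).closure_subset_iff.2 (fun x hx => ?_) hcl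
    by_contra! hcon
    exact absurd (hb' x ⟨⟨(hbG.1.1.trans hx.1.le), hx.2.le⟩, (not_le.1 (show ¬ D x ≤ 2 from hcon)).le⟩)
      (not_le.2 hx.1)
  have hlt : ∀ x < b, 2 < D x := by
    intro x hx
    have h := two_lt_of_mem_gap (a := min A x - 1) (b := b) (s := 1) hd hb hloc (by simp)
      (by linarith [hA (min A x - 1) (by linarith [min_le_left A x])]) (by linarith)
      (fun y hy => by simpa using hpos y (hy.2.trans_lt hbq)) x
      ⟨by linarith [min_le_right A x], hx⟩
    linarith
  refine ⟨b, hbq, hDb, fun x hx hx2 => ?_, hlt, fun h0 => ?_⟩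
  · rw [abs_of_pos (hpos x hx)] at hx2
    rcases lt_trichotomy x b with h | h | h
    · linarith [hlt x h]
    · exact h
    · have hAx : A ≤ x := hbG.1.1.trans h.le
      linarith [hb' x ⟨⟨hAx, hx.le⟩, hx2.ge⟩]
  · have hev := (hloc b (by rw [hDb]; norm_num) h0).filter_mono (nhdsWithin_mono b
      (show Iio b ⊆ {b}ᶜ by intro y hy; exact ne_of_lt hy))
    obtain ⟨y, hy, hyI⟩ := (hev.and self_mem_nhdsWithin).exists
    linarith [hlt y hyI, le_abs_self (D y)]

/-- The periodic spectrum read off from the discriminant: `μ` lists the points where `|D| = 2`, and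
`κ` lists the zeros of `D`. -/
structure SpectrumData (D : ℝ → ℝ) (κ μ : ℕ → ℝ) : Prop where
  strictMono : StrictMono κ
  zero_iff : ∀ x, D x = 0 ↔ x ∈ range κ
  lt_zero : μ 0 < κ 0
  zero_lt : ∀ n, κ n < μ (2 * n + 1)
  le : ∀ n, μ (2 * n + 1) ≤ μ (2 * n + 2)
  lt_succ : ∀ n, μ (2 * n + 2) < κ (n + 1)
  abs_eq : ∀ k, |D (μ k)| = 2
  exists_eq : ∀ x, |D x| = 2 → ∃ k, x = μ k
  two_lt : ∀ x < μ 0, 2 < D x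
  two_lt_abs : ∀ n, ∀ x ∈ Ioo (μ (2 * n + 1)) (μ (2 * n + 2)), 2 < |D x|
  deriv_zero : deriv D (μ 0) ≠ 0
  deriv_eq : ∀ n, μ (2 * n + 1) = μ (2 * n + 2) → deriv D (μ (2 * n + 1)) = 0
  deriv_ne : ∀ n, μ (2 * n + 1) < μ (2 * n + 2) →
    deriv D (μ (2 * n + 1)) ≠ 0 ∧ deriv D (μ (2 * n + 2)) ≠ 0

/-- A function whose behaviour in the strip `|D| ≤ 2` is that of a discriminant alternates between
zeros and gaps. -/
theorem exists_spectrumData (hd : Differentiable ℝ D) (hb : ∀ x, |D x| < 2 → deriv D x ≠ 0)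
    (hloc : ∀ x, |D x| = 2 → deriv D x = 0 → ∀ᶠ y in 𝓝[≠] x, |D y| < 2)
    {A : ℝ} (hA : ∀ x ≤ A, 2 < D x) {κ : ℕ → ℝ} (hκ : StrictMono κ)
    (hκD : ∀ x, D x = 0 ↔ x ∈ range κ) (hunb : ∀ x, ∃ n, x < κ n) :
    ∃ μ, SpectrumData D κ μ := by
  have hzero : ∀ n, D (κ n) = 0 := fun n => (hκD _).2 ⟨n, rfl⟩
  have hne : ∀ n, ∀ x ∈ Ioo (κ n) (κ (n + 1)), D x ≠ 0 := by
    rintro n x ⟨h1, h2⟩ h0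
    obtain ⟨j, rfl⟩ := (hκD x).1 h0
    have := hκ.lt_iff_lt.1 h1
    have := hκ.lt_iff_lt.1 h2
    omega
  choose a b hpa hab hbq hDa hDb hex hgap heq hlt using fun n =>
    exists_gap hd hb hloc (hκ n.lt_succ_self) (hzero n) (hzero (n + 1)) (hne n)
  obtain ⟨c, hcq, hDc, hexc, hltc, hdc⟩ := exists_bottom hd hb hloc hA (hzero 0) (fun x hx h0 => by
    obtain ⟨j, rfl⟩ := (hκD x).1 h0
    exact absurd (hκ.lt_iff_lt.1 hx) (by omega))
  set μ : ℕ → ℝ := fun k => if k = 0 then c else if k % 2 = 1 then a (k / 2) else b (k / 2 - 1)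
    with hμ
  have hμ0 : μ 0 = c := by simp [hμ]
  have hμ1 : ∀ n, μ (2 * n + 1) = a n := fun n => by
    simp only [hμ]
    rw [if_neg (by omega), if_pos (by omega)]
    congr 1; omega
  have hμ2 : ∀ n, μ (2 * n + 2) = b n := fun n => by
    simp only [hμ]
    rw [if_neg (by omega), if_neg (by omega)]
    congr 1; omega
  refine ⟨μ, ⟨hκ, hκD, by rwa [hμ0], fun n => by rw [hμ1]; exact hpa n,
    fun n => by rw [hμ1, hμ2]; exact hab n, fun n => by rw [hμ2]; exact hbq n, fun k => ?_,
    fun x hx => ?_, fun x hx => hltc x (by rwa [hμ0] at hx), fun n x hx => hgap n x (by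
      rwa [hμ1, hμ2] at hx), by rwa [hμ0], fun n h => ?_, fun n h => ?_⟩⟩
  · rcases Nat.even_or_odd' k with ⟨n, rfl | rfl⟩
    · rcases n with _ | n
      · rw [mul_zero, hμ0, hDc]; norm_num
      · rw [mul_add, mul_one, hμ2]; exact hDb n
    · rw [hμ1]; exact hDa n
  · rcases lt_or_ge x (κ 0) with h | h
    · exact ⟨0, by rw [hμ0]; exact hexc x h hx⟩
    · classical
      have hex' : ∃ n, x < κ n := hunb x
      set N := Nat.find hex' with hN
      have hN1 : x < κ N := Nat.find_spec hex'
      have hN0 : N ≠ 0 := fun h0 => by rw [h0] at hN1; linarith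
      obtain ⟨n, hn⟩ := Nat.exists_eq_succ_of_ne_zero hN0
      have hle : κ n ≤ x := not_lt.1 (Nat.find_min hex' (by omega : n < N))
      have hlt : κ n < x := lt_of_le_of_ne hle (by
        rintro rfl
        rw [hzero] at hx; norm_num at hx)
      rw [hn] at hN1
      rcases hex n x ⟨hlt, hN1⟩ hx with h | h
      · exact ⟨2 * n + 1, by rw [hμ1]; exact h⟩
      · exact ⟨2 * n + 2, by rw [hμ2]; exact h⟩
  · rw [hμ1, hμ2] at h
    rw [hμ1]; exact heq n h
  · rw [hμ1, hμ2] at h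
    rw [hμ1, hμ2]; exact hlt n h

namespace SpectrumData

variable {κ μ : ℕ → ℝ} (h : SpectrumData D κ μ)
include h

lemma monotone : Monotone μ := by
  refine monotone_nat_of_le_succ fun k => ?_
  rcases Nat.even_or_odd' k with ⟨n, rfl | rfl⟩
  · rcases n with _ | n
    · exact (h.lt_zero.trans (h.zero_lt 0)).le
    · exact ((h.lt_succ n).trans (h.zero_lt (n + 1))).le
  · exact h.le n

lemma lt_odd (n : ℕ) : μ (2 * n) < μ (2 * n + 1) := by
  rcases n with _ | n
  · exact h.lt_zero.trans (h.zero_lt 0)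
  · exact (h.lt_succ n).trans (h.zero_lt (n + 1))

/-- The number of indices with `μ k = x` is the order to which `x` is a zero of `D² - 4`. -/
lemma encard_fiber (x : ℝ) : {k | μ k = x}.encard =
    if |D x| = 2 then (if deriv D x = 0 then 2 else 1) else 0 := by
  by_cases hx : |D x| = 2
  · rw [if_pos hx]
    obtain ⟨k, rfl⟩ := h.exists_eq x hx
    rcases Nat.even_or_odd' k with ⟨n, rfl | rfl⟩
    · rcases n with _ | n
      · rw [mul_zero, if_neg h.deriv_zero]
        have : {k | μ k = μ 0} = {0} := by
          ext j
          simp only [mem_ofPred_eq, mem_singleton_iff]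
          refine ⟨fun hj => ?_, fun hj => by rw [hj]⟩
          by_contra hj0
          have := h.monotone (show 1 ≤ j by omega)
          have h1 := h.lt_odd 0
          simp only [mul_zero, zero_add] at h1
          linarith
        rw [this, encard_singleton]
      · have e : 2 * (n + 1) = 2 * n + 2 := by ring
        rw [e]
        have hup : ∀ j, 2 * n + 3 ≤ j → μ (2 * n + 2) < μ j := fun j hj =>
          (h.lt_odd (n + 1)).trans_le (h.monotone (by omega))
        have hdn : ∀ j, j ≤ 2 * n → μ j < μ (2 * n + 1) := fun j hj =>
          (h.monotone hj).trans_lt (h.lt_odd n)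
        rcases (h.le n).eq_or_lt with heq | hlt
        · rw [if_pos (by rw [← heq]; exact h.deriv_eq n heq)]
          have : {k | μ k = μ (2 * n + 2)} = {2 * n + 1, 2 * n + 2} := by
            ext j
            simp only [mem_ofPred_eq, mem_insert_iff, mem_singleton_iff]
            refine ⟨fun hj => ?_, ?_⟩
            · by_contra! hcon
              rcases lt_or_ge j (2 * n + 1) with h1 | h1
              · linarith [hdn j (by omega)]
              · linarith [hup j (by omega)]
            · rintro (rfl | rfl)
              exacts [heq, rfl]
          rw [this, encard_pair (by omega)]
        · rw [if_neg (h.deriv_ne n hlt).2]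
          have : {k | μ k = μ (2 * n + 2)} = {2 * n + 2} := by
            ext j
            simp only [mem_ofPred_eq, mem_singleton_iff]
            refine ⟨fun hj => ?_, fun hj => by rw [hj]⟩
            by_contra hcon
            rcases lt_or_ge j (2 * n + 2) with h1 | h1
            · linarith [h.monotone (show j ≤ 2 * n + 1 by omega)]
            · linarith [hup j (by omega)]
          rw [this, encard_singleton]
    · have hup : ∀ j, 2 * n + 3 ≤ j → μ (2 * n + 2) < μ j := fun j hj =>
        (h.lt_odd (n + 1)).trans_le (h.monotone (by omega))
      have hdn : ∀ j, j ≤ 2 * n → μ j < μ (2 * n + 1) := fun j hj =>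
        (h.monotone hj).trans_lt (h.lt_odd n)
      rcases (h.le n).eq_or_lt with heq | hlt
      · rw [if_pos (h.deriv_eq n heq)]
        have : {k | μ k = μ (2 * n + 1)} = {2 * n + 1, 2 * n + 2} := by
          ext j
          simp only [mem_ofPred_eq, mem_insert_iff, mem_singleton_iff]
          refine ⟨fun hj => ?_, ?_⟩
          · by_contra! hcon
            rcases lt_or_ge j (2 * n + 1) with h1 | h1
            · linarith [hdn j (by omega)]
            · linarith [hup j (by omega)]
          · rintro (rfl | rfl)
            exacts [rfl, heq.symm]
        rw [this, encard_pair (by omega)]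
      · rw [if_neg (h.deriv_ne n hlt).1]
        have : {k | μ k = μ (2 * n + 1)} = {2 * n + 1} := by
          ext j
          simp only [mem_ofPred_eq, mem_singleton_iff]
          refine ⟨fun hj => ?_, fun hj => by rw [hj]⟩
          by_contra hcon
          rcases lt_or_ge j (2 * n + 1) with h1 | h1
          · linarith [hdn j (by omega)]
          · linarith [h.monotone (show 2 * n + 2 ≤ j by omega)]
        rw [this, encard_singleton]
  · rw [if_neg hx, encard_eq_zero]
    ext j
    simp only [mem_ofPred_eq, mem_empty_iff_false, iff_false]
    rintro rfl
    exact hx (h.abs_eq j)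

/-- The sign of the discriminant alternates from one interval between zeros to the next. -/
lemma neg_one_pow_mul_pos (hd : Differentiable ℝ D) (hb : ∀ x, |D x| < 2 → deriv D x ≠ 0)
    (n : ℕ) : ∀ x ∈ Ioo (κ n) (κ (n + 1)), 0 < (-1) ^ (n + 1) * D x := by
  have hzero : ∀ n, D (κ n) = 0 := fun n => (h.zero_iff _).2 ⟨n, rfl⟩
  -- the sign changes at each zero
  have hflip : ∀ n, ∀ s : ℝ, (∀ᶠ x in 𝓝[<] (κ n), 0 < s * D x) → ∀ᶠ x in 𝓝[>] (κ n), 0 < -s * D x := by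
    intro n s hs
    have hz := hzero n
    obtain hc | hc : (∀ᶠ x in 𝓝 (κ n), SignType.sign (D x) = SignType.sign (x - κ n)) ∨
        (∀ᶠ x in 𝓝 (κ n), SignType.sign (D x) = SignType.sign (κ n - x)) := by
      rcases lt_or_gt_of_ne (hb (κ n) (by simp [hz])) with h1 | h1
      · exact Or.inr (eventually_nhdsWithin_sign_eq_of_deriv_neg h1 hz)
      · exact Or.inl (eventually_nhdsWithin_sign_eq_of_deriv_pos h1 hz)
    · obtain ⟨y, ⟨hy1, hy2⟩, hy3⟩ := ((hs.and (nhdsWithin_le_nhds hc)).and self_mem_nhdsWithin).exists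
      have hDy : D y < 0 := by
        rw [← sign_eq_neg_one_iff, hy2, sign_eq_neg_one_iff]
        linarith [show y < κ n from hy3]
      have hs0 : s < 0 := by nlinarith
      filter_upwards [nhdsWithin_le_nhds hc, self_mem_nhdsWithin] with x hx1 hx2
      have hDx : 0 < D x := by
        rw [← sign_eq_one_iff, hx1, sign_eq_one_iff]
        linarith [show κ n < x from hx2]
      nlinarith
    · obtain ⟨y, ⟨hy1, hy2⟩, hy3⟩ := ((hs.and (nhdsWithin_le_nhds hc)).and self_mem_nhdsWithin).exists
      have hDy : 0 < D y := by
        rw [← sign_eq_one_iff, hy2, sign_eq_one_iff]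
        linarith [show y < κ n from hy3]
      have hs0 : 0 < s := by nlinarith
      filter_upwards [nhdsWithin_le_nhds hc, self_mem_nhdsWithin] with x hx1 hx2
      have hDx : D x < 0 := by
        rw [← sign_eq_neg_one_iff, hx1, sign_eq_neg_one_iff]
        linarith [show κ n < x from hx2]
      nlinarith
  -- between consecutive zeros the sign is constant
  have hext : ∀ n, ∀ s : ℝ, (∀ᶠ x in 𝓝[>] (κ n), 0 < s * D x) →
      ∀ x ∈ Ioo (κ n) (κ (n + 1)), 0 < s * D x := by
    intro n s hs
    have hlt := h.strictMono n.lt_succ_self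
    obtain ⟨r, hr, hpos⟩ := exists_sign_of_ne_zero hd
      (isPreconnected_Ioo (a := κ n) (b := κ (n + 1))) (fun x hx h0 => by
        obtain ⟨j, rfl⟩ := (h.zero_iff x).1 h0
        have := h.strictMono.lt_iff_lt.1 hx.1
        have := h.strictMono.lt_iff_lt.1 hx.2
        omega)
    obtain ⟨y, hy1, hy2⟩ := (hs.and (Ioo_mem_nhdsGT hlt)).exists
    intro x hx
    have h1 := mul_pos hy1 (hpos y hy2)
    have h2 : 0 < s * r := by
      have : s * D y * (r * D y) = (s * r) * (D y * D y) := by ring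
      rw [this] at h1
      exact (pos_iff_pos_of_mul_pos h1).2 (by
        have : D y ≠ 0 := fun h0 => by simp [h0] at hy1
        exact mul_self_pos.2 this)
    have h3 := mul_pos h2 (hpos x hx)
    have h4 : s * r * (r * D x) = (r * r) * (s * D x) := by ring
    rwa [h4, ← abs_mul_abs_self, hr, one_mul, one_mul] at h3
  induction n with
  | zero =>
    -- to the left of the first zero the sign is the one below the spectrum
    refine hext 0 _ ?_
    have : ∀ᶠ x in 𝓝[<] (κ 0), 0 < 1 * D x := by
      obtain ⟨r, hr, hpos⟩ := exists_sign_of_ne_zero hd (isPreconnected_Iio (a := κ 0))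
        (fun x hx h0 => by
          obtain ⟨j, rfl⟩ := (h.zero_iff x).1 h0
          exact absurd (h.strictMono.lt_iff_lt.1 hx) (by omega))
      have h1 := hpos (μ 0 - 1) (show μ 0 - 1 < κ 0 by linarith [h.lt_zero])
      have h2 := h.two_lt (μ 0 - 1) (by linarith)
      have hr0 : 0 < r := (pos_iff_pos_of_mul_pos h1).2 (by linarith)
      filter_upwards [self_mem_nhdsWithin] with x hx
      have := hpos x hx
      rw [one_mul]
      exact (pos_iff_pos_of_mul_pos this).1 hr0
    simpa using hflip 0 1 this
  | succ n ih =>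
    refine hext (n + 1) _ ?_
    have h1 : ∀ᶠ x in 𝓝[<] (κ (n + 1)), 0 < (-1) ^ (n + 1) * D x := by
      filter_upwards [Ioo_mem_nhdsLT (h.strictMono n.lt_succ_self)] with x hx using ih x hx
    have h2 := hflip (n + 1) _ h1
    filter_upwards [h2] with x hx
    rw [pow_succ]
    linarith

end SpectrumData

end Gaps

/-- Two nondecreasing sequences with the same finite multiplicities agree. -/
lemma eq_of_encard_fiber_eq {μ μ' : ℕ → ℝ} (hμ : Monotone μ) (hμ' : Monotone μ')
    (hfin : ∀ x, {k | μ k = x}.Finite) (h : ∀ x, {k | μ k = x}.encard = {k | μ' k = x}.encard) :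
    μ = μ' := by
  have hfin' : ∀ x, {k | μ' k = x}.Finite := fun x => by
    rw [← encard_lt_top_iff, ← h x, encard_lt_top_iff]; exact hfin x
  -- at the first index of disagreement the smaller value has too few indices in one sequence
  have key : ∀ (f g : ℕ → ℝ), Monotone f → Monotone g → (∀ x, {k | f k = x}.Finite) →
      (∀ x, {k | f k = x}.encard = {k | g k = x}.encard) → ∀ k, (∀ j < k, f j = g j) → ¬ f k < g k := by
    intro f g hf hg hff hfg k hk hlt
    have hsub : {j | g j = f k} ⊂ {j | f j = f k} := by
      refine ⟨fun j hj => ?_, fun hcon => ?_⟩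
      · have hjk : j < k := by
          by_contra! hcon
          have := hg hcon
          rw [mem_ofPred_eq] at hj
          linarith
        rw [mem_ofPred_eq, hk j hjk]; exact hj
      · have : g k = f k := hcon (show k ∈ {j | f j = f k} from rfl)
        linarith
    have := ((hff (f k)).subset hsub.1).encard_lt_encard hsub
    rw [hfg] at this
    exact lt_irrefl _ this
  funext k
  induction k using Nat.strong_induction_on with
  | _ k ih =>
    rcases lt_trichotomy (μ k) (μ' k) with h1 | h1 | h1
    · exact absurd h1 (key μ μ' hμ hμ' hfin h k ih)
    · exact h1
    · exact absurd h1 (key μ' μ hμ' hμ hfin' (fun x => (h x).symm) k fun j hj => (ih j hj).symm)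

/-! ### The spectrum of the discriminant -/

section Spectrum

variable {V : ℝ → ℝ} (hV : ∀ a b : ℝ, IntervalIntegrable V volume a b)
include hV

lemma hillDisc_ofReal_eq (x : ℝ) : hillDisc V x = ((hillDisc V x).re : ℂ) :=
  Complex.ext (by simp) (by simp [hillDisc_im hV x])

lemma hillDisc_sq_eq_four_iff (x : ℝ) : hillDisc V x ^ 2 = 4 ↔ |(hillDisc V x).re| = 2 := by
  rw [hillDisc_ofReal_eq hV x, Complex.ofReal_re, ← sq_abs_iff_four]
  norm_cast
where
  sq_abs_iff_four : ∀ {a : ℝ}, a ^ 2 = 4 ↔ |a| = 2 := by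
    intro a
    rw [show (4 : ℝ) = 2 ^ 2 by norm_num, sq_eq_sq_iff_abs_eq_abs]
    norm_num

/-- Next to a point of multiplicity two the discriminant lies in a band. -/
lemma eventually_abs_hillDisc_lt {x : ℝ} (h : |(hillDisc V x).re| = 2)
    (h0 : deriv (fun s : ℝ => (hillDisc V s).re) x = 0) :
    ∀ᶠ y : ℝ in 𝓝[≠] x, |(hillDisc V y).re| < 2 := by
  obtain ⟨σ, hσ, hA, hB, hC, hD⟩ := monodromy_scalar_of_deriv_eq_zero hV
    (by rw [← sq_abs, h]; norm_num) h0
  obtain ⟨κ, hκ, -, hκ0, hexp⟩ := exists_scalar_expansion hV hA hB hC hD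
  have hκr : Continuous fun y : ℝ => (κ y).re :=
    Complex.continuous_re.comp (hκ.comp Complex.continuous_ofReal)
  have hre : ∀ y : ℝ, (hillDisc V y).re = σ * (2 - (y - x) ^ 2 * (κ y).re) := by
    intro y
    have e : ((y : ℂ) - x) ^ 2 = (((y - x) ^ 2 : ℝ) : ℂ) := by push_cast; rfl
    rw [hexp, Complex.re_ofReal_mul, Complex.sub_re, e, Complex.re_ofReal_mul]
    simp
  have h1 : ∀ᶠ y : ℝ in 𝓝 x, 0 < (κ y).re := hκr.continuousAt.eventually (lt_mem_nhds hκ0)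
  have h2 : ∀ᶠ y : ℝ in 𝓝 x, (y - x) ^ 2 * (κ y).re < 4 := by
    have : Continuous fun y : ℝ => (y - x) ^ 2 * (κ y).re := by fun_prop
    exact (this.tendsto' x 0 (by simp)).eventually (gt_mem_nhds four_pos)
  have hσ1 : |σ| = 1 := by
    rw [← sq_abs] at hσ
    nlinarith [abs_nonneg σ]
  filter_upwards [nhdsWithin_le_nhds h1, nhdsWithin_le_nhds h2, self_mem_nhdsWithin] with y hy1 hy2 hy3
  rw [hre, abs_mul, hσ1, one_mul, abs_lt]
  have : 0 < (y - x) ^ 2 := by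
    have : y - x ≠ 0 := sub_ne_zero.2 hy3
    positivity
  constructor <;> nlinarith [mul_pos this hy1]

/-- The discriminant at real parameters has the shape required of spectral data; the zeros can be
listed because their number below `(n π)²` is `n` for all large `n`. -/
theorem exists_spectrumData_hillDisc :
    ∃ κ μ, SpectrumData (fun x : ℝ => (hillDisc V x).re) κ μ := by
  set K := ∫ t in (0 : ℝ)..1, |V t| with hK
  have hK0 : 0 ≤ K := intervalIntegral.integral_nonneg zero_le_one fun t _ => abs_nonneg _
  set S := {x : ℝ | (hillDisc V x).re = 0} with hS
  have hcount : ∀ n : ℕ, 1 ≤ n → 5 * K ≤ n → {x : ℝ | (hillDisc V x).re = 0 ∧ x < (n * Real.pi) ^ 2}.Finite ∧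
      {x : ℝ | (hillDisc V x).re = 0 ∧ x < (n * Real.pi) ^ 2}.ncard = n := by
    intro n hn h5
    have hn' : (1 : ℝ) ≤ n := by exact_mod_cast hn
    have hpi := Real.pi_gt_three
    refine ncard_hillDisc_zeros hV (by positivity) (by nlinarith) (by nlinarith) (by nlinarith) ?_
    rw [Real.cos_nat_mul_pi]
    norm_num
  have hex : ∀ X : ℝ, ∃ n : ℕ, 1 ≤ n ∧ 5 * K ≤ n ∧ X ≤ (n * Real.pi) ^ 2 := by
    intro X
    obtain ⟨n, hn⟩ := exists_nat_ge (1 + 5 * K + |X|)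
    have hpi := Real.pi_gt_three
    have h1 := le_abs_self X
    have h2 := abs_nonneg X
    have hn1 : (1 : ℝ) ≤ n := by linarith
    refine ⟨n, by exact_mod_cast hn1, by linarith, ?_⟩
    have : (n : ℝ) ≤ n * Real.pi := by nlinarith
    nlinarith
  obtain ⟨κ, hκ, hr⟩ := exists_strictMono_range_eq (S := S) (fun X => by
    obtain ⟨n, hn1, hn2, hn3⟩ := hex X
    exact (hcount n hn1 hn2).1.subset fun x hx => ⟨hx.1, lt_of_lt_of_le hx.2 hn3⟩) (fun X => by
    by_contra! hcon
    obtain ⟨n, hn1, hn2, hn3⟩ := hex X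
    have h1 := (hcount n hn1 hn2).2
    have h2 := (hcount (n + 1) (by omega) (by push_cast; linarith)).2
    have e : ∀ Y, X ≤ Y → {x : ℝ | (hillDisc V x).re = 0 ∧ x < Y} = S := fun Y hY => by
      ext x
      exact ⟨fun h => h.1, fun h => ⟨h, (hcon x h).trans_le hY⟩⟩
    rw [e _ hn3] at h1
    rw [e _ (hn3.trans (by push_cast; gcongr; linarith))] at h2
    omega)
  obtain ⟨μ, hμ⟩ := exists_spectrumData (differentiable_hillDisc_re hV)
    (fun x => deriv_hillDisc_ne_zero hV) (fun x => eventually_abs_hillDisc_lt hV)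
    (A := -(K + K ^ 2) - 1) (fun x hx => two_lt_hillDisc hV (by linarith)) hκ
    (fun x => by rw [hr]; rfl) (fun x => by
      by_contra! hcon
      obtain ⟨n, hn1, hn2, hn3⟩ := hex (x + 1)
      have h := (hcount n hn1 hn2).1
      refine Set.infinite_of_injective_forall_mem hκ.injective (fun j => ?_) h
      have hj : κ j ∈ S := hr ▸ mem_range_self j
      exact ⟨hj, by linarith [hcon j]⟩)
  exact ⟨κ, μ, hμ⟩

end Spectrum

/-! ### The periodic eigenspaces -/

/-- The periodic extension to `ℝ` of a potential. -/
noncomputable def potentialLift (q : Potential) : ℝ → ℝ := fun t => q (t : UnitAddCircle)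

lemma potentialLift_periodic (q : Potential) : Function.Periodic (potentialLift q) 1 := by
  intro t
  simp only [potentialLift]
  congr 1
  exact AddCircle.coe_add_period 1 t

lemma integrable_potential (q : Potential) : Integrable q volume :=
  (Lp.memLp q).integrable one_le_two

lemma intervalIntegrable_potentialLift (q : Potential) (a b : ℝ) :
    IntervalIntegrable (potentialLift q) volume a b := by
  refine (potentialLift_periodic q).intervalIntegrable₀ one_ne_zero ?_ a b
  rw [intervalIntegrable_iff_integrableOn_Ioc_of_le zero_le_one]
  have h := (UnitAddCircle.measurePreserving_mk 0).integrable_comp_of_integrable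
    (integrable_potential q)
  rw [zero_add] at h
  exact h

lemma integral_abs_potentialLift_le (q : Potential) :
    ∫ t in (0 : ℝ)..1, |potentialLift q t| ≤ ‖q‖ := by
  have h1 := UnitAddCircle.intervalIntegral_preimage 0 fun x => ‖q x‖
  rw [zero_add] at h1
  have h2 : ∫ x, ‖q x‖ = (eLpNorm q 1 volume).toReal := by
    rw [eLpNorm_one_eq_lintegral_enorm, integral_norm_eq_lintegral_enorm (Lp.aestronglyMeasurable q)]
  calc ∫ t in (0 : ℝ)..1, |potentialLift q t| = (eLpNorm q 1 volume).toReal := by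
        rw [← h2, ← h1]; rfl
    _ ≤ (eLpNorm q 2 volume).toReal := by
        have : IsProbabilityMeasure (volume : Measure UnitAddCircle) := ⟨by simp⟩
        refine ENNReal.toReal_mono (Lp.memLp q).2.ne ?_
        exact eLpNorm_le_eLpNorm_of_exponent_le one_le_two (Lp.aestronglyMeasurable q)
    _ = ‖q‖ := (Lp.norm_def q).symm

lemma isHillSolution_iff (q : Potential) (lam : ℂ) (y : ℝ → ℂ) : IsHillSolution q lam y ↔
    IsSol (hillCoeff (potentialLift q) lam) fun t => (y t, deriv y t) := by
  have hV := intervalIntegrable_potentialLift q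
  constructor
  · rintro ⟨hd, h⟩
    have hs : IsPrim (fun t => hillCoeff (potentialLift q) lam t * y t) (deriv y) :=
      ⟨fun a b => (intervalIntegrable_hillCoeff hV lam a b).mul_continuousOn
        hd.continuous.continuousOn, h⟩
    exact IsSol.mk (IsPrim.of_hasDerivAt (fun x => (hd x).hasDerivAt) hs.continuous) hs
  · intro h
    exact ⟨fun x => (hasDerivAt_fst h x).differentiableAt, h.snd.eq⟩

lemma isHillSolution_of_isSol {q : Potential} {lam : ℂ} {Y : ℝ → ℂ × ℂ}
    (hY : IsSol (hillCoeff (potentialLift q) lam) Y) :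
    IsHillSolution q lam (fun t => (Y t).1) ∧ (deriv fun t => (Y t).1) = fun t => (Y t).2 := by
  have h : (deriv fun t => (Y t).1) = fun t => (Y t).2 :=
    funext fun x => (hasDerivAt_fst hY x).deriv
  exact ⟨(isHillSolution_iff _ _ _).2 (by rw [h]; exact hY), h⟩

lemma hillSolution_eq (q : Potential) (lam a b : ℂ) :
    hillSolution q lam a b = fun t => (hillFlow (potentialLift q) lam (a, b) t).1 := by
  have hV := intervalIntegrable_potentialLift q
  have hsol := isSol_hillFlow hV lam (a, b)
  have h0 := hillFlow_zero hV lam (a, b)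
  obtain ⟨h1, h2⟩ := isHillSolution_of_isSol hsol
  have hspec := Classical.epsilon_spec
    (p := fun y => IsHillSolution q lam y ∧ y 0 = a ∧ deriv y 0 = b)
    ⟨_, h1, by simp [h0], by rw [h2]; simp [h0]⟩
  have h := eq_hillFlow hV ((isHillSolution_iff _ _ _).1 hspec.1)
  rw [hspec.2.1, hspec.2.2] at h
  funext t
  exact congrArg Prod.fst (congrFun h t)

lemma discriminant_eq (q : Potential) : discriminant q = hillDisc (potentialLift q) := by
  have hV := intervalIntegrable_potentialLift q
  funext lam
  rw [discriminant, hillDisc, hillSolution_eq, hillSolution_eq,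
    (isHillSolution_of_isSol (isSol_hillFlow hV lam (0, 1))).2]

section Eigenspace

variable {V : ℝ → ℝ} (hV : ∀ a b : ℝ, IntervalIntegrable V volume a b)
include hV

/-- The flow of Hill's equation over `[0, x]` as a linear map of the initial values. -/
noncomputable def hillFlowMap (lam : ℂ) (x : ℝ) : ℂ × ℂ →ₗ[ℂ] ℂ × ℂ where
  toFun v := hillFlow V lam v x
  map_add' v w := by
    rw [hillFlow_eq_comb hV lam (v + w), hillFlow_eq_comb hV lam v, hillFlow_eq_comb hV lam w]
    simp only [Prod.fst_add, Prod.snd_add, add_smul]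
    abel
  map_smul' c v := by
    rw [hillFlow_eq_comb hV lam (c • v), hillFlow_eq_comb hV lam v]
    simp only [Prod.smul_fst, Prod.smul_snd, smul_eq_mul, mul_smul, smul_add, RingHom.id_apply]

/-- The solution with given initial values, as a linear map. -/
noncomputable def hillSolutionMap (lam : ℂ) : ℂ × ℂ →ₗ[ℂ] (ℝ → ℂ) where
  toFun v t := (hillFlow V lam v t).1
  map_add' v w := by
    funext t
    exact congrArg Prod.fst ((hillFlowMap hV lam t).map_add v w)
  map_smul' c v := by
    funext t
    exact congrArg Prod.fst ((hillFlowMap hV lam t).map_smul c v)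

/-- For a periodic potential the flow over `[0, x + 1]` factors through the monodromy. -/
lemma hillFlow_add_one (hper : Function.Periodic V 1) (lam : ℂ) (v : ℂ × ℂ) (x : ℝ) :
    hillFlow V lam v (x + 1) = hillFlow V lam (hillFlow V lam v 1) x := by
  have h := isSol_hillFlow hV lam v
  have hs : IsSol (hillCoeff V lam) fun t => hillFlow V lam v (t + 1) := by
    refine ⟨fun a b => ?_, fun x => ?_⟩
    · exact intervalIntegrable_coeff (intervalIntegrable_hillCoeff hV lam)
        (h.continuous.comp (continuous_add_const 1)) a b
    · have h1 := IsPrim.sub_eq h 1 (x + 1)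
      have e : ∀ t, hillCoeff V lam t = hillCoeff V lam (t + 1) := fun t => by
        simp only [hillCoeff, hper t]
      have h2 := intervalIntegral.integral_comp_add_right (a := 0) (b := x)
        (fun t => ((hillFlow V lam v t).2, hillCoeff V lam t * (hillFlow V lam v t).1)) 1
      rw [zero_add] at h2
      simp only [zero_add]
      rw [intervalIntegral.integral_congr fun t _ => by rw [e t]]
      rw [h2, ← h1]; abel
  have := congrFun (eq_hillFlow hV hs) x
  simpa using this

/-- The trace and the determinant of the monodromy give its characteristic equation. -/
lemma hillFlow_two (hper : Function.Periodic V 1) (lam : ℂ) (v : ℂ × ℂ) :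
    hillFlow V lam v 2 = hillDisc V lam • hillFlow V lam v 1 - v := by
  have h2 : hillFlow V lam v 2 = hillFlow V lam (hillFlow V lam v 1) 1 := by
    rw [← hillFlow_add_one hV hper]; norm_num
  have hW := wronskian_eq_one hV lam 1
  rw [h2, hillFlow_eq_comb hV lam (hillFlow V lam v 1), hillFlow_eq_comb hV lam v 1, hillDisc]
  ext
  · simp only [Prod.fst_add, Prod.smul_fst, Prod.snd_add, Prod.smul_snd, smul_eq_mul, Prod.fst_sub]
    linear_combination (-v.1) * hW
  · simp only [Prod.fst_add, Prod.smul_fst, Prod.snd_add, Prod.smul_snd, smul_eq_mul, Prod.snd_sub]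
    linear_combination (-v.2) * hW

lemma hillFlow_two_eq_self_iff (hper : Function.Periodic V 1) (lam : ℂ) (v : ℂ × ℂ) :
    hillFlow V lam v 2 = v ↔ hillDisc V lam • hillFlow V lam v 1 = (2 : ℂ) • v := by
  rw [hillFlow_two hV hper, sub_eq_iff_eq_add, two_smul]

end Eigenspace

section Multiplicity

variable (q : Potential)

/-- The periodic solutions correspond to the fixed points of the monodromy over the double period. -/
lemma periodicSolutions_eq (lam : ℂ) : periodicSolutions q lam =
    hillSolutionMap (intervalIntegrable_potentialLift q) lam ''
      (LinearMap.ker (hillFlowMap (intervalIntegrable_potentialLift q) lam 2 - LinearMap.id) : Set (ℂ × ℂ)) := by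
  have hV := intervalIntegrable_potentialLift q
  have hper := potentialLift_periodic q
  ext y
  simp only [periodicSolutions, mem_ofPred_eq, mem_image, SetLike.mem_coe, LinearMap.mem_ker,
    LinearMap.sub_apply, LinearMap.id_apply, sub_eq_zero]
  constructor
  · rintro ⟨hy, hp⟩
    have h := eq_hillFlow hV ((isHillSolution_iff _ _ _).1 hy)
    refine ⟨(y 0, deriv y 0), ?_, ?_⟩
    · have h2 := congrFun h 2
      change hillFlow (potentialLift q) lam (y 0, deriv y 0) 2 = _
      rw [← h2]
      have hp0 : y 2 = y 0 := by simpa using hp 0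
      have hd : deriv y 2 = deriv y 0 := by
        have e : (fun t => y (t + 2)) = y := funext hp
        have := deriv_comp_add_const (f := y) 2 0
        rw [e] at this
        simpa using this.symm
      rw [hp0, hd]
    · funext t
      exact (congrArg Prod.fst (congrFun h t)).symm
  · rintro ⟨v, hv, rfl⟩
    change hillFlow (potentialLift q) lam v 2 = v at hv
    refine ⟨(isHillSolution_of_isSol (isSol_hillFlow hV lam v)).1, fun t => ?_⟩
    change (hillFlow (potentialLift q) lam v (t + 2)).1 = (hillFlow (potentialLift q) lam v t).1
    have h2 : hillFlow (potentialLift q) lam v 2 =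
        hillFlow (potentialLift q) lam (hillFlow (potentialLift q) lam v 1) 1 := by
      rw [← hillFlow_add_one hV hper]; norm_num
    rw [show t + 2 = (t + 1) + 1 by ring, hillFlow_add_one hV hper, hillFlow_add_one hV hper, ← h2, hv]

lemma finrank_periodicSolutions_eq (lam : ℂ) : Set.finrank ℂ (periodicSolutions q lam) =
    Module.finrank ℂ (LinearMap.ker (hillFlowMap (intervalIntegrable_potentialLift q) lam 2 - LinearMap.id)) := by
  have hV := intervalIntegrable_potentialLift q
  rw [periodicSolutions_eq, Set.finrank, ← Submodule.map_coe, Submodule.span_eq]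
  refine (Submodule.equivMapOfInjective _ ?_ _).finrank_eq.symm
  rw [← LinearMap.ker_eq_bot, LinearMap.ker_eq_bot']
  intro v hv
  have h := eq_zero_of_fst_eq_zero (isSol_hillFlow hV lam v) fun x _ => congrFun hv x
  rwa [hillFlow_zero hV] at h

lemma mem_ker_hillFlowMap (lam : ℂ) (v : ℂ × ℂ) :
    v ∈ LinearMap.ker (hillFlowMap (intervalIntegrable_potentialLift q) lam 2 - LinearMap.id) ↔
      hillDisc (potentialLift q) lam • hillFlow (potentialLift q) lam v 1 = (2 : ℂ) • v := by
  rw [LinearMap.mem_ker, LinearMap.sub_apply, sub_eq_zero,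
    ← hillFlow_two_eq_self_iff (intervalIntegrable_potentialLift q) (potentialLift_periodic q)]
  rfl

lemma finrank_periodicSolutions_of_ne {lam : ℂ} (h : hillDisc (potentialLift q) lam ^ 2 ≠ 4) :
    Set.finrank ℂ (periodicSolutions q lam) = 0 := by
  have hV := intervalIntegrable_potentialLift q
  rw [finrank_periodicSolutions_eq, Submodule.finrank_eq_zero, Submodule.eq_bot_iff]
  intro v hv
  have h1 := (mem_ker_hillFlowMap q lam v).1 hv
  have h2 : hillFlow (potentialLift q) lam v 2 = v :=
    (hillFlow_two_eq_self_iff hV (potentialLift_periodic q) lam v).2 h1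
  set d := hillDisc (potentialLift q) lam
  -- apply the monodromy to `d • M v = 2 • v` once more
  have h3 : d • hillFlow (potentialLift q) lam v 2 = (2 : ℂ) • hillFlow (potentialLift q) lam v 1 := by
    have := congrArg (hillFlowMap hV lam 1) h1
    rw [map_smul, map_smul] at this
    have e : hillFlowMap hV lam 1 (hillFlow (potentialLift q) lam v 1) =
        hillFlow (potentialLift q) lam v 2 := by
      change hillFlow (potentialLift q) lam (hillFlow (potentialLift q) lam v 1) 1 = _
      rw [← hillFlow_add_one hV (potentialLift_periodic q)]; norm_num
    rw [e] at this
    exact this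
  rw [h2] at h3
  have h4 : (d ^ 2 - 4) • v = 0 := by
    have : d • d • v = (4 : ℂ) • v := by
      rw [h3, smul_comm, h1, smul_smul]; norm_num
    rw [sub_smul, sq, mul_smul, this, sub_self]
  exact (smul_eq_zero.1 h4).resolve_left (sub_ne_zero.2 h)

/-- The multiplicity of a real periodic eigenvalue is the order to which `Δ² - 4` vanishes. If the
eigenspace is the whole plane then the monodromy is scalar, and `Δ' = 0`; the converse is
`monodromy_scalar_of_deriv_eq_zero`. -/
lemma finrank_periodicSolutions_ofReal (x : ℝ) : Set.finrank ℂ (periodicSolutions q x) =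
    if |(hillDisc (potentialLift q) x).re| = 2 then
      (if deriv (fun s : ℝ => (hillDisc (potentialLift q) s).re) x = 0 then 2 else 1) else 0 := by
  have hV := intervalIntegrable_potentialLift q
  by_cases hx : |(hillDisc (potentialLift q) x).re| = 2
  swap
  · rw [if_neg hx]
    exact finrank_periodicSolutions_of_ne q fun h => hx ((hillDisc_sq_eq_four_iff hV x).1 h)
  rw [if_pos hx, finrank_periodicSolutions_eq]
  have hsq := (hillDisc_sq_eq_four_iff hV x).2 hx
  split_ifs with h0
  · obtain ⟨σ, hσ, hA, hB, hC, hD⟩ := monodromy_scalar_of_deriv_eq_zero hV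
      (by rw [← sq_abs, hx]; norm_num) h0
    have : LinearMap.ker (hillFlowMap hV x 2 - LinearMap.id) = ⊤ := by
      rw [Submodule.eq_top_iff']
      intro v
      rw [mem_ker_hillFlowMap, hillFlow_eq_comb hV, hillDisc, hA, hD]
      have hσ' : (σ : ℂ) ^ 2 = 1 := by exact_mod_cast hσ
      ext
      · simp only [Prod.fst_add, Prod.smul_fst, smul_eq_mul, hA, hB]
        linear_combination 2 * v.1 * hσ'
      · simp only [Prod.snd_add, Prod.smul_snd, smul_eq_mul, hC, hD]
        linear_combination 2 * v.2 * hσ'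
    rw [this, finrank_top]; simp
  · set d := hillDisc (potentialLift q) x with hd
    have hd0 : d ≠ 0 := fun h => by rw [h] at hsq; norm_num at hsq
    have hlt : Module.finrank ℂ (LinearMap.ker (hillFlowMap hV x 2 - LinearMap.id)) < 2 := by
      have e2 : Module.finrank ℂ (ℂ × ℂ) = 2 := by simp
      rw [← e2]
      refine Submodule.finrank_lt fun htop => h0 ?_
      have h1 : ∀ v, hillFlow (potentialLift q) x v 1 = (2 / d) • v := fun v => by
        have : v ∈ LinearMap.ker (hillFlowMap hV x 2 - LinearMap.id) := htop ▸ Submodule.mem_top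
        have := (mem_ker_hillFlowMap q x v).1 this
        rw [div_eq_inv_mul, mul_smul, ← this, smul_smul, inv_mul_cancel₀ hd0, one_smul]
      have hder := hasDerivAt_hillDisc hV (x : ℂ)
      simp only [h1, Prod.smul_fst, Prod.smul_snd, smul_eq_mul, mul_zero, mul_one, zero_mul,
        sub_zero, add_zero] at hder
      have ov : ∀ Y Z, overlap Y Z = overlap Z Y := fun Y Z => by
        simp only [overlap, mul_comm]
      rw [ov, sub_self] at hder
      have := hder.real_of_complex
      simpa using this.deriv
    have hpos : 0 < Module.finrank ℂ (LinearMap.ker (hillFlowMap hV x 2 - LinearMap.id)) := by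
      obtain ⟨v, hv, hv1⟩ := exists_multiplier_solution hV (lam := x) (σ := d / 2)
        (by rw [div_pow, hsq]; norm_num) (by rw [← hd]; ring)
      have hmem : v ∈ LinearMap.ker (hillFlowMap hV x 2 - LinearMap.id) := by
        rw [mem_ker_hillFlowMap, hv1, smul_smul, ← hd]
        congr 1
        linear_combination hsq / 2
      exact Module.finrank_pos_iff_exists_ne_zero.2 ⟨⟨v, hmem⟩, fun h => hv (congrArg Subtype.val h)⟩
    omega

end Multiplicity

/-- The spectral data read off from the discriminant are the listed periodic spectrum: the latter is
defined by a choice, but a nondecreasing sequence is determined by its multiplicities. -/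
theorem exists_spectrumData_periodicSpectrum (q : Potential) : ∃ κ,
    SpectrumData (fun x : ℝ => (hillDisc (potentialLift q) x).re) κ (periodicSpectrum q) := by
  have hV := intervalIntegrable_potentialLift q
  obtain ⟨κ, μ, h⟩ := exists_spectrumData_hillDisc hV
  have hreal : ∀ ν : ℕ → ℝ, ∀ x : ℝ, {k : ℕ | (ν k : ℂ) = x} = {k | ν k = x} := fun ν x => by
    ext k; simp
  have hμ : IsPeriodicSpectrum q μ := by
    refine ⟨h.monotone, fun lam => ?_⟩
    by_cases hl : lam.im = 0
    · rw [show lam = (lam.re : ℂ) from Complex.ext rfl (by simp [hl])]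
      rw [hreal, h.encard_fiber, finrank_periodicSolutions_ofReal]
      split_ifs <;> simp
    · rw [finrank_periodicSolutions_of_ne q fun hsq => hl (real_of_hillDisc_sq hV hsq).1]
      rw [Nat.cast_zero, encard_eq_zero]
      ext k
      simp only [mem_ofPred_eq, mem_empty_iff_false, iff_false]
      rintro rfl
      simp at hl
  have hq : IsPeriodicSpectrum q (periodicSpectrum q) := Classical.epsilon_spec ⟨μ, hμ⟩
  have : μ = periodicSpectrum q := by
    refine eq_of_encard_fiber_eq hμ.1 hq.1 (fun x => ?_) fun x => ?_
    · rw [← encard_lt_top_iff, ← hreal, hμ.2]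
      exact ENat.natCast_lt_top _
    · rw [← hreal, ← hreal, hμ.2, hq.2]
  exact ⟨κ, this ▸ h⟩

/-! ### Localization of the gaps -/

lemma cos_sq_le_half {N : ℕ} {ν : ℝ} (h1 : Real.pi / 4 ≤ |ν - N * Real.pi|)
    (h2 : |ν - N * Real.pi| ≤ 3 * Real.pi / 4) : Real.cos ν ^ 2 ≤ 1 / 2 := by
  have h := Real.cos_nonpos_of_pi_div_two_le_of_le (x := 2 * |ν - N * Real.pi|) (by linarith)
    (by linarith)
  rw [show 2 * |ν - N * Real.pi| = |2 * ν - N * (2 * Real.pi)| by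
    rw [← abs_two, ← abs_mul, abs_two]; congr 1; ring, Real.cos_abs, Real.cos_sub_nat_mul_two_pi,
    Real.cos_two_mul] at h
  linarith

lemma abs_cos_eq_cos_sub (N : ℕ) (ν : ℝ) : |Real.cos ν| = |Real.cos (ν - N * Real.pi)| := by
  rw [Real.cos_sub_nat_mul_pi, abs_mul, abs_pow, abs_neg, abs_one, one_pow, one_mul]

section Windows

variable {V : ℝ → ℝ} (hV : ∀ a b : ℝ, IntervalIntegrable V volume a b)
include hV

/-- Away from the points `N π` the energies `ν²` belong to bands: there `2 |cos ν| ≤ √2`, and the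
discriminant differs from `2 cos ν` by at most `1/2`. -/
lemma abs_hillDisc_lt_two {N : ℕ} {ν : ℝ} (h0 : 0 < ν) (h5 : 5 * (∫ t in (0 : ℝ)..1, |V t|) ≤ ν)
    (h1 : Real.pi / 4 ≤ |ν - N * Real.pi|) (h2 : |ν - N * Real.pi| ≤ 3 * Real.pi / 4) :
    |(hillDisc V ((ν ^ 2 : ℝ) : ℂ)).re| < 2 := by
  have h3 := abs_lt.1 (abs_hillDisc_sub_cos_le hV h0 h5)
  have h4 : |Real.cos ν| < 3 / 4 := by
    refine abs_lt_of_sq_lt_sq ?_ (by norm_num)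
    linarith [cos_sq_le_half h1 h2]
  have h5 := abs_lt.1 h4
  rw [abs_lt]
  constructor <;> linarith [h3.1, h3.2, h5.1, h5.2]

variable {κ μ : ℕ → ℝ} (h : SpectrumData (fun x : ℝ => (hillDisc V x).re) κ μ)
include h

/-- The zeros of the discriminant on either side of `ν²` are those of the zero potential. -/
lemma SpectrumData.zero_lt_iff {n : ℕ} {ν : ℝ} (h0 : 0 < ν) (h1 : ((n : ℝ) - 1 / 2) * Real.pi < ν)
    (h2 : ν < ((n : ℝ) + 1 / 2) * Real.pi) (h5 : 5 * (∫ t in (0 : ℝ)..1, |V t|) ≤ ν)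
    (hcos : 1 / 4 ≤ |Real.cos ν|) (j : ℕ) : κ j < ν ^ 2 ↔ j < n := by
  obtain ⟨hf, hn⟩ := ncard_hillDisc_zeros hV h0 h1 h2 h5 hcos
  have e : {x : ℝ | x ∈ range κ ∧ x < ν ^ 2} = {x : ℝ | (hillDisc V x).re = 0 ∧ x < ν ^ 2} := by
    ext x
    simp only [mem_ofPred_eq, ← h.zero_iff x]
  exact lt_iff_lt_ncard h.strictMono (e ▸ hf) (by rw [e]; exact hn) j

/-- The upper end of gap number `n + 1` lies below `((n + 1 + 1/4) π)²`. By the count of zeros it lies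
below `((n + 1 + 3/5) π)²`, and the energies between these two bounds belong to a band. The number
`3/5` exceeds `1/2`, so that the next zero is counted. -/
lemma SpectrumData.even_lt {n : ℕ}
    (h5 : 5 * (∫ t in (0 : ℝ)..1, |V t|) ≤ ((n : ℝ) + 5 / 4) * Real.pi) :
    μ (2 * n + 2) < (((n : ℝ) + 5 / 4) * Real.pi) ^ 2 := by
  have hpi := Real.pi_gt_d2
  have hpi' := Real.pi_lt_d2
  have hn : (0 : ℝ) ≤ n := n.cast_nonneg
  by_contra! hcon
  -- the interval between `(n + 1 + 1/4) π` and `(n + 1 + 3/5) π` belongs to a band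
  have hup : μ (2 * n + 2) < (((n : ℝ) + 8 / 5) * Real.pi) ^ 2 := by
    refine (h.lt_succ n).trans ?_
    refine (SpectrumData.zero_lt_iff hV h (n := n + 2) (by positivity) (by push_cast; nlinarith)
      (by push_cast; nlinarith) (by nlinarith) ?_ (n + 1)).2 (by omega)
    rw [abs_cos_eq_cos_sub (n + 1), show ((n : ℝ) + 8 / 5) * Real.pi - ((n + 1 : ℕ) : ℝ) * Real.pi =
      Real.pi / 10 + Real.pi / 2 by push_cast; ring, Real.cos_add_pi_div_two, abs_neg]
    refine le_trans ?_ (le_abs_self _)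
    have := Real.sin_gt_sub_cube (x := Real.pi / 10) (by positivity)
    have h3 : (Real.pi / 10) ^ 3 ≤ (1 / 3) ^ 3 := pow_le_pow_left₀ (by positivity) (by linarith) 3
    linarith
  set ν := √(μ (2 * n + 2)) with hν
  have hμ0 : 0 ≤ μ (2 * n + 2) := le_trans (by positivity) hcon
  have hsq : ν ^ 2 = μ (2 * n + 2) := Real.sq_sqrt hμ0
  have hν0 : 0 ≤ ν := Real.sqrt_nonneg _
  rw [← hsq] at hcon hup
  have h1 : ((n : ℝ) + 5 / 4) * Real.pi ≤ ν := le_of_sq_le_sq hcon hν0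
  have h2 : ν < ((n : ℝ) + 8 / 5) * Real.pi := lt_of_pow_lt_pow_left₀ 2 (by positivity) hup
  have habs : |ν - ((n + 1 : ℕ) : ℝ) * Real.pi| = ν - ((n + 1 : ℕ) : ℝ) * Real.pi :=
    abs_of_nonneg (by push_cast; nlinarith)
  have := abs_hillDisc_lt_two hV (N := n + 1) (ν := ν) (by nlinarith) (by linarith)
    (by rw [habs]; push_cast; linarith) (by rw [habs]; push_cast; linarith)
  rw [hsq] at this
  linarith [h.abs_eq (2 * n + 2)]

/-- The lower end of gap number `n + 1` lies above `((n + 1 - 1/4) π)²`, since it lies above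
`((n + 1 - 3/5) π)²` and the energies between these two bounds belong to a band. -/
lemma SpectrumData.lt_odd_of_le {n : ℕ}
    (h5 : 5 * (∫ t in (0 : ℝ)..1, |V t|) ≤ ((n : ℝ) + 2 / 5) * Real.pi) :
    (((n : ℝ) + 3 / 4) * Real.pi) ^ 2 < μ (2 * n + 1) := by
  have hpi := Real.pi_gt_d2
  have hpi' := Real.pi_lt_d2
  have hn : (0 : ℝ) ≤ n := n.cast_nonneg
  by_contra! hcon
  have hlow : (((n : ℝ) + 2 / 5) * Real.pi) ^ 2 < μ (2 * n + 1) := by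
    refine lt_of_le_of_lt ?_ (h.zero_lt n)
    refine not_lt.1 fun hlt => ?_
    have := (SpectrumData.zero_lt_iff hV h (n := n) (by positivity) (by nlinarith)
      (by nlinarith) h5 ?_ n).1 hlt
    · omega
    rw [abs_cos_eq_cos_sub n, show ((n : ℝ) + 2 / 5) * Real.pi - (n : ℝ) * Real.pi =
      Real.pi / 2 - Real.pi / 10 by ring, Real.cos_pi_div_two_sub]
    refine le_trans ?_ (le_abs_self _)
    have := Real.sin_gt_sub_cube (x := Real.pi / 10) (by positivity)
    have h3 : (Real.pi / 10) ^ 3 ≤ (1 / 3) ^ 3 := pow_le_pow_left₀ (by positivity) (by linarith) 3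
    linarith
  set ν := √(μ (2 * n + 1)) with hν
  have hμ0 : 0 ≤ μ (2 * n + 1) := le_trans (by positivity) hlow.le
  have hsq : ν ^ 2 = μ (2 * n + 1) := Real.sq_sqrt hμ0
  have hν0 : 0 ≤ ν := Real.sqrt_nonneg _
  rw [← hsq] at hcon hlow
  have h1 : ν ≤ ((n : ℝ) + 3 / 4) * Real.pi := le_of_sq_le_sq hcon (by positivity)
  have h2 : ((n : ℝ) + 2 / 5) * Real.pi < ν := lt_of_pow_lt_pow_left₀ 2 hν0 hlow
  have habs : |ν - ((n + 1 : ℕ) : ℝ) * Real.pi| = -(ν - ((n + 1 : ℕ) : ℝ) * Real.pi) :=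
    abs_of_nonpos (by push_cast; nlinarith)
  have := abs_hillDisc_lt_two hV (N := n + 1) (ν := ν) (by nlinarith) (by linarith)
    (by rw [habs]; push_cast; linarith) (by rw [habs]; push_cast; linarith)
  rw [hsq] at this
  linarith [h.abs_eq (2 * n + 1)]

lemma SpectrumData.lower_bound (k : ℕ) :
    -((∫ t in (0 : ℝ)..1, |V t|) + (∫ t in (0 : ℝ)..1, |V t|) ^ 2) ≤ μ k := by
  by_contra! hcon
  have h1 := two_lt_hillDisc hV hcon
  have h2 := h.abs_eq k
  have := le_abs_self (hillDisc V (μ k)).re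
  linarith

/-- The ends of the gaps are `n² π² + O(√n)`. At such an end `ν²` the estimate `Δ - 2 cos ν = O(1/ν)`
gives `1 - |cos ν| = O(1/n)`, hence `|ν - n π| = O(n ^ (-1/2))`. -/
lemma SpectrumData.exists_asymptotics : ∃ C : ℝ, 0 ≤ C ∧ ∀ n : ℕ,
    |μ (2 * n + 1) - ((n + 1 : ℕ) * Real.pi) ^ 2| ≤ C * √(n + 1 : ℕ) ∧
    |μ (2 * n + 2) - ((n + 1 : ℕ) * Real.pi) ^ 2| ≤ C * √(n + 1 : ℕ) := by
  have hpi := Real.pi_gt_d2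
  have hpi' := Real.pi_lt_d2
  set K := ∫ t in (0 : ℝ)..1, |V t| with hK
  have hK0 : 0 ≤ K := intervalIntegral.integral_nonneg zero_le_one fun t _ => abs_nonneg _
  -- the constant arises from `(ν - n π)² ≤ 5 K / n` and `ν + n π ≤ 9 n`
  have hpt : ∀ n : ℕ, 5 * K ≤ n → ∀ x : ℝ, |(hillDisc V x).re| = 2 →
      (((n : ℝ) + 3 / 4) * Real.pi) ^ 2 < x → x < (((n : ℝ) + 5 / 4) * Real.pi) ^ 2 →
      |x - ((n + 1 : ℕ) * Real.pi) ^ 2| ≤ √(405 * K) * √(n + 1 : ℕ) := by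
    intro n h5 x hx hx1 hx2
    have hn : (0 : ℝ) ≤ n := n.cast_nonneg
    have hx0 : 0 ≤ x := le_trans (by positivity) hx1.le
    obtain ⟨ν, hν0, rfl⟩ : ∃ ν, 0 ≤ ν ∧ ν ^ 2 = x := ⟨√x, Real.sqrt_nonneg x, Real.sq_sqrt hx0⟩
    have h1 : ((n : ℝ) + 3 / 4) * Real.pi < ν := lt_of_pow_lt_pow_left₀ 2 hν0 hx1
    have h2 : ν < ((n : ℝ) + 5 / 4) * Real.pi := lt_of_pow_lt_pow_left₀ 2 (by positivity) hx2
    have hνpos : 0 < ν := lt_of_le_of_lt (by positivity) h1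
    have hKν : K / ν ≤ 1 / 5 := by rw [div_le_iff₀ hνpos]; nlinarith
    have hexp : Real.exp (K / ν) ≤ 2 := by
      refine (Real.exp_le_exp.2 hKν).trans ?_
      have := Real.exp_bound_div_one_sub_of_interval (x := 1 / 5) (by norm_num) (by norm_num)
      linarith [show (1 : ℝ) / (1 - 1 / 5) ≤ 2 by norm_num]
    have hest := norm_hillDisc_sub_cos_le hV (ν := (ν : ℂ)) (by exact_mod_cast hνpos.ne')
    rw [Complex.ofReal_im, abs_zero, Real.exp_zero, mul_one, Complex.norm_real, Real.norm_eq_abs,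
      abs_of_pos hνpos, ← hK] at hest
    have hre : |(hillDisc V ((ν ^ 2 : ℝ) : ℂ)).re - 2 * Real.cos ν| ≤ 4 * (K / ν) := by
      have h3 := Complex.abs_re_le_norm (hillDisc V ((ν : ℂ) ^ 2) - 2 * Complex.cos ν)
      rw [← Complex.ofReal_pow, ← Complex.ofReal_cos, Complex.sub_re] at h3
      rw [← Complex.ofReal_pow, ← Complex.ofReal_cos] at hest
      have e : (2 * ((Real.cos ν : ℝ) : ℂ)).re = 2 * Real.cos ν := by
        rw [← Complex.ofReal_ofNat, ← Complex.ofReal_mul, Complex.ofReal_re]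
      rw [e] at h3
      refine (h3.trans hest).trans ?_
      have : 0 ≤ K / ν := by positivity
      nlinarith
    have hcos : 2 - 2 * |Real.cos ν| ≤ 4 * (K / ν) := by
      have h3 := abs_sub_abs_le_abs_sub ((hillDisc V ((ν ^ 2 : ℝ) : ℂ)).re) (2 * Real.cos ν)
      rw [hx, abs_mul, abs_two] at h3
      linarith
    set δ := ν - (n + 1 : ℕ) * Real.pi with hδ
    have hδ1 : |δ| ≤ Real.pi / 4 := by
      rw [abs_le, hδ]; push_cast; constructor <;> linarith
    have hδ2 := Real.cos_le_one_sub_mul_cos_sq (x := δ) (by linarith)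
    have hcosδ : |Real.cos ν| = Real.cos δ := by
      rw [abs_cos_eq_cos_sub (n + 1), ← hδ]
      refine abs_of_nonneg (Real.cos_nonneg_of_mem_Icc ⟨?_, ?_⟩) <;> linarith [(abs_le.1 hδ1).1, (abs_le.1 hδ1).2]
    rw [hcosδ] at hcos
    have hδ3 : δ ^ 2 ≤ Real.pi ^ 2 * (K / ν) := by
      have : 2 / Real.pi ^ 2 * δ ^ 2 ≤ 2 * (K / ν) := by linarith
      rw [div_mul_eq_mul_div, div_le_iff₀ (by positivity)] at this
      linarith
    have hn1 : ((n + 1 : ℕ) : ℝ) = n + 1 := by push_cast; ring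
    have hKn : K / ν ≤ K / (2 * (n + 1 : ℕ)) := by
      refine div_le_div_of_nonneg_left hK0 (by positivity) ?_
      rw [hn1]; nlinarith
    have hδ4 : δ ^ 2 ≤ 5 * K / (n + 1 : ℕ) := by
      have e : 5 * K / (n + 1 : ℕ) = 10 * (K / (2 * (n + 1 : ℕ))) := by field_simp; ring
      rw [e]
      refine hδ3.trans ?_
      have hpi2 : Real.pi ^ 2 ≤ 10 := by nlinarith
      have : 0 ≤ K / ν := by positivity
      exact (mul_le_mul_of_nonneg_right hpi2 this).trans (by gcongr)
    rw [← Real.sqrt_mul (by positivity)]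
    refine Real.abs_le_sqrt ?_
    have e : ν ^ 2 - ((n + 1 : ℕ) * Real.pi) ^ 2 = δ * (ν + (n + 1 : ℕ) * Real.pi) := by
      rw [hδ]; ring
    rw [e, mul_pow]
    have h6 : (ν + (n + 1 : ℕ) * Real.pi) ^ 2 ≤ (9 * (n + 1 : ℕ)) ^ 2 := by
      refine pow_le_pow_left₀ (by positivity) ?_ 2
      rw [hn1]; nlinarith
    calc δ ^ 2 * (ν + (n + 1 : ℕ) * Real.pi) ^ 2
        ≤ (5 * K / (n + 1 : ℕ)) * (9 * (n + 1 : ℕ)) ^ 2 := by gcongr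
      _ = 405 * K * (n + 1 : ℕ) := by
        have : ((n + 1 : ℕ) : ℝ) ≠ 0 := by positivity
        field_simp; ring
  have hev : ∀ᶠ n : ℕ in atTop,
      |μ (2 * n + 1) - ((n + 1 : ℕ) * Real.pi) ^ 2| ≤ √(405 * K) * √(n + 1 : ℕ) ∧
      |μ (2 * n + 2) - ((n + 1 : ℕ) * Real.pi) ^ 2| ≤ √(405 * K) * √(n + 1 : ℕ) := by
    filter_upwards [tendsto_natCast_atTop_atTop.eventually_ge_atTop (5 * K)] with n hn
    have hn0 : (0 : ℝ) ≤ n := n.cast_nonneg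
    have h1 := SpectrumData.lt_odd_of_le hV h (n := n) (by rw [← hK]; nlinarith)
    have h2 := SpectrumData.even_lt hV h (n := n) (by rw [← hK]; nlinarith)
    have h3 := h.le n
    exact ⟨hpt n hn _ (h.abs_eq _) h1 (h3.trans_lt h2), hpt n hn _ (h.abs_eq _) (h1.trans_le h3) h2⟩
  -- a larger constant takes care of the finitely many remaining indices
  have hall : ∀ f : ℕ → ℝ, (∀ᶠ n : ℕ in atTop, |f n| ≤ √(405 * K) * √(n + 1 : ℕ)) →
      ∃ C : ℝ, 0 < C ∧ ∀ n : ℕ, |f n| ≤ C * √(n + 1 : ℕ) := by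
    intro f hf
    have hO : f =O[atTop] fun n : ℕ => √(n + 1 : ℕ) := by
      refine Asymptotics.IsBigO.of_bound (√(405 * K)) ?_
      filter_upwards [hf] with n hn
      rwa [Real.norm_eq_abs, Real.norm_of_nonneg (Real.sqrt_nonneg _)]
    obtain ⟨C, hC, hb⟩ := Asymptotics.bound_of_isBigO_nat_atTop hO
    refine ⟨C, hC, fun n => ?_⟩
    have := @hb n (by positivity)
    rwa [Real.norm_eq_abs, Real.norm_of_nonneg (Real.sqrt_nonneg _)] at this
  obtain ⟨C₁, hC₁, hb₁⟩ := hall _ (hev.mono fun n hn => hn.1)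
  obtain ⟨C₂, hC₂, hb₂⟩ := hall _ (hev.mono fun n hn => hn.2)
  refine ⟨max C₁ C₂, by positivity, fun n => ⟨(hb₁ n).trans ?_, (hb₂ n).trans ?_⟩⟩
  · gcongr; exact le_max_left _ _
  · gcongr; exact le_max_right _ _

end Windows

section EigenvalueBounds

variable (q : Potential) {n : ℕ}

lemma eigMinus_succ (n : ℕ) : eigMinus q (n + 1) = periodicSpectrum q (2 * n + 1) := rfl

lemma eigPlus_succ (n : ℕ) : eigPlus q (n + 1) = periodicSpectrum q (2 * n + 2) := rfl

/-- For `n ≥ 4 ‖q‖` the gap lies between `((n - 1/4) π)²` and `((n + 1/4) π)²`. -/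
lemma eigenvalue_bounds_of_le (hn : 1 ≤ n) (h : 4 * ‖q‖ ≤ n) :
    (n * Real.pi) ^ 2 / 2 ≤ eigMinus q n ∧ eigPlus q n ≤ 2 * (n * Real.pi) ^ 2 := by
  obtain ⟨κ, hκ⟩ := exists_spectrumData_periodicSpectrum q
  have hV := intervalIntegrable_potentialLift q
  have hK := integral_abs_potentialLift_le q
  obtain ⟨n, rfl⟩ := Nat.exists_eq_succ_of_ne_zero (by omega : n ≠ 0)
  have hpi := Real.pi_gt_d2
  rw [Nat.succ_eq_add_one, eigMinus_succ, eigPlus_succ]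
  rw [Nat.succ_eq_add_one] at h
  push_cast at h ⊢
  have hn0 : (0 : ℝ) ≤ n := n.cast_nonneg
  have h1 := SpectrumData.lt_odd_of_le hV hκ (n := n) (by nlinarith)
  have h2 := SpectrumData.even_lt hV hκ (n := n) (by nlinarith)
  rw [mul_pow] at h1 h2 ⊢
  have hp : 0 < Real.pi ^ 2 := by positivity
  constructor
  · refine le_trans ?_ h1.le
    rw [div_le_iff₀ two_pos, mul_right_comm]
    gcongr
    nlinarith
  · refine h2.le.trans ?_
    rw [← mul_assoc]
    gcongr
    nlinarith

/-- For `n < 4 ‖q‖` the gap lies above the lower bound of the spectrum, where `‖q‖ ≤ 4 ‖q‖²` because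
of `‖q‖ > 1/4`, and not above the last gap with an index of this kind. -/
lemma eigenvalue_bounds_of_lt (hn : 1 ≤ n) (h : n < 4 * ‖q‖) :
    -(5 * ‖q‖ ^ 2) ≤ eigMinus q n ∧ eigPlus q n ≤ 256 * ‖q‖ ^ 2 := by
  obtain ⟨κ, hκ⟩ := exists_spectrumData_periodicSpectrum q
  have hV := intervalIntegrable_potentialLift q
  have hK := integral_abs_potentialLift_le q
  have hK0 : 0 ≤ ∫ t in (0 : ℝ)..1, |potentialLift q t| :=
    intervalIntegral.integral_nonneg zero_le_one fun t _ => abs_nonneg _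
  have hpi := Real.pi_gt_d2
  have hpi' := Real.pi_lt_d2
  have hn1 : (1 : ℝ) ≤ n := by exact_mod_cast hn
  have hQ : 1 / 4 ≤ ‖q‖ := by linarith
  constructor
  · refine le_trans ?_ (SpectrumData.lower_bound hV hκ (2 * n - 1))
    nlinarith
  · -- `N + 1` is the largest index below `4 ‖q‖`
    obtain ⟨N, hN⟩ : ∃ N, ⌈4 * ‖q‖⌉₊ = N + 2 := by
      have : 1 < ⌈4 * ‖q‖⌉₊ := Nat.lt_ceil.2 (by push_cast; linarith)
      exact ⟨⌈4 * ‖q‖⌉₊ - 2, by omega⟩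
    have h1 : 4 * ‖q‖ ≤ N + 2 := by
      have := Nat.le_ceil (4 * ‖q‖)
      rw [hN] at this
      exact_mod_cast this
    have h2 : (N : ℝ) + 2 < 4 * ‖q‖ + 1 := by
      have := Nat.ceil_lt_add_one (show 0 ≤ 4 * ‖q‖ by positivity)
      rw [hN] at this
      exact_mod_cast this
    have hnN : n ≤ N + 1 := by
      have : n < ⌈4 * ‖q‖⌉₊ := Nat.lt_ceil.2 h
      omega
    have hN0 : (0 : ℝ) ≤ N := N.cast_nonneg
    have h3 := SpectrumData.even_lt hV hκ (n := N) (by nlinarith)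
    have h4 : eigPlus q n ≤ periodicSpectrum q (2 * N + 2) := hκ.monotone (by omega)
    refine h4.trans (h3.le.trans ?_)
    rw [show 256 * ‖q‖ ^ 2 = (16 * ‖q‖) ^ 2 by ring]
    refine pow_le_pow_left₀ (by positivity) ?_ 2
    nlinarith

end EigenvalueBounds

/-! ### Infinite products over the eigenvalues -/

lemma norm_tprod_one_add_le {f : ℕ → ℂ} (hf : Summable fun k => ‖f k‖) :
    ‖∏' k, (1 + f k)‖ ≤ Real.exp (∑' k, ‖f k‖) := by
  have h := (multipliable_one_add_of_summable hf).hasProd.norm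
  refine le_of_tendsto h (Eventually.of_forall fun s => ?_)
  calc ∏ k ∈ s, ‖1 + f k‖ ≤ ∏ k ∈ s, Real.exp ‖f k‖ := by
        refine Finset.prod_le_prod (fun _ _ => norm_nonneg _) fun k _ => ?_
        refine (norm_add_le _ _).trans ?_
        rw [norm_one, add_comm]
        exact Real.add_one_le_exp _
    _ = Real.exp (∑ k ∈ s, ‖f k‖) := (Real.exp_sum _ _).symm
    _ ≤ _ := Real.exp_le_exp.2 (hf.sum_le_tsum s fun _ _ => norm_nonneg _)

lemma tprod_one_add_pos {f : ℕ → ℂ} (hf : Summable fun k => ‖f k‖) (him : ∀ k, (f k).im = 0)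
    (hre : ∀ k, 0 < 1 + (f k).re) :
    (∏' k, (1 + f k)).im = 0 ∧ 0 < (∏' k, (1 + f k)).re := by
  have hreal : ∀ k, 1 + f k = ((1 + (f k).re : ℝ) : ℂ) := fun k =>
    Complex.ext (by simp) (by simp [him k])
  have hne : ∏' k, (1 + f k) ≠ 0 := tprod_one_add_ne_zero_of_summable (fun k => by
    rw [hreal k]; exact_mod_cast (hre k).ne') hf
  have hcl : IsClosed {z : ℂ | z.im = 0 ∧ 0 ≤ z.re} :=
    (isClosed_eq Complex.continuous_im continuous_const).inter
      (isClosed_le continuous_const Complex.continuous_re)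
  obtain ⟨h1, h2⟩ := hcl.mem_of_tendsto (multipliable_one_add_of_summable hf).hasProd
    (Eventually.of_forall fun s => by
      simp only [hreal, ← Complex.ofReal_prod]
      exact ⟨Complex.ofReal_im _, by
        rw [Complex.ofReal_re]; exact Finset.prod_nonneg fun k _ => (hre k).le⟩)
  exact ⟨h1, lt_of_le_of_ne h2 fun h => hne (Complex.ext h.symm h1)⟩

lemma differentiableOn_tprod_one_add {f : ℕ → ℂ → ℂ} {U : Set ℂ} (hU : IsOpen U) {u : ℕ → ℝ}
    (hu : Summable u) (hd : ∀ k, DifferentiableOn ℂ (f k) U) (hb : ∀ k, ∀ z ∈ U, ‖f k z‖ ≤ u k) :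
    DifferentiableOn ℂ (fun z => ∏' k, (1 + f k z)) U := by
  have h := hu.hasProdLocallyUniformlyOn_nat_one_add hU (Eventually.of_forall hb)
    (fun k => (hd k).continuousOn)
  rw [hasProdLocallyUniformlyOn_iff_tendstoLocallyUniformlyOn] at h
  refine h.differentiableOn (Eventually.of_forall fun s => ?_) hU
  exact DifferentiableOn.fun_finsetProd fun k _ => (hd k).const_add 1

lemma summable_sqrt_div_sq : Summable fun k : ℕ => √((k + 1 : ℕ) : ℝ) / ((k + 1 : ℕ) : ℝ) ^ 2 := by
  have h := (summable_nat_add_iff 1).2 (Real.summable_one_div_nat_rpow.2 (by norm_num : (1 : ℝ) < 3 / 2))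
  refine h.congr fun k => ?_
  have h0 : (0 : ℝ) < ((k + 1 : ℕ) : ℝ) := by positivity
  rw [div_eq_div_iff (by positivity) (by positivity), one_mul, Real.sqrt_eq_rpow,
    ← Real.rpow_add h0, ← Real.rpow_natCast]
  norm_num

/-- The product `∏ (a_k - z) / (k² π²)` over a sequence of zeros, with `k` starting at one. -/
noncomputable def zeroProduct (a : ℕ → ℝ) (z : ℂ) : ℂ :=
  ∏' k : ℕ, ((a k : ℂ) - z) / (((k + 1 : ℕ) : ℂ) * Real.pi) ^ 2

section ZeroProduct

lemma zeroProduct_term_eq (a : ℕ → ℝ) (k : ℕ) (z : ℂ) : ((a k : ℂ) - z) / (((k + 1 : ℕ) : ℂ) * Real.pi) ^ 2 =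
    1 + (((a k - ((k + 1 : ℕ) * Real.pi) ^ 2 : ℝ) : ℂ) - z) / (((k + 1 : ℕ) : ℂ) * Real.pi) ^ 2 := by
  have h1 : ((k + 1 : ℕ) : ℂ) ≠ 0 := by exact_mod_cast k.succ_ne_zero
  have h2 : (Real.pi : ℂ) ≠ 0 := by exact_mod_cast Real.pi_ne_zero
  have h3 : (((k + 1 : ℕ) : ℂ) * Real.pi) ^ 2 ≠ 0 := pow_ne_zero 2 (mul_ne_zero h1 h2)
  rw [eq_comm, ← div_self h3, ← add_div]
  congr 1
  push_cast
  ring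

variable {a : ℕ → ℝ} {C : ℝ}
  (ha : ∀ k : ℕ, |a k - ((k + 1 : ℕ) * Real.pi) ^ 2| ≤ C * √((k + 1 : ℕ) : ℝ))
include ha

lemma norm_term_sub_one_le {R : ℝ} {z : ℂ} (hz : ‖z‖ ≤ R) (k : ℕ) :
    ‖(((a k - ((k + 1 : ℕ) * Real.pi) ^ 2 : ℝ) : ℂ) - z) / (((k + 1 : ℕ) : ℂ) * Real.pi) ^ 2‖ ≤
      (C + R) * (√((k + 1 : ℕ) : ℝ) / ((k + 1 : ℕ) : ℝ) ^ 2) := by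
  have hR : 0 ≤ R := (norm_nonneg z).trans hz
  have h0 : (1 : ℝ) ≤ ((k + 1 : ℕ) : ℝ) := by exact_mod_cast Nat.le_add_left 1 k
  have h1 : 1 ≤ √((k + 1 : ℕ) : ℝ) := Real.one_le_sqrt.2 h0
  have hpi := Real.pi_gt_three
  rw [norm_div, norm_pow, norm_mul, Complex.norm_natCast, Complex.norm_real, Real.norm_eq_abs,
    abs_of_pos Real.pi_pos, ← mul_div_assoc]
  have hnum : ‖((a k - ((k + 1 : ℕ) * Real.pi) ^ 2 : ℝ) : ℂ) - z‖ ≤ (C + R) * √((k + 1 : ℕ) : ℝ) := by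
    refine (norm_sub_le _ _).trans ?_
    rw [Complex.norm_real, Real.norm_eq_abs]
    nlinarith [ha k]
  refine div_le_div₀ ((norm_nonneg _).trans hnum) hnum (by positivity) ?_
  rw [mul_pow]
  exact le_mul_of_one_le_right (sq_nonneg _) (by nlinarith)

lemma summable_term_sub_one (z : ℂ) : Summable fun k : ℕ =>
    ‖(((a k - ((k + 1 : ℕ) * Real.pi) ^ 2 : ℝ) : ℂ) - z) / (((k + 1 : ℕ) : ℂ) * Real.pi) ^ 2‖ :=
  Summable.of_nonneg_of_le (fun _ => norm_nonneg _) (norm_term_sub_one_le ha le_rfl)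
    (summable_sqrt_div_sq.mul_left _)

lemma multipliable_zeroProduct (z : ℂ) :
    Multipliable fun k : ℕ => ((a k : ℂ) - z) / (((k + 1 : ℕ) : ℂ) * Real.pi) ^ 2 := by
  simp only [zeroProduct_term_eq]
  exact multipliable_one_add_of_summable (summable_term_sub_one ha z)

lemma differentiable_zeroProduct : Differentiable ℂ (zeroProduct a) := by
  intro z
  have h : DifferentiableOn ℂ (zeroProduct a) (Metric.ball 0 (‖z‖ + 1)) := by
    unfold zeroProduct
    simp only [zeroProduct_term_eq]
    refine differentiableOn_tprod_one_add Metric.isOpen_ball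
      (summable_sqrt_div_sq.mul_left (C + (‖z‖ + 1))) (fun k => ?_) fun k w hw => ?_
    · fun_prop
    · exact norm_term_sub_one_le ha (mem_ball_zero_iff.1 hw).le k
  exact (h z (by simp)).differentiableAt (Metric.isOpen_ball.mem_nhds (by simp))

lemma zeroProduct_ne_zero {z : ℂ} (hz : ∀ k, (a k : ℂ) ≠ z) : zeroProduct a z ≠ 0 := by
  unfold zeroProduct
  simp only [zeroProduct_term_eq]
  refine tprod_one_add_ne_zero_of_summable (fun k => ?_) (summable_term_sub_one ha z)
  rw [← zeroProduct_term_eq]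
  refine div_ne_zero (sub_ne_zero.2 (hz k)) (pow_ne_zero 2 (mul_ne_zero ?_ ?_))
  · exact_mod_cast k.succ_ne_zero
  · exact_mod_cast Real.pi_ne_zero

lemma zeroProduct_pos {x : ℝ} (hx : ∀ k, x < a k) :
    (zeroProduct a x).im = 0 ∧ 0 < (zeroProduct a x).re := by
  unfold zeroProduct
  simp only [zeroProduct_term_eq]
  have hreal : ∀ k : ℕ, (((a k - ((k + 1 : ℕ) * Real.pi) ^ 2 : ℝ) : ℂ) - x) /
      (((k + 1 : ℕ) : ℂ) * Real.pi) ^ 2 =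
      (((a k - ((k + 1 : ℕ) * Real.pi) ^ 2 - x) / ((k + 1 : ℕ) * Real.pi) ^ 2 : ℝ) : ℂ) := by
    intro k; push_cast; rfl
  refine tprod_one_add_pos (summable_term_sub_one ha x) (fun k => ?_) fun k => ?_
  · rw [hreal, Complex.ofReal_im]
  · rw [hreal, Complex.ofReal_re]
    have h3 : (0 : ℝ) < ((k + 1 : ℕ) * Real.pi) ^ 2 := by positivity
    rw [← div_self h3.ne', ← add_div]
    refine div_pos ?_ h3
    linarith [hx k]

/-- The zeros of the product are simple when the sequence has no repetitions. -/
lemma exists_zeroProduct_eq_mul (hinj : Function.Injective a) (j : ℕ) :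
    ∃ G : ℂ → ℂ, Differentiable ℂ G ∧ G (a j) ≠ 0 ∧ ∀ z, zeroProduct a z = (z - a j) * G z := by
  -- the factor with index `j` is replaced by one
  set f : ℕ → ℂ → ℂ := fun k z => if k = j then 0 else
    (((a k - ((k + 1 : ℕ) * Real.pi) ^ 2 : ℝ) : ℂ) - z) / (((k + 1 : ℕ) : ℂ) * Real.pi) ^ 2 with hf
  have hfb : ∀ {R : ℝ} {z : ℂ}, ‖z‖ ≤ R → ∀ k, ‖f k z‖ ≤
      (|C| + R) * (√((k + 1 : ℕ) : ℝ) / ((k + 1 : ℕ) : ℝ) ^ 2) := by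
    intro R z hz k
    have hR : 0 ≤ R := (norm_nonneg z).trans hz
    simp only [hf]
    split_ifs
    · rw [norm_zero]; positivity
    · refine (norm_term_sub_one_le ha hz k).trans ?_
      gcongr
      exact le_abs_self C
  have hsum : ∀ z, Summable fun k => ‖f k z‖ := fun z =>
    Summable.of_nonneg_of_le (fun _ => norm_nonneg _) (hfb le_rfl)
      (summable_sqrt_div_sq.mul_left _)
  have hG : Differentiable ℂ fun z => ∏' k, (1 + f k z) := by
    intro z
    have h : DifferentiableOn ℂ (fun z => ∏' k, (1 + f k z)) (Metric.ball 0 (‖z‖ + 1)) := by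
      refine differentiableOn_tprod_one_add Metric.isOpen_ball
        (summable_sqrt_div_sq.mul_left (|C| + (‖z‖ + 1))) (fun k => ?_) fun k w hw => ?_
      · simp only [hf]
        split_ifs <;> fun_prop
      · exact hfb (mem_ball_zero_iff.1 hw).le k
    exact (h z (by simp)).differentiableAt (Metric.isOpen_ball.mem_nhds (by simp))
  have hc : (((j + 1 : ℕ) : ℂ) * Real.pi) ^ 2 ≠ 0 := by
    refine pow_ne_zero 2 (mul_ne_zero ?_ ?_)
    · exact_mod_cast j.succ_ne_zero
    · exact_mod_cast Real.pi_ne_zero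
  refine ⟨fun z => -((((j + 1 : ℕ) : ℂ) * Real.pi) ^ 2)⁻¹ * ∏' k, (1 + f k z), hG.const_mul _, ?_,
    fun z => ?_⟩
  · refine mul_ne_zero (neg_ne_zero.2 (inv_ne_zero hc)) ?_
    refine tprod_one_add_ne_zero_of_summable (fun k => ?_) (hsum _)
    simp only [hf]
    split_ifs with hk
    · simp
    · rw [← zeroProduct_term_eq]
      refine div_ne_zero (sub_ne_zero.2 ?_) (pow_ne_zero 2 (mul_ne_zero ?_ ?_))
      · exact_mod_cast fun h => hk (hinj h)
      · exact_mod_cast k.succ_ne_zero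
      · exact_mod_cast Real.pi_ne_zero
  · have hupd : (fun k => 1 + f k z) =
        Function.update (fun k : ℕ => ((a k : ℂ) - z) / (((k + 1 : ℕ) : ℂ) * Real.pi) ^ 2) j 1 := by
      funext k
      by_cases hk : k = j
      · subst hk; simp [hf]
      · rw [Function.update_of_ne hk, zeroProduct_term_eq]; simp only [hf, if_neg hk]
    have hmul : Multipliable (Function.update
        (fun k : ℕ => ((a k : ℂ) - z) / (((k + 1 : ℕ) : ℂ) * Real.pi) ^ 2) j 1) := by
      rw [← hupd]; exact multipliable_one_add_of_summable (hsum z)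
    rw [zeroProduct, hmul.tprod_eq_mul_tprod_ite' j]
    have e : ∀ k, (if k = j then 1 else ((a k : ℂ) - z) / (((k + 1 : ℕ) : ℂ) * Real.pi) ^ 2) =
        1 + f k z := by
      intro k
      simp only [hf]
      split_ifs
      · simp
      · rw [zeroProduct_term_eq]
    rw [tprod_congr e, div_eq_mul_inv]
    ring

end ZeroProduct

/-- Euler's product for the sine. -/
lemma zeroProduct_free (ν : ℂ) :
    ν * zeroProduct (fun k => ((k + 1 : ℕ) * Real.pi) ^ 2) (ν ^ 2) = Complex.sin ν := by
  have hpi : (Real.pi : ℂ) ≠ 0 := by exact_mod_cast Real.pi_ne_zero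
  have h1 := Complex.tendsto_euler_sin_prod (ν / Real.pi)
  rw [mul_div_cancel₀ _ hpi] at h1
  have h2 := (multipliable_zeroProduct (a := fun k => ((k + 1 : ℕ) * Real.pi) ^ 2) (C := 0)
    (fun k => by simp) (ν ^ 2)).hasProd.tendsto_prod_nat.const_mul ν
  refine tendsto_nhds_unique h2 (h1.congr fun n => ?_)
  congr 1
  refine Finset.prod_congr rfl fun k _ => ?_
  have h3 : ((k : ℂ) + 1) ≠ 0 := by exact_mod_cast k.succ_ne_zero
  push_cast
  field_simp

/-- On the circles `|z| = ((N + 1/2) π)²` the product over a sequence close to `k² π²` is bounded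
below by the product of the sine. The quotient is a product of factors `1 + w k`, and the points of the
sequence keep so far from the circle that `‖w k‖` is at most `C |k - N + 1/2| ^ (-3/2)`, which has a
sum independent of `N`. -/
theorem exists_norm_free_le {a : ℕ → ℝ} {C : ℝ}
    (ha : ∀ k : ℕ, |a k - ((k + 1 : ℕ) * Real.pi) ^ 2| ≤ C * √((k + 1 : ℕ) : ℝ)) :
    ∃ B > 0, ∃ N₀ : ℕ, ∀ N : ℕ, N₀ ≤ N → ∀ z : ℂ, ‖z‖ = ((N + 1 / 2) * Real.pi) ^ 2 →
      ‖zeroProduct (fun k => ((k + 1 : ℕ) * Real.pi) ^ 2) z‖ ≤ B * ‖zeroProduct a z‖ := by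
  have hC : 0 ≤ C := by
    have := (abs_nonneg _).trans (ha 0)
    simpa using this
  set u : ℤ → ℝ := fun j => 1 / |(j : ℝ) + 1 / 2| ^ (3 / 2 : ℝ) with hu
  have hus : Summable u := (Real.summable_one_div_int_add_rpow _ _).2 (by norm_num)
  have hu0 : ∀ j, 0 ≤ u j := fun j => by simp only [hu]; positivity
  obtain ⟨N₀, hN₀⟩ := exists_nat_ge (C ^ 2)
  refine ⟨Real.exp (C * ∑' j, u j), Real.exp_pos _, N₀, fun N hN z hz => ?_⟩
  have hNC : C ^ 2 ≤ N := hN₀.trans (by exact_mod_cast hN)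
  have hpi := Real.pi_gt_three
  -- the distance of the points to the circle
  have hdist : ∀ k : ℕ, 0 < ‖(a k : ℂ) - z‖ ∧
      C * √((k + 1 : ℕ) : ℝ) / ‖(a k : ℂ) - z‖ ≤ C * u ((k : ℤ) - N) := by
    intro k
    set d := |(((k : ℤ) - N : ℤ) : ℝ) + 1 / 2| with hd
    have hd2 : 1 / 2 ≤ d := by
      rw [hd, le_abs]
      rcases le_or_gt (N : ℤ) k with h | h
      · left
        have : (0 : ℝ) ≤ (((k : ℤ) - N : ℤ) : ℝ) := by exact_mod_cast sub_nonneg.2 h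
        linarith
      · right
        have : (((k : ℤ) - N : ℤ) : ℝ) ≤ -1 := by exact_mod_cast (by omega : (k : ℤ) - N ≤ -1)
        linarith
    set s : ℝ := ((k + 1 : ℕ) : ℝ) + (N + 1 / 2) with hs
    have hN0 : (0 : ℝ) ≤ N := N.cast_nonneg
    have hk0 : (0 : ℝ) < ((k + 1 : ℕ) : ℝ) := by positivity
    have hs0 : 0 < s := by positivity
    have hds : d ≤ s := by
      rw [hd, abs_le, hs]
      push_cast
      constructor <;> linarith [(Nat.cast_nonneg k : (0 : ℝ) ≤ k)]
    have hsqrt : √((k + 1 : ℕ) : ℝ) ^ 2 = ((k + 1 : ℕ) : ℝ) := Real.sq_sqrt hk0.le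
    have h1 : C * √((k + 1 : ℕ) : ℝ) ≤ d * s := by
      have : C * √((k + 1 : ℕ) : ℝ) ≤ s / 2 := by
        nlinarith [sq_nonneg (C - √((k + 1 : ℕ) : ℝ))]
      nlinarith
    have h2 : Real.pi ^ 2 * (d * s) ≤ ‖((((k + 1 : ℕ) * Real.pi) ^ 2 : ℝ) : ℂ) - z‖ := by
      have h3 := abs_norm_sub_norm_le ((((k + 1 : ℕ) * Real.pi) ^ 2 : ℝ) : ℂ) z
      rw [hz, Complex.norm_real, Real.norm_of_nonneg (by positivity)] at h3
      refine le_trans (le_of_eq ?_) h3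
      rw [mul_pow, mul_pow, ← sub_mul, abs_mul, abs_of_pos (by positivity : 0 < Real.pi ^ 2),
        mul_comm, hd, ← abs_of_pos hs0, ← abs_mul]
      congr 2
      rw [hs]; push_cast; ring
    have h3 : d * s ≤ ‖(a k : ℂ) - z‖ := by
      have h4 : ‖((((k + 1 : ℕ) * Real.pi) ^ 2 : ℝ) : ℂ) - z‖ ≤
          ‖(a k : ℂ) - z‖ + ‖((a k - ((k + 1 : ℕ) * Real.pi) ^ 2 : ℝ) : ℂ)‖ := by
        refine (le_of_eq ?_).trans (norm_sub_le _ _)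
        congr 1; push_cast; ring
      rw [Complex.norm_real, Real.norm_eq_abs] at h4
      have h5 : 0 < d * s := by positivity
      have h6 : 2 * (d * s) ≤ Real.pi ^ 2 * (d * s) :=
        mul_le_mul_of_nonneg_right (by nlinarith) h5.le
      linarith [ha k]
    have h5 : 0 < d * s := by positivity
    refine ⟨h5.trans_le h3, ?_⟩
    rw [mul_div_assoc]
    refine mul_le_mul_of_nonneg_left ?_ hC
    refine (div_le_div_of_nonneg_left (Real.sqrt_nonneg _) h5 h3).trans ?_
    simp only [hu]
    rw [← hd, div_le_div_iff₀ h5 (by positivity), one_mul, show (3 / 2 : ℝ) = 1 + 1 / 2 by norm_num,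
      Real.rpow_add (by linarith), Real.rpow_one, ← Real.sqrt_eq_rpow]
    have h6 : √((k + 1 : ℕ) : ℝ) * √d ≤ s := by
      have h7 : √((k + 1 : ℕ) : ℝ) ≤ √s := Real.sqrt_le_sqrt (by rw [hs]; linarith)
      have h8 : √d ≤ √s := Real.sqrt_le_sqrt hds
      calc √((k + 1 : ℕ) : ℝ) * √d ≤ √s * √s := by gcongr
        _ = s := Real.mul_self_sqrt hs0.le
    calc √((k + 1 : ℕ) : ℝ) * (d * √d) = d * (√((k + 1 : ℕ) : ℝ) * √d) := by ring
      _ ≤ d * s := by gcongr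
  set w : ℕ → ℂ := fun k => (((((k + 1 : ℕ) * Real.pi) ^ 2 - a k : ℝ)) : ℂ) / ((a k : ℂ) - z) with hw
  have hwb : ∀ k, ‖w k‖ ≤ C * u ((k : ℤ) - N) := by
    intro k
    refine le_trans ?_ (hdist k).2
    rw [hw, norm_div, Complex.norm_real, Real.norm_eq_abs, abs_sub_comm]
    gcongr
    exact ha k
  have hinj : Function.Injective fun k : ℕ => (k : ℤ) - N := fun i j h => by
    simpa using h
  have hsub : Summable fun k : ℕ => C * u ((k : ℤ) - N) := (hus.comp_injective hinj).mul_left C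
  have hws : Summable fun k => ‖w k‖ := Summable.of_nonneg_of_le (fun _ => norm_nonneg _) hwb hsub
  have hle : ∑' k, ‖w k‖ ≤ C * ∑' j, u j := by
    refine (hws.tsum_le_tsum hwb hsub).trans ?_
    rw [tsum_mul_left]
    exact mul_le_mul_of_nonneg_left (tsum_comp_le_tsum_of_inj hus hu0 hinj) hC
  have hprod : zeroProduct (fun k => ((k + 1 : ℕ) * Real.pi) ^ 2) z =
      (∏' k, (1 + w k)) * zeroProduct a z := by
    rw [zeroProduct, zeroProduct, ← (multipliable_one_add_of_summable hws).tprod_mul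
      (multipliable_zeroProduct ha z)]
    refine tprod_congr fun k => ?_
    have h1 : (a k : ℂ) - z ≠ 0 := norm_pos_iff.1 (hdist k).1
    have h2 : 1 + w k = (((((k + 1 : ℕ) * Real.pi) ^ 2 : ℝ) : ℂ) - z) / ((a k : ℂ) - z) := by
      rw [hw]
      simp only
      rw [eq_div_iff h1, add_mul, one_mul, div_mul_cancel₀ _ h1]
      push_cast; ring
    rw [h2, div_mul_div_comm, mul_comm (_ - z) ((a k : ℂ) - z), mul_div_mul_left _ _ h1]
  rw [hprod, norm_mul]
  gcongr
  exact (norm_tprod_one_add_le hws).trans (Real.exp_le_exp.2 hle)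

/-! ### The product formula for the discriminant -/

/-- On the circles `|ν| = (N + 1/2) π` the sine is as large as the exponential of the imaginary
part: either the hyperbolic sine of the imaginary part is large, or the point is close to the real
axis, where the modulus of the sine is at least `1/2`. -/
lemma exp_abs_im_le_norm_sin {N : ℕ} {ν : ℂ} (hν : ‖ν‖ = (N + 1 / 2) * Real.pi) :
    Real.exp |ν.im| ≤ 6 * ‖Complex.sin ν‖ := by
  have hsin : ‖Complex.sin ν‖ ^ 2 = Real.sin ν.re ^ 2 + Real.sinh ν.im ^ 2 := by
    rw [Complex.sin_eq, ← Complex.ofReal_sin, ← Complex.ofReal_cosh, ← Complex.ofReal_cos,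
      ← Complex.ofReal_sinh, ← Complex.normSq_eq_norm_sq, ← Complex.ofReal_mul, ← Complex.ofReal_mul,
      Complex.normSq_add_mul_I]
    have h1 := Real.cosh_sq ν.im
    have h2 := Real.sin_sq_add_cos_sq ν.re
    linear_combination (Real.sin ν.re ^ 2) * h1 + (Real.sinh ν.im ^ 2) * h2
  refine le_of_sq_le_sq ?_ (by positivity)
  rw [mul_pow, hsin]
  have hpi := Real.pi_gt_three
  rcases le_or_gt 1 |ν.im| with hb | hb
  · have h1 : 2 ≤ Real.exp |ν.im| := by linarith [Real.add_one_le_exp |ν.im|]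
    have h2 : Real.exp |ν.im| ≤ 6 * Real.sinh |ν.im| := by
      rw [Real.sinh_eq]
      have h3 : Real.exp (-|ν.im|) ≤ 1 := Real.exp_le_one_iff.2 (by linarith)
      linarith
    have h3 : Real.sinh |ν.im| ^ 2 = Real.sinh ν.im ^ 2 := by
      rcases abs_choice ν.im with h | h <;> rw [h]
      rw [Real.sinh_neg, neg_sq]
    rw [← h3]
    have h4 := pow_le_pow_left₀ (by linarith) h2 2
    nlinarith [sq_nonneg (Real.sin ν.re)]
  · -- `t` is the distance of `|Re ν|` to the zero `R` of the cosine
    set R := (N + 1 / 2) * Real.pi with hR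
    have hR1 : 3 / 2 ≤ R := by
      have : (0 : ℝ) ≤ N := N.cast_nonneg
      nlinarith
    have hsq : ν.re ^ 2 + ν.im ^ 2 = R ^ 2 := by
      rw [← hν, ← Complex.normSq_eq_norm_sq, Complex.normSq_apply]; ring
    set t := R - |ν.re| with ht
    have hre : |ν.re| ≤ R := hν ▸ Complex.abs_re_le_norm ν
    have him : ν.im ^ 2 < 1 := by rw [← sq_abs]; nlinarith [abs_nonneg ν.im]
    have ht0 : 0 ≤ t := by linarith
    have ht1 : t ≤ 2 / 3 := by
      have : t * (R + |ν.re|) < 1 := by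
        rw [ht, ← sq_abs ν.re] at *
        nlinarith
      nlinarith [abs_nonneg ν.re]
    have hcos : 1 / 2 ≤ Real.cos t := by
      refine le_trans ?_ (Real.one_sub_sq_div_two_le_cos)
      nlinarith
    have hs : Real.sin ν.re ^ 2 = Real.cos t ^ 2 := by
      have h1 : |Real.cos (N * Real.pi - t)| = |Real.cos t| := by
        rw [abs_cos_eq_cos_sub N, show N * Real.pi - t - N * Real.pi = -t by ring, Real.cos_neg]
      have h2 : Real.sin |ν.re| = Real.cos (N * Real.pi - t) := by
        rw [← Real.sin_add_pi_div_two]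
        congr 1
        rw [ht, hR]; ring
      have h3 : Real.sin |ν.re| ^ 2 = Real.sin ν.re ^ 2 := by
        rcases abs_choice ν.re with h | h <;> rw [h]
        rw [Real.sin_neg, neg_sq]
      rw [← h3, h2, ← sq_abs, h1, sq_abs]
    have hexp : Real.exp |ν.im| ≤ 3 := by
      refine (Real.exp_le_exp.2 hb.le).trans ?_
      linarith [Real.exp_one_lt_d9]
    have h4 := pow_le_pow_left₀ (Real.exp_pos _).le hexp 2
    rw [hs]
    nlinarith [sq_nonneg (Real.sinh ν.im)]

/-- A bounded sequence of circles suffices in Liouville's theorem. -/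
lemma apply_eq_apply_of_bounded_circles {f : ℂ → ℂ} (hf : Differentiable ℂ f) {r : ℕ → ℝ}
    (hr : Tendsto r atTop atTop) {M : ℝ} {N₀ : ℕ}
    (hM : ∀ N, N₀ ≤ N → ∀ z, ‖z‖ = r N → ‖f z‖ ≤ M) (z w : ℂ) : f z = f w := by
  refine hf.apply_eq_apply_of_bounded ?_ z w
  refine isBounded_iff_forall_norm_le.2 ⟨M, ?_⟩
  rintro _ ⟨z, rfl⟩
  obtain ⟨N, hN, hN1⟩ := ((hr.eventually_ge_atTop (‖z‖ + 1)).and (eventually_ge_atTop N₀)).exists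
  have hr0 : r N ≠ 0 := by linarith [norm_nonneg z]
  refine Complex.norm_le_of_forall_mem_frontier_norm_le Metric.isBounded_ball
    (hf.diffContOnCl (s := Metric.ball 0 (r N))) (fun x hx => ?_)
    (subset_closure (mem_ball_zero_iff.2 (by linarith)))
  rw [frontier_ball _ hr0, mem_sphere_zero_iff_norm] at hx
  exact hM N hN1 x hx

/-- Local quotients of entire functions glue to an entire quotient. -/
lemma exists_entire_quotient {F E : ℂ → ℂ} (hF : Continuous F) (hE : Continuous E)
    (hloc : ∀ x, ∃ h : ℂ → ℂ, AnalyticAt ℂ h x ∧ ∀ᶠ z in 𝓝[≠] x, E z ≠ 0 ∧ F z = E z * h z) :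
    ∃ f : ℂ → ℂ, Differentiable ℂ f ∧ ∀ z, F z = E z * f z := by
  choose h ha hq using hloc
  have key : ∀ x, (fun y => h y y) =ᶠ[𝓝 x] h x := by
    intro x
    have h1 : ∀ᶠ y in 𝓝[≠] x, ∀ᶠ z in 𝓝 y, E z ≠ 0 ∧ F z = E z * h x z := by
      have h2 := eventually_eventually_nhdsWithin.2 (hq x)
      filter_upwards [h2, self_mem_nhdsWithin] with y hy hyx
      rwa [isOpen_compl_singleton.nhdsWithin_eq hyx] at hy
    have h2 : ∀ᶠ y in 𝓝[≠] x, h y y = h x y := by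
      filter_upwards [h1, nhdsWithin_le_nhds (ha x).eventually_analyticAt] with y hy hay
      have h3 : h y =ᶠ[𝓝[≠] y] h x := by
        filter_upwards [hq y, nhdsWithin_le_nhds hy] with z hz1 hz2
        exact mul_left_cancel₀ hz1.1 (hz1.2.symm.trans hz2.2)
      exact tendsto_nhds_unique ((ha y).continuousAt.tendsto.mono_left nhdsWithin_le_nhds)
        ((hay.continuousAt.tendsto.mono_left nhdsWithin_le_nhds).congr' h3.symm)
    rw [eventually_nhdsWithin_iff] at h2
    filter_upwards [h2] with y hy
    by_cases hyx : y = x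
    · rw [hyx]
    · exact hy hyx
  refine ⟨fun y => h y y, fun x => ((ha x).congr (key x).symm).differentiableAt, fun x => ?_⟩
  have h1 : Tendsto (fun z => E z * h x z) (𝓝[≠] x) (𝓝 (E x * h x x)) :=
    (hE.continuousAt.mul (ha x).continuousAt).tendsto.mono_left nhdsWithin_le_nhds
  exact tendsto_nhds_unique (hF.continuousAt.tendsto.mono_left nhdsWithin_le_nhds)
    (h1.congr' ((hq x).mono fun z hz => hz.2.symm))

lemma exists_eq_sub_mul {F : ℂ → ℂ} (hF : Differentiable ℂ F) {x : ℂ} (hx : F x = 0) :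
    ∃ G : ℂ → ℂ, Differentiable ℂ G ∧ (∀ z, F z = (z - x) * G z) ∧ G x = deriv F x := by
  refine ⟨dslope F x, ?_, fun z => ?_, dslope_same F x⟩
  · rw [← differentiableOn_univ, Complex.differentiableOn_dslope univ_mem]
    exact hF.differentiableOn
  · have := sub_smul_dslope F x z
    rw [hx, sub_zero, smul_eq_mul] at this
    exact this.symm

/-- Near a common zero of order `m` of both functions, and exactly `m` for the denominator, the
quotient is analytic. -/
lemma exists_local_quotient {F E f g : ℂ → ℂ} {x : ℂ} (m : ℕ) (hf : Differentiable ℂ f)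
    (hg : Differentiable ℂ g) (hgx : g x ≠ 0) (hF : ∀ z, F z = (z - x) ^ m * f z)
    (hE : ∀ z, E z = (z - x) ^ m * g z) :
    ∃ h : ℂ → ℂ, AnalyticAt ℂ h x ∧ ∀ᶠ z in 𝓝[≠] x, E z ≠ 0 ∧ F z = E z * h z := by
  refine ⟨fun z => f z / g z, (hf.analyticAt x).div (hg.analyticAt x) hgx, ?_⟩
  filter_upwards [self_mem_nhdsWithin,
    nhdsWithin_le_nhds (hg.continuous.continuousAt.eventually_ne hgx)] with z hz hgz
  refine ⟨?_, ?_⟩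
  · rw [hE]
    exact mul_ne_zero (pow_ne_zero m (sub_ne_zero.2 hz)) hgz
  · rw [hE, hF]
    field_simp

section ProductFormula

variable {V : ℝ → ℝ} (hV : ∀ a b : ℝ, IntervalIntegrable V volume a b)
include hV

lemma deriv_hillDisc_ofReal (x : ℝ) : deriv (hillDisc V) x =
    ((deriv (fun s : ℝ => (hillDisc V s).re) x : ℝ) : ℂ) := by
  have h1 := ((differentiable_hillDisc hV).differentiableAt (x := (x : ℂ))).hasDerivAt.comp_ofReal
  have h2 := (differentiable_hillDisc_re hV x).hasDerivAt.ofReal_comp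
  refine h1.unique (h2.congr_of_eventuallyEq (Eventually.of_forall fun s => ?_))
  exact hillDisc_ofReal_eq hV s

/-- The growth of `Δ² - 4` is the one for the zero potential. -/
lemma exists_norm_hillDisc_sq_le : ∃ M, 0 ≤ M ∧ ∀ ν : ℂ, 1 ≤ ‖ν‖ →
    ‖hillDisc V (ν ^ 2) ^ 2 - 4‖ ≤ M * Real.exp |ν.im| ^ 2 := by
  set K := ∫ t in (0 : ℝ)..1, |V t| with hK
  have hK0 : 0 ≤ K := intervalIntegral.integral_nonneg zero_le_one fun t _ => abs_nonneg _
  refine ⟨(2 + 2 * (K * Real.exp K)) ^ 2 + 4, by positivity, fun ν hν => ?_⟩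
  have h1 := norm_hillDisc_sub_cos_le hV (ν := ν) (by rintro rfl; norm_num at hν)
  rw [← hK] at h1
  have hKν : K / ‖ν‖ ≤ K := div_le_self hK0 hν
  have h2 : ‖hillDisc V (ν ^ 2)‖ ≤ (2 + 2 * (K * Real.exp K)) * Real.exp |ν.im| := by
    have h3 : ‖hillDisc V (ν ^ 2)‖ ≤ ‖hillDisc V (ν ^ 2) - 2 * Complex.cos ν‖ + ‖2 * Complex.cos ν‖ := by
      simpa using norm_add_le (hillDisc V (ν ^ 2) - 2 * Complex.cos ν) (2 * Complex.cos ν)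
    have h4 : ‖2 * Complex.cos ν‖ ≤ 2 * Real.exp |ν.im| := by
      rw [norm_mul, Complex.norm_ofNat]
      gcongr
      exact Complex.norm_cos_le_exp ν
    have h5 : 2 * (K / ‖ν‖ * Real.exp (K / ‖ν‖)) * Real.exp |ν.im| ≤
        2 * (K * Real.exp K) * Real.exp |ν.im| := by gcongr
    linarith
  have h6 : 1 ≤ Real.exp |ν.im| := Real.one_le_exp (abs_nonneg _)
  calc ‖hillDisc V (ν ^ 2) ^ 2 - 4‖ ≤ ‖hillDisc V (ν ^ 2)‖ ^ 2 + 4 := by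
        refine (norm_sub_le _ _).trans ?_
        rw [norm_pow, Complex.norm_ofNat]
    _ ≤ ((2 + 2 * (K * Real.exp K)) * Real.exp |ν.im|) ^ 2 + 4 * Real.exp |ν.im| ^ 2 := by
        gcongr
        nlinarith
    _ = _ := by ring

variable {κ μ : ℕ → ℝ} (h : SpectrumData (fun x : ℝ => (hillDisc V x).re) κ μ)
include h

lemma SpectrumData.hillDisc_sq (k : ℕ) : hillDisc V (μ k) ^ 2 - 4 = 0 :=
  sub_eq_zero.2 ((hillDisc_sq_eq_four_iff hV _).2 (h.abs_eq k))

omit hV in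
lemma SpectrumData.strictMono_odd : StrictMono fun k => μ (2 * k + 1) :=
  strictMono_nat_of_lt_succ fun k => (h.le k).trans_lt (h.lt_odd (k + 1))

omit hV in
lemma SpectrumData.strictMono_even : StrictMono fun k => μ (2 * k + 2) :=
  strictMono_nat_of_lt_succ fun k => (h.lt_odd (k + 1)).trans_le (h.le (k + 1))

omit hV in
lemma SpectrumData.zero_lt_odd (k : ℕ) : μ 0 < μ (2 * k + 1) :=
  (h.monotone (Nat.zero_le (2 * k))).trans_lt (h.lt_odd k)

/-- The function `Δ² - 4` is a multiple of the product over the periodic eigenvalues: the orders of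
the zeros agree, so the quotient is entire, and it is bounded on large circles, where the product is
comparable to `(sin ν)²` with `ν² = z`. -/
theorem SpectrumData.exists_product_formula : ∃ c : ℝ, 0 < c ∧ ∀ z : ℂ, hillDisc V z ^ 2 - 4 =
    -c * ((z - μ 0) * (zeroProduct (fun k => μ (2 * k + 1)) z * zeroProduct (fun k => μ (2 * k + 2)) z)) := by
  obtain ⟨C, hC0, hC⟩ := SpectrumData.exists_asymptotics hV h
  set a : ℕ → ℝ := fun k => μ (2 * k + 1) with ha_def
  set b : ℕ → ℝ := fun k => μ (2 * k + 2) with hb_def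
  have ha : ∀ k : ℕ, |a k - ((k + 1 : ℕ) * Real.pi) ^ 2| ≤ C * √((k + 1 : ℕ) : ℝ) := fun k => (hC k).1
  have hb : ∀ k : ℕ, |b k - ((k + 1 : ℕ) * Real.pi) ^ 2| ≤ C * √((k + 1 : ℕ) : ℝ) := fun k => (hC k).2
  have hab : ∀ k, a k ≤ b k := h.le
  have hba : ∀ j k, j < k → b j < a k := fun j k hjk =>
    (h.lt_odd (j + 1)).trans_le (h.monotone (by omega))
  have haS : StrictMono a := h.strictMono_odd
  have hbS : StrictMono b := h.strictMono_even
  have h0a : ∀ k, μ 0 < a k := h.zero_lt_odd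
  have h0b : ∀ k, μ 0 < b k := fun k => (h0a k).trans_le (hab k)
  set F : ℂ → ℂ := fun z => hillDisc V z ^ 2 - 4 with hF_def
  have hΔ := differentiable_hillDisc hV
  have hF : Differentiable ℂ F := (hΔ.pow 2).sub_const 4
  set E : ℂ → ℂ := fun z => (z - μ 0) * (zeroProduct a z * zeroProduct b z) with hE_def
  have hPa := differentiable_zeroProduct ha
  have hPb := differentiable_zeroProduct hb
  have hE : Differentiable ℂ E := (differentiable_id.sub_const _).mul (hPa.mul hPb)
  have hF0 : ∀ k, F (μ k) = 0 := SpectrumData.hillDisc_sq hV h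
  -- the order of each zero of the product is at most the order of the zero of `Δ² - 4`
  have hloc : ∀ x, ∃ g : ℂ → ℂ, AnalyticAt ℂ g x ∧ ∀ᶠ z in 𝓝[≠] x, E z ≠ 0 ∧ F z = E z * g z := by
    intro x
    by_cases hxa : ∃ j, (a j : ℂ) = x
    · obtain ⟨j, rfl⟩ := hxa
      have hja : (a j : ℂ) - μ 0 ≠ 0 := by
        rw [sub_ne_zero]; exact_mod_cast (h0a j).ne'
      obtain ⟨G, hG, hGj, hGe⟩ := exists_zeroProduct_eq_mul ha haS.injective j
      obtain ⟨F₁, hF₁, hF₁e, hF₁x⟩ := exists_eq_sub_mul hF (hF0 (2 * j + 1))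
      rcases (hab j).eq_or_lt with heq | hlt
      · -- a point of multiplicity two
        obtain ⟨H, hH, hHj, hHe⟩ := exists_zeroProduct_eq_mul hb hbS.injective j
        rw [← heq] at hHj hHe
        have hderiv : deriv F (μ (2 * j + 1)) = 0 := by
          have hd := (hΔ (μ (2 * j + 1))).hasDerivAt
          have h3 : deriv (hillDisc V) (μ (2 * j + 1)) = 0 := by
            rw [deriv_hillDisc_ofReal hV, h.deriv_eq j heq, Complex.ofReal_zero]
          have h4 := ((hd.pow 2).sub_const 4).deriv
          rw [h3, mul_zero] at h4
          exact h4
        obtain ⟨F₂, hF₂, hF₂e, -⟩ := exists_eq_sub_mul hF₁ (hF₁x.trans hderiv)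
        refine exists_local_quotient 2 hF₂ ((differentiable_id.sub_const (μ 0 : ℂ)).mul (hG.mul hH))
          (mul_ne_zero hja (mul_ne_zero hGj hHj)) (fun z => ?_) (fun z => ?_)
        · rw [hF₁e, hF₂e]; ring
        · simp only [hE_def, hGe, hHe, Pi.mul_apply, id]; ring
      · refine exists_local_quotient 1 hF₁ ((differentiable_id.sub_const (μ 0 : ℂ)).mul (hG.mul hPb))
          (mul_ne_zero hja (mul_ne_zero hGj (zeroProduct_ne_zero hb fun k => ?_)))
          (fun z => ?_) (fun z => ?_)
        · refine fun hk => ?_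
          have hk : b k = a j := by exact_mod_cast hk
          rcases lt_trichotomy k j with hkj | rfl | hkj
          · linarith [hba k j hkj]
          · linarith
          · linarith [hbS hkj]
        · rw [hF₁e, pow_one]
        · simp only [hE_def, hGe, Pi.mul_apply, id]; ring
    by_cases hxb : ∃ j, (b j : ℂ) = x
    · obtain ⟨j, rfl⟩ := hxb
      have hjb : (b j : ℂ) - μ 0 ≠ 0 := by
        rw [sub_ne_zero]; exact_mod_cast (h0b j).ne'
      obtain ⟨H, hH, hHj, hHe⟩ := exists_zeroProduct_eq_mul hb hbS.injective j
      obtain ⟨F₁, hF₁, hF₁e, hF₁x⟩ := exists_eq_sub_mul hF (hF0 (2 * j + 2))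
      refine exists_local_quotient 1 hF₁ ((differentiable_id.sub_const (μ 0 : ℂ)).mul (hPa.mul hH))
        (mul_ne_zero hjb (mul_ne_zero (zeroProduct_ne_zero ha fun k hk => hxa ⟨k, hk⟩) hHj))
        (fun z => ?_) (fun z => ?_)
      · rw [hF₁e, pow_one]
      · simp only [hE_def, hHe, Pi.mul_apply, id]; ring
    have hPa0 : zeroProduct a x ≠ 0 := zeroProduct_ne_zero ha fun k hk => hxa ⟨k, hk⟩
    have hPb0 : zeroProduct b x ≠ 0 := zeroProduct_ne_zero hb fun k hk => hxb ⟨k, hk⟩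
    by_cases hx0 : x = μ 0
    · subst hx0
      obtain ⟨F₁, hF₁, hF₁e, hF₁x⟩ := exists_eq_sub_mul hF (hF0 0)
      refine exists_local_quotient 1 hF₁ (hPa.mul hPb) (mul_ne_zero hPa0 hPb0)
        (fun z => ?_) (fun z => ?_)
      · rw [hF₁e, pow_one]
      · simp only [hE_def, Pi.mul_apply, pow_one]
    · exact exists_local_quotient 0 hF hE (mul_ne_zero (sub_ne_zero.2 hx0) (mul_ne_zero hPa0 hPb0))
        (fun z => by simp) (fun z => by simp)
  obtain ⟨f, hf, hfE⟩ := exists_entire_quotient hF.continuous hE.continuous hloc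
  -- the quotient is bounded on large circles, hence constant
  obtain ⟨M, hM0, hM⟩ := exists_norm_hillDisc_sq_le hV
  obtain ⟨B₁, hB₁, N₁, hN₁⟩ := exists_norm_free_le ha
  obtain ⟨B₂, hB₂, N₂, hN₂⟩ := exists_norm_free_le hb
  obtain ⟨N₃, hN₃⟩ := exists_nat_ge (2 * |μ 0|)
  have hr : Tendsto (fun N : ℕ => (((N : ℝ) + 1 / 2) * Real.pi) ^ 2) atTop atTop :=
    (tendsto_pow_atTop two_ne_zero).comp
      ((tendsto_natCast_atTop_atTop.atTop_add tendsto_const_nhds).atTop_mul_const Real.pi_pos)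
  have hconst := apply_eq_apply_of_bounded_circles hf hr (M := 72 * M * B₁ * B₂)
    (N₀ := max (max N₁ N₂) N₃) (fun N hN z hz => ?_)
  swap
  · have hpi := Real.pi_gt_three
    obtain ⟨ν, hν⟩ := IsAlgClosed.exists_pow_nat_eq z two_pos
    have hN0 : (0 : ℝ) ≤ N := N.cast_nonneg
    have hνn : ‖ν‖ = (N + 1 / 2) * Real.pi := by
      rw [← hν, norm_pow] at hz
      exact (pow_left_inj₀ (norm_nonneg _) (by positivity) two_ne_zero).1 hz
    have hsin := exp_abs_im_le_norm_sin hνn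
    have hup := hM ν (by rw [hνn]; nlinarith)
    rw [← zeroProduct_free, hν, norm_mul] at hsin
    rw [hν] at hup
    have hS1 := hN₁ N (by omega) z hz
    have hS2 := hN₂ N (by omega) z hz
    set S := ‖zeroProduct (fun k => ((k + 1 : ℕ) * Real.pi) ^ 2) z‖ with hS
    have hz3 : 2 * |μ 0| ≤ ‖z‖ := by
      have : (N₃ : ℝ) ≤ N := by exact_mod_cast (by omega : N₃ ≤ N)
      have h4 : (N : ℝ) + 1 ≤ (N + 1 / 2) * Real.pi := by nlinarith
      rw [hz]; nlinarith
    have hzμ : ‖z‖ / 2 ≤ ‖z - μ 0‖ := by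
      have := norm_sub_norm_le z (μ 0 : ℂ)
      rw [Complex.norm_real, Real.norm_eq_abs] at this
      linarith
    have hνz : ‖ν‖ ^ 2 = ‖z‖ := by rw [← norm_pow, hν]
    have hνpos : 0 < ‖ν‖ := by rw [hνn]; positivity
    have hS0 : 0 < S := by
      by_contra! hcon
      have h1 : S = 0 := le_antisymm hcon (norm_nonneg _)
      rw [h1, mul_zero, mul_zero] at hsin
      exact absurd hsin (not_le.2 (Real.exp_pos _))
    set p := ‖zeroProduct a z‖ with hp
    set r := ‖zeroProduct b z‖ with hr'
    have hp0 : 0 < p := pos_of_mul_pos_right (hS0.trans_le hS1) hB₁.le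
    have hr0 : 0 < r := pos_of_mul_pos_right (hS0.trans_le hS2) hB₂.le
    have hEn : ‖E z‖ = ‖z - μ 0‖ * (p * r) := by rw [hE_def]; simp only [norm_mul]; rfl
    have h1 : ‖f z‖ * (‖z‖ / 2 * (p * r)) ≤ 72 * M * B₁ * B₂ * (‖z‖ / 2 * (p * r)) := by
      calc ‖f z‖ * (‖z‖ / 2 * (p * r)) ≤ ‖f z‖ * ‖E z‖ := by rw [hEn]; gcongr
        _ = ‖F z‖ := by rw [hfE, norm_mul (E z), mul_comm]
        _ ≤ M * Real.exp |ν.im| ^ 2 := hup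
        _ ≤ M * (6 * (‖ν‖ * S)) ^ 2 := by gcongr
        _ = 36 * M * ‖z‖ * (S * S) := by rw [← hνz]; ring
        _ ≤ 36 * M * ‖z‖ * ((B₁ * p) * (B₂ * r)) := by gcongr
        _ = _ := by ring
    refine le_of_mul_le_mul_right h1 ?_
    rw [← hνz]; positivity
  -- the sign of the constant is read off below the spectrum
  set x : ℝ := μ 0 - 1 with hx
  obtain ⟨ha1, ha2⟩ := zeroProduct_pos ha (x := x) fun k => by linarith [h0a k]
  obtain ⟨hb1, hb2⟩ := zeroProduct_pos hb (x := x) fun k => by linarith [h0b k]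
  have hEx : E x = ((-((zeroProduct a x).re * (zeroProduct b x).re) : ℝ) : ℂ) := by
    have e1 : zeroProduct a x = ((zeroProduct a x).re : ℂ) := Complex.ext rfl (by simp [ha1])
    have e2 : zeroProduct b x = ((zeroProduct b x).re : ℂ) := Complex.ext rfl (by simp [hb1])
    have e3 : (x : ℂ) - μ 0 = -1 := by rw [hx]; push_cast; ring
    simp only [hE_def]
    rw [e3, e1, e2]
    push_cast
    simp
  have hFx : F x = (((hillDisc V x).re ^ 2 - 4 : ℝ) : ℂ) := by
    simp only [hF_def]
    rw [hillDisc_ofReal_eq hV x]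
    push_cast
    simp
  have hD := h.two_lt x (by linarith)
  refine ⟨((hillDisc V x).re ^ 2 - 4) / ((zeroProduct a x).re * (zeroProduct b x).re),
    div_pos (by nlinarith) (mul_pos ha2 hb2), fun z => ?_⟩
  have hfx := hfE x
  rw [hFx, hEx] at hfx
  have hne : (((zeroProduct a x).re * (zeroProduct b x).re : ℝ) : ℂ) ≠ 0 := by
    exact_mod_cast (mul_pos ha2 hb2).ne'
  change F z = _ * E z
  rw [hfE z, hconst z x, mul_comm]
  congr 1
  rw [Complex.ofReal_div, hfx, Complex.ofReal_neg, neg_mul, neg_div, neg_neg,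
    mul_div_cancel_left₀ _ hne]

end ProductFormula

/-! ### The principal root -/

lemma principalRoot_sq (z : ℂ) : principalRoot z ^ 2 = z := by
  have := Complex.cpow_nat_inv_pow z two_ne_zero
  rw [principalRoot, one_div]
  exact_mod_cast this

lemma principalRoot_ofReal {x : ℝ} (hx : 0 ≤ x) : principalRoot x = (√x : ℝ) := by
  rw [principalRoot, Real.sqrt_eq_rpow, Complex.ofReal_cpow hx]
  norm_num

lemma differentiableAt_principalRoot {z : ℂ} (hz : z ∈ Complex.slitPlane) :
    DifferentiableAt ℂ principalRoot z :=
  differentiableAt_id.cpow (differentiableAt_const _) hz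

lemma principalRoot_re_nonneg (z : ℂ) : 0 ≤ (principalRoot z).re := by
  by_cases hz : z = 0
  · rw [hz, principalRoot, Complex.zero_cpow (by norm_num)]; simp
  · rw [principalRoot, Complex.cpow_def_of_ne_zero hz, Complex.exp_re]
    refine mul_nonneg (Real.exp_pos _).le (Real.cos_nonneg_of_mem_Icc ?_)
    have h1 : (Complex.log z * (1 / 2)).im = z.arg / 2 := by
      rw [show Complex.log z * (1 / 2) = Complex.log z / (2 : ℝ) by push_cast; ring,
        Complex.div_ofReal_im, Complex.log_im]
    rw [h1]
    constructor <;> linarith [Complex.neg_pi_lt_arg z, Complex.arg_le_pi z]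

/-- The root `s` of `1 - w` satisfies `(s - 1) (s + 1) = -w` and `|s + 1| ≥ 1`. -/
lemma norm_principalRoot_one_sub_sub_one_le (w : ℂ) : ‖principalRoot (1 - w) - 1‖ ≤ ‖w‖ := by
  set s := principalRoot (1 - w) with hs
  have h1 : (s - 1) * (s + 1) = -w := by
    have := principalRoot_sq (1 - w)
    rw [← hs] at this
    linear_combination this
  have h2 : 1 ≤ ‖s + 1‖ := by
    refine le_trans ?_ (Complex.re_le_norm _)
    rw [Complex.add_re, Complex.one_re]
    linarith [principalRoot_re_nonneg (1 - w)]
  have h3 := congrArg norm h1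
  rw [norm_mul, norm_neg] at h3
  nlinarith [norm_nonneg (s - 1)]

/-! ### The contour integral around a gap -/

lemma norm_mul_cos_le (u : ℂ) (θ : ℝ) : ‖u * (Real.cos θ : ℂ)‖ ≤ ‖u‖ := by
  rw [norm_mul, Complex.norm_real, Real.norm_eq_abs]
  exact mul_le_of_le_one_right (norm_nonneg _) (Real.abs_cos_le_one θ)

lemma one_sub_norm_le (u : ℂ) (θ : ℝ) : 1 - ‖u‖ ≤ ‖1 - u * (Real.cos θ : ℂ)‖ := by
  have := norm_sub_norm_le 1 (u * (Real.cos θ : ℂ))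
  rw [norm_one] at this
  linarith [norm_mul_cos_le u θ]

lemma one_sub_mul_cos_ne_zero {u : ℂ} (hu : ‖u‖ < 1) (θ : ℝ) : 1 - u * (Real.cos θ : ℂ) ≠ 0 := by
  rw [← norm_pos_iff]
  linarith [one_sub_norm_le u θ]

lemma continuous_inv_one_sub_mul_cos {u : ℂ} (hu : ‖u‖ < 1) :
    Continuous fun θ : ℝ => (1 - u * (Real.cos θ : ℂ))⁻¹ := by
  refine Continuous.inv₀ ?_ (one_sub_mul_cos_ne_zero hu)
  exact continuous_const.sub (continuous_const.mul (Complex.continuous_ofReal.comp Real.continuous_cos))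

lemma hasDerivAt_integral_inv {u : ℂ} (hu : ‖u‖ < 1) :
    HasDerivAt (fun v : ℂ => ∫ θ in (0 : ℝ)..Real.pi, (1 - v * (Real.cos θ : ℂ))⁻¹)
      (∫ θ in (0 : ℝ)..Real.pi, (Real.cos θ : ℂ) * ((1 - u * (Real.cos θ : ℂ)) ^ 2)⁻¹) u := by
  obtain ⟨r, hur, hr1⟩ := exists_between hu
  have hs : Metric.ball (0 : ℂ) r ∈ 𝓝 u := Metric.isOpen_ball.mem_nhds (by simpa using hur)
  have hcos : Continuous fun θ : ℝ => (Real.cos θ : ℂ) :=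
    Complex.continuous_ofReal.comp Real.continuous_cos
  have hc2 : Continuous fun θ : ℝ => (Real.cos θ : ℂ) * ((1 - u * (Real.cos θ : ℂ)) ^ 2)⁻¹ := by
    refine hcos.mul (Continuous.inv₀ ?_ fun θ => pow_ne_zero 2 (one_sub_mul_cos_ne_zero hu θ))
    exact (continuous_const.sub (continuous_const.mul hcos)).pow 2
  refine (intervalIntegral.hasDerivAt_integral_of_dominated_loc_of_deriv_le
    (F' := fun v θ => (Real.cos θ : ℂ) * ((1 - v * (Real.cos θ : ℂ)) ^ 2)⁻¹)
    (bound := fun _ => ((1 - r) ^ 2)⁻¹) hs ?_ ?_ ?_ ?_ ?_ ?_).2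
  · filter_upwards [hs] with v hv
    exact (continuous_inv_one_sub_mul_cos ((mem_ball_zero_iff.1 hv).trans hr1)).aestronglyMeasurable
  · exact (continuous_inv_one_sub_mul_cos hu).intervalIntegrable _ _
  · exact hc2.aestronglyMeasurable
  · refine Eventually.of_forall fun θ _ v hv => ?_
    have hv' := mem_ball_zero_iff.1 hv
    rw [norm_mul, norm_inv, norm_pow, Complex.norm_real, Real.norm_eq_abs]
    have h1 := one_sub_norm_le v θ
    calc |Real.cos θ| * (‖1 - v * (Real.cos θ : ℂ)‖ ^ 2)⁻¹ ≤ 1 * ((1 - r) ^ 2)⁻¹ := by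
          have h2 : 0 < 1 - r := by linarith
          have h3 : 1 - r ≤ ‖1 - v * (Real.cos θ : ℂ)‖ := by linarith
          gcongr
          exact Real.abs_cos_le_one θ
      _ = _ := one_mul _
  · exact intervalIntegrable_const
  · refine Eventually.of_forall fun θ _ v hv => ?_
    have hne := one_sub_mul_cos_ne_zero ((mem_ball_zero_iff.1 hv).trans hr1) θ
    have h1 : HasDerivAt (fun v : ℂ => 1 - v * (Real.cos θ : ℂ)) (-(Real.cos θ : ℂ)) v := by
      simpa using ((hasDerivAt_id v).mul_const (Real.cos θ : ℂ)).const_sub 1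
    refine (h1.fun_inv hne).congr_deriv ?_
    rw [neg_neg, div_eq_mul_inv]

/-- The integral of `1 / (1 - u cos θ)` over a half period is `π / √(1 - u²)`. It satisfies the
differential equation `(1 - u²) H' = u H`, so `H² (1 - u²)` is constant. -/
lemma integral_inv_mul_principalRoot {u : ℂ} (hu : ‖u‖ < 1) :
    (∫ θ in (0 : ℝ)..Real.pi, (1 - u * (Real.cos θ : ℂ))⁻¹) * principalRoot (1 - u ^ 2) = Real.pi := by
  set H : ℂ → ℂ := fun v => ∫ θ in (0 : ℝ)..Real.pi, (1 - v * (Real.cos θ : ℂ))⁻¹ with hH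
  set H' : ℂ → ℂ := fun v =>
    ∫ θ in (0 : ℝ)..Real.pi, (Real.cos θ : ℂ) * ((1 - v * (Real.cos θ : ℂ)) ^ 2)⁻¹ with hH'
  have hcos : Continuous fun θ : ℝ => (Real.cos θ : ℂ) :=
    Complex.continuous_ofReal.comp Real.continuous_cos
  -- the difference of the two sides is the integral of the derivative of `sin θ / (1 - v cos θ)`
  have hode : ∀ v : ℂ, ‖v‖ < 1 → (1 - v ^ 2) * H' v = v * H v := by
    intro v hv
    have hne := one_sub_mul_cos_ne_zero hv
    have hc1 := continuous_inv_one_sub_mul_cos hv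
    have hc2 : Continuous fun θ : ℝ => (Real.cos θ : ℂ) * ((1 - v * (Real.cos θ : ℂ)) ^ 2)⁻¹ := by
      refine hcos.mul (Continuous.inv₀ ?_ fun θ => pow_ne_zero 2 (hne θ))
      exact (continuous_const.sub (continuous_const.mul hcos)).pow 2
    have hder : ∀ θ : ℝ, HasDerivAt (fun t : ℝ => (Real.sin t : ℂ) * (1 - v * (Real.cos t : ℂ))⁻¹)
        ((1 - v ^ 2) * ((Real.cos θ : ℂ) * ((1 - v * (Real.cos θ : ℂ)) ^ 2)⁻¹) -
          v * (1 - v * (Real.cos θ : ℂ))⁻¹) θ := by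
      intro θ
      have h1 := (Real.hasDerivAt_sin θ).ofReal_comp
      have h2 := (((Real.hasDerivAt_cos θ).ofReal_comp).const_mul v).const_sub 1
      refine (h1.fun_mul (h2.fun_inv (hne θ))).congr_deriv ?_
      have h4 : (Real.sin θ : ℂ) ^ 2 = 1 - (Real.cos θ : ℂ) ^ 2 := by
        rw [← Complex.ofReal_pow, Real.sin_sq]; push_cast; ring
      have hn := hne θ
      rw [Complex.ofReal_neg]
      generalize (Real.cos θ : ℂ) = c at *
      generalize (Real.sin θ : ℂ) = s at *
      have h5 : (1 - v * c)⁻¹ = (1 - v * c) * ((1 - v * c) ^ 2)⁻¹ := by field_simp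
      rw [h5, div_eq_mul_inv]
      linear_combination (-v * ((1 - v * c) ^ 2)⁻¹) * h4
    have hFTC := intervalIntegral.integral_eq_sub_of_hasDerivAt (a := 0) (b := Real.pi)
      (fun θ _ => hder θ)
      (((continuous_const.mul hc2).sub (continuous_const.mul hc1)).intervalIntegrable _ _)
    have hi1 : IntervalIntegrable (fun θ : ℝ => (1 - v ^ 2) *
        ((Real.cos θ : ℂ) * ((1 - v * (Real.cos θ : ℂ)) ^ 2)⁻¹)) volume 0 Real.pi :=
      (continuous_const.mul hc2).intervalIntegrable _ _
    have hi2 : IntervalIntegrable (fun θ : ℝ => v * (1 - v * (Real.cos θ : ℂ))⁻¹) volume 0 Real.pi :=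
      (continuous_const.mul hc1).intervalIntegrable _ _
    rw [intervalIntegral.integral_sub hi1 hi2, intervalIntegral.integral_const_mul,
      intervalIntegral.integral_const_mul] at hFTC
    simp only [Real.sin_pi, Real.sin_zero, Complex.ofReal_zero, zero_mul, sub_zero] at hFTC
    exact sub_eq_zero.1 hFTC
  have hderiv : ∀ v ∈ Metric.ball (0 : ℂ) 1, HasDerivAt (fun v => H v ^ 2 * (1 - v ^ 2)) 0 v := by
    intro v hv
    have hv' := mem_ball_zero_iff.1 hv
    refine (((hasDerivAt_integral_inv hv').fun_pow 2).fun_mul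
      (((hasDerivAt_id' v).fun_pow 2).const_sub 1)).congr_deriv ?_
    have := hode v hv'
    simp only [hH, hH'] at this
    simp only [pow_one, Nat.cast_ofNat, Nat.add_one_sub_one, mul_one]
    linear_combination (2 * H v) * this
  have hconst : H u ^ 2 * (1 - u ^ 2) = Real.pi ^ 2 := by
    have h0 := Metric.isOpen_ball.is_const_of_deriv_eq_zero (convex_ball (0 : ℂ) 1).isPreconnected
      (fun v hv => (hderiv v hv).differentiableAt.differentiableWithinAt)
      (fun v hv => (hderiv v hv).deriv) (mem_ball_zero_iff.2 hu) (Metric.mem_ball_self one_pos)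
    rw [h0]
    simp [hH]
  set s := principalRoot (1 - u ^ 2) with hs
  have hs2 : s ^ 2 = 1 - u ^ 2 := principalRoot_sq _
  rw [← hs2, ← mul_pow] at hconst
  rcases sq_eq_sq_iff_eq_or_eq_neg.1 hconst with h | h
  · exact h
  · -- the negative sign is excluded as both factors have nonnegative real part
    exfalso
    have hpi : (Real.pi : ℂ) ≠ 0 := by exact_mod_cast Real.pi_ne_zero
    have hsne : s ≠ 0 := by
      intro h0
      rw [h0, mul_zero] at h
      exact hpi (neg_eq_zero.1 h.symm)
    have hHre : 0 < (H u).re := by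
      have hint := (continuous_inv_one_sub_mul_cos hu).intervalIntegrable (μ := volume) 0 Real.pi
      have e : (H u).re = ∫ θ in (0 : ℝ)..Real.pi, ((1 - u * (Real.cos θ : ℂ))⁻¹).re :=
        (Complex.reCLM.intervalIntegral_comp_comm hint).symm
      rw [e]
      refine intervalIntegral.intervalIntegral_pos_of_pos
        ((Complex.continuous_re.comp (continuous_inv_one_sub_mul_cos hu)).intervalIntegrable _ _)
        (fun θ => ?_) Real.pi_pos
      rw [Complex.inv_re]
      refine div_pos ?_ (Complex.normSq_pos.2 (one_sub_mul_cos_ne_zero hu θ))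
      rw [Complex.sub_re, Complex.one_re]
      linarith [Complex.re_le_norm (u * (Real.cos θ : ℂ)), norm_mul_cos_le u θ]
    have h1 : H u = -(Real.pi : ℂ) * s⁻¹ := by
      rw [← h, mul_assoc, mul_inv_cancel₀ hsne, mul_one]
    have h2 : (H u).re = -(Real.pi * (s⁻¹).re) := by
      rw [h1, ← Complex.ofReal_neg, Complex.re_ofReal_mul, neg_mul]
    have h3 : 0 ≤ (s⁻¹).re := by
      rw [Complex.inv_re]
      exact div_nonneg (principalRoot_re_nonneg _) (Complex.normSq_nonneg _)
    nlinarith [Real.pi_pos]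

/-- The contour integral against the standard root of a gap is an integral over the gap. No limit of
contours is needed: the reciprocal of the root is an average of Cauchy kernels with poles in the gap,
and Cauchy's formula applies to each of them. -/
theorem circleIntegral_div_root {g : ℂ → ℂ} {τ γ r : ℝ} (hγ : 0 ≤ γ) (hr : γ / 2 < r)
    (hg : DiffContOnCl ℂ g (Metric.ball (τ : ℂ) r)) :
    (∮ z in C((τ : ℂ), r), g z / (((τ : ℂ) - z) *
      principalRoot (1 - (γ : ℂ) ^ 2 / (4 * ((τ : ℂ) - z) ^ 2)))) =
    -2 * Complex.I * ∫ θ in (0 : ℝ)..Real.pi, g ((τ + γ / 2 * Real.cos θ : ℝ) : ℂ) := by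
  have hr0 : 0 < r := by linarith
  set p : ℝ → ℂ := fun θ => ((τ + γ / 2 * Real.cos θ : ℝ) : ℂ) with hp
  have hpc : Continuous p := by
    refine Complex.continuous_ofReal.comp ?_
    exact continuous_const.add (continuous_const.mul Real.continuous_cos)
  have hpr : ∀ θ, ‖p θ - τ‖ ≤ γ / 2 := by
    intro θ
    have : p θ - τ = ((γ / 2 * Real.cos θ : ℝ) : ℂ) := by simp only [hp]; push_cast; ring
    rw [this, Complex.norm_real, Real.norm_eq_abs, abs_mul, abs_of_nonneg (by linarith : 0 ≤ γ / 2)]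
    exact mul_le_of_le_one_right (by linarith) (Real.abs_cos_le_one θ)
  have hpball : ∀ θ, p θ ∈ Metric.ball (τ : ℂ) r := fun θ => by
    rw [mem_ball_iff_norm]; exact (hpr θ).trans_lt hr
  have hcirc : ∀ t, ‖circleMap (τ : ℂ) r t - τ‖ = r := fun t => by
    rw [circleMap_sub_center, norm_circleMap_zero, abs_of_pos hr0]
  have hne : ∀ t θ, circleMap (τ : ℂ) r t - p θ ≠ 0 := by
    intro t θ h0
    rw [sub_eq_zero] at h0
    have h1 := hcirc t
    rw [h0] at h1
    linarith [hpr θ]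
  have hgc : Continuous fun t => g (circleMap (τ : ℂ) r t) := by
    refine hg.continuousOn_ball.comp_continuous (continuous_circleMap _ _) fun t => ?_
    exact circleMap_mem_closedBall _ hr0.le t
  -- the formula for `∫ 1 / (1 - u cos θ)` at `u = (γ / 2) / (z - τ)`
  have hker : ∀ t, g (circleMap (τ : ℂ) r t) / (((τ : ℂ) - circleMap (τ : ℂ) r t) *
      principalRoot (1 - (γ : ℂ) ^ 2 / (4 * ((τ : ℂ) - circleMap (τ : ℂ) r t) ^ 2))) =
      -(Real.pi : ℂ)⁻¹ * ∫ θ in (0 : ℝ)..Real.pi,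
        (circleMap (τ : ℂ) r t - p θ)⁻¹ * g (circleMap (τ : ℂ) r t) := by
    intro t
    set z := circleMap (τ : ℂ) r t with hz
    have hzn : ‖z - τ‖ = r := hcirc t
    have hz0 : z - τ ≠ 0 := by rw [← norm_pos_iff, hzn]; exact hr0
    have hz0' : (τ : ℂ) - z ≠ 0 := by rw [← neg_sub]; exact neg_ne_zero.2 hz0
    have hu : ‖((γ / 2 : ℝ) : ℂ) / (z - τ)‖ < 1 := by
      rw [norm_div, hzn, Complex.norm_real, Real.norm_of_nonneg (by linarith), div_lt_one hr0]
      exact hr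
    have hint := integral_inv_mul_principalRoot hu
    have hsq : (((γ / 2 : ℝ) : ℂ) / (z - τ)) ^ 2 = (γ : ℂ) ^ 2 / (4 * ((τ : ℂ) - z) ^ 2) := by
      rw [div_pow, ← neg_sub z (τ : ℂ), neg_sq]
      push_cast
      field_simp
      norm_num
    rw [hsq] at hint
    set s := principalRoot (1 - (γ : ℂ) ^ 2 / (4 * ((τ : ℂ) - z) ^ 2)) with hs
    have hpi : (Real.pi : ℂ) ≠ 0 := by exact_mod_cast Real.pi_ne_zero
    have hs0 : s ≠ 0 := by
      intro h0
      rw [h0, mul_zero] at hint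
      exact hpi hint.symm
    have hkern : ∀ θ, (1 - ((γ / 2 : ℝ) : ℂ) / (z - τ) * (Real.cos θ : ℂ))⁻¹ =
        (z - τ) * (z - p θ)⁻¹ := by
      intro θ
      have h1 : z - p θ ≠ 0 := hne t θ
      have h2 : 1 - ((γ / 2 : ℝ) : ℂ) / (z - τ) * (Real.cos θ : ℂ) = (z - p θ) / (z - τ) := by
        simp only [hp]
        field_simp
        push_cast
        ring
      rw [h2, inv_div, div_eq_mul_inv]
    simp only [hkern] at hint
    rw [intervalIntegral.integral_const_mul] at hint
    rw [intervalIntegral.integral_mul_const, div_eq_iff (mul_ne_zero hz0' hs0)]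
    set A := ∫ θ in (0 : ℝ)..Real.pi, (z - p θ)⁻¹ with hA
    field_simp
    linear_combination (-g z) * hint
  have hswap : (∫ t in (0 : ℝ)..2 * Real.pi, ∫ θ in (0 : ℝ)..Real.pi, deriv (circleMap (τ : ℂ) r) t *
      ((circleMap (τ : ℂ) r t - p θ)⁻¹ * g (circleMap (τ : ℂ) r t))) =
      ∫ θ in (0 : ℝ)..Real.pi, ∫ t in (0 : ℝ)..2 * Real.pi, deriv (circleMap (τ : ℂ) r) t *
      ((circleMap (τ : ℂ) r t - p θ)⁻¹ * g (circleMap (τ : ℂ) r t)) := by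
    refine intervalIntegral_intervalIntegral_swap ?_
    have hcm : Continuous (circleMap (τ : ℂ) r) := continuous_circleMap _ _
    have hdc : Continuous fun t => deriv (circleMap (τ : ℂ) r) t := by
      simp only [deriv_circleMap]
      exact (continuous_circleMap 0 r).mul continuous_const
    have hcont : Continuous (Function.uncurry fun t θ => deriv (circleMap (τ : ℂ) r) t *
        ((circleMap (τ : ℂ) r t - p θ)⁻¹ * g (circleMap (τ : ℂ) r t))) := by
      refine (hdc.comp continuous_fst).mul (Continuous.mul (Continuous.inv₀ ?_ ?_)
        (hgc.comp continuous_fst))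
      · exact (hcm.comp continuous_fst).sub (hpc.comp continuous_snd)
      · exact fun x => hne x.1 x.2
    exact (hcont.continuousOn.integrableOn_compact (isCompact_uIcc.prod isCompact_uIcc)).mono_set
      (prod_mono uIoc_subset_uIcc uIoc_subset_uIcc)
  have hcauchy : ∀ θ, (∫ t in (0 : ℝ)..2 * Real.pi, deriv (circleMap (τ : ℂ) r) t *
      ((circleMap (τ : ℂ) r t - p θ)⁻¹ * g (circleMap (τ : ℂ) r t))) =
      2 * Real.pi * Complex.I * g (p θ) := fun θ =>
    hg.circleIntegral_sub_inv_smul (hpball θ)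
  rw [circleIntegral]
  simp only [hker, smul_eq_mul]
  have e : ∀ t, deriv (circleMap (τ : ℂ) r) t * (-(Real.pi : ℂ)⁻¹ * ∫ θ in (0 : ℝ)..Real.pi,
        (circleMap (τ : ℂ) r t - p θ)⁻¹ * g (circleMap (τ : ℂ) r t)) =
      -(Real.pi : ℂ)⁻¹ * ∫ θ in (0 : ℝ)..Real.pi, deriv (circleMap (τ : ℂ) r) t *
        ((circleMap (τ : ℂ) r t - p θ)⁻¹ * g (circleMap (τ : ℂ) r t)) := fun t => by
    rw [intervalIntegral.integral_const_mul]; ring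
  simp only [e]
  rw [intervalIntegral.integral_const_mul, hswap]
  simp only [hcauchy]
  rw [intervalIntegral.integral_const_mul]
  have hpi : (Real.pi : ℂ) ≠ 0 := by exact_mod_cast Real.pi_ne_zero
  generalize (∫ θ in (0 : ℝ)..Real.pi, g (p θ)) = A
  field_simp

/-! ### The canonical root near a gap -/

section CanonicalRoot

variable (q : Potential)

/-- The vertical strip between the neighbours of the gap number `j + 1`. The index is shifted by one,
as in the infinite product for the canonical root. -/
def gapStrip (j : ℕ) : Set ℂ :=
  {z | periodicSpectrum q (2 * j) < z.re ∧ z.re < periodicSpectrum q (2 * j + 3)}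

/-- The amount by which the factor with index `k` of the canonical root differs from one; the factor
with index `j` is replaced by one. -/
noncomputable def rootTerm (j k : ℕ) (z : ℂ) : ℂ :=
  if k = j then 0 else standardRoot q (k + 1) z / (((k + 1 : ℕ) : ℂ) ^ 2 * (Real.pi : ℂ) ^ 2) - 1

/-- The canonical root without the standard root of the gap number `j + 1`; the constant
`(j + 1)² π²` of that factor is retained. -/
noncomputable def reducedRoot (j : ℕ) (z : ℂ) : ℂ :=
  -2 * Complex.I * principalRoot (z - (eigPlus q 0 : ℂ)) *
    ((((j + 1 : ℕ) : ℂ) ^ 2 * (Real.pi : ℂ) ^ 2)⁻¹ * ∏' k : ℕ, (1 + rootTerm q j k z))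

lemma isOpen_gapStrip (j : ℕ) : IsOpen (gapStrip q j) :=
  (isOpen_lt continuous_const Complex.continuous_re).inter
    (isOpen_lt Complex.continuous_re continuous_const)

lemma index_sq_mul_pi_sq_ne_zero (k : ℕ) : ((k + 1 : ℕ) : ℂ) ^ 2 * (Real.pi : ℂ) ^ 2 ≠ 0 := by
  refine mul_ne_zero (pow_ne_zero 2 ?_) (pow_ne_zero 2 ?_)
  · exact_mod_cast k.succ_ne_zero
  · exact_mod_cast Real.pi_ne_zero

lemma gapLength_succ (k : ℕ) : gapLength q (k + 1) =
    periodicSpectrum q (2 * k + 2) - periodicSpectrum q (2 * k + 1) := rfl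

lemma gapMid_succ (k : ℕ) : gapMid q (k + 1) =
    (periodicSpectrum q (2 * k + 1) + periodicSpectrum q (2 * k + 2)) / 2 := rfl

lemma standardRoot_sq {k : ℕ} {z : ℂ} (hz : (gapMid q (k + 1) : ℂ) - z ≠ 0) :
    standardRoot q (k + 1) z ^ 2 =
      ((periodicSpectrum q (2 * k + 1) : ℂ) - z) * ((periodicSpectrum q (2 * k + 2) : ℂ) - z) := by
  rw [standardRoot, mul_pow, principalRoot_sq]
  have : ((gapMid q (k + 1) : ℂ) - z) ^ 2 *
      (1 - (gapLength q (k + 1) : ℂ) ^ 2 / (4 * ((gapMid q (k + 1) : ℂ) - z) ^ 2)) =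
      ((gapMid q (k + 1) : ℂ) - z) ^ 2 - (gapLength q (k + 1) : ℂ) ^ 2 / 4 := by
    field_simp
  rw [this, gapMid_succ, gapLength_succ]
  push_cast
  ring

variable {κ : ℕ → ℝ} (h : SpectrumData (fun x : ℝ => (hillDisc (potentialLift q) x).re) κ
  (periodicSpectrum q))
include h

lemma gapLength_nonneg (k : ℕ) : 0 ≤ gapLength q (k + 1) := sub_nonneg.2 (h.le k)

/-- The strip around one gap keeps its distance from the other gaps. -/
lemma gapLength_lt_of_mem_gapStrip {j k : ℕ} (hkj : k ≠ j) {z : ℂ} (hz : z ∈ gapStrip q j) :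
    gapLength q (k + 1) / 2 < ‖(gapMid q (k + 1) : ℂ) - z‖ := by
  refine lt_of_lt_of_le ?_ (Complex.abs_re_le_norm _)
  rw [Complex.sub_re, Complex.ofReal_re, gapLength_succ, gapMid_succ, lt_abs]
  rcases lt_or_gt_of_ne hkj with hlt | hlt
  · right
    have := h.monotone (show 2 * k + 2 ≤ 2 * j by omega)
    linarith [hz.1]
  · left
    have := h.monotone (show 2 * j + 3 ≤ 2 * k + 1 by omega)
    linarith [hz.2]

lemma gapMid_sub_ne_zero {j k : ℕ} (hkj : k ≠ j) {z : ℂ} (hz : z ∈ gapStrip q j) :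
    (gapMid q (k + 1) : ℂ) - z ≠ 0 := by
  rw [← norm_pos_iff]
  linarith [gapLength_lt_of_mem_gapStrip q h hkj hz, gapLength_nonneg q h k]

lemma norm_gap_quotient_lt {j k : ℕ} (hkj : k ≠ j) {z : ℂ} (hz : z ∈ gapStrip q j) :
    ‖(gapLength q (k + 1) : ℂ) ^ 2 / (4 * ((gapMid q (k + 1) : ℂ) - z) ^ 2)‖ < 1 := by
  have h1 := gapLength_lt_of_mem_gapStrip q h hkj hz
  have h2 := gapLength_nonneg q h k
  rw [norm_div, norm_mul, norm_pow, norm_pow, Complex.norm_real, Real.norm_of_nonneg h2,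
    Complex.norm_ofNat, div_lt_one (by nlinarith)]
  nlinarith

lemma one_sub_gap_quotient_mem_slitPlane {j k : ℕ} (hkj : k ≠ j) {z : ℂ} (hz : z ∈ gapStrip q j) :
    1 - (gapLength q (k + 1) : ℂ) ^ 2 / (4 * ((gapMid q (k + 1) : ℂ) - z) ^ 2) ∈ Complex.slitPlane := by
  refine Or.inl ?_
  rw [Complex.sub_re, Complex.one_re]
  linarith [norm_gap_quotient_lt q h hkj hz, Complex.re_le_norm
    ((gapLength q (k + 1) : ℂ) ^ 2 / (4 * ((gapMid q (k + 1) : ℂ) - z) ^ 2))]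

lemma standardRoot_ne_zero {j k : ℕ} (hkj : k ≠ j) {z : ℂ} (hz : z ∈ gapStrip q j) :
    standardRoot q (k + 1) z ≠ 0 := by
  refine mul_ne_zero (gapMid_sub_ne_zero q h hkj hz) fun h0 => ?_
  have h1 := principalRoot_sq
    (1 - (gapLength q (k + 1) : ℂ) ^ 2 / (4 * ((gapMid q (k + 1) : ℂ) - z) ^ 2))
  rw [h0] at h1
  exact Complex.slitPlane_ne_zero (one_sub_gap_quotient_mem_slitPlane q h hkj hz)
    (by rw [← h1]; norm_num)

lemma differentiableOn_rootTerm (j k : ℕ) : DifferentiableOn ℂ (rootTerm q j k) (gapStrip q j) := by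
  intro z hz
  unfold rootTerm
  split_ifs with hkj
  · exact differentiableWithinAt_const _
  · refine DifferentiableAt.differentiableWithinAt ?_
    unfold standardRoot
    have hne := gapMid_sub_ne_zero q h hkj hz
    have h1 : DifferentiableAt ℂ (fun z : ℂ => (gapMid q (k + 1) : ℂ) - z) z := by fun_prop
    have h2 : DifferentiableAt ℂ (fun z : ℂ => 1 - (gapLength q (k + 1) : ℂ) ^ 2 /
        (4 * ((gapMid q (k + 1) : ℂ) - z) ^ 2)) z := by
      refine (differentiableAt_const _).sub ((differentiableAt_const _).div
        ((differentiableAt_const _).mul (h1.pow 2)) ?_)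
      exact mul_ne_zero (by norm_num) (pow_ne_zero 2 hne)
    have h3 := (differentiableAt_principalRoot
      (one_sub_gap_quotient_mem_slitPlane q h hkj hz)).comp z h2
    exact ((h1.mul h3).div_const _).sub_const 1

/-- The terms decrease like `k ^ (-3/2)`, locally uniformly in `z`. -/
lemma exists_norm_rootTerm_le (j : ℕ) : ∃ C : ℝ, 0 ≤ C ∧ ∀ k, ∀ z ∈ gapStrip q j,
    ‖rootTerm q j k z‖ ≤ (C + ‖z‖) * (√((k + 1 : ℕ) : ℝ) / ((k + 1 : ℕ) : ℝ) ^ 2) := by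
  obtain ⟨C, hC0, hC⟩ := SpectrumData.exists_asymptotics (intervalIntegrable_potentialLift q) h
  refine ⟨2 * C, by positivity, fun k z hz => ?_⟩
  unfold rootTerm
  split_ifs with hkj
  · rw [norm_zero]; positivity
  obtain ⟨h1, h2⟩ := hC k
  set a := periodicSpectrum q (2 * k + 1) with ha
  set b := periodicSpectrum q (2 * k + 2) with hb
  have hτ : |gapMid q (k + 1) - ((k + 1 : ℕ) * Real.pi) ^ 2| ≤ C * √((k + 1 : ℕ) : ℝ) := by
    rw [gapMid_succ, ← ha, ← hb]
    rw [abs_le] at h1 h2 ⊢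
    constructor <;> linarith
  have hγ : gapLength q (k + 1) / 2 ≤ C * √((k + 1 : ℕ) : ℝ) := by
    rw [gapLength_succ, ← ha, ← hb]
    rw [abs_le] at h1 h2
    linarith
  have hγ0 := gapLength_nonneg q h k
  set w := (gapLength q (k + 1) : ℂ) ^ 2 / (4 * ((gapMid q (k + 1) : ℂ) - z) ^ 2) with hw
  set s := principalRoot (1 - w) with hs
  set N := ((k + 1 : ℕ) : ℂ) ^ 2 * (Real.pi : ℂ) ^ 2 with hN
  have hN0 : N ≠ 0 := index_sq_mul_pi_sq_ne_zero k
  have hd := gapLength_lt_of_mem_gapStrip q h hkj hz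
  set d := (gapMid q (k + 1) : ℂ) - z with hd'
  have hdpos : 0 < ‖d‖ := by linarith
  have e : standardRoot q (k + 1) z / N - 1 = ((d - N) + d * (s - 1)) / N := by
    rw [standardRoot, ← hd', ← hw, ← hs]
    field_simp
    ring
  have hs1 : ‖s - 1‖ ≤ ‖w‖ := norm_principalRoot_one_sub_sub_one_le w
  have hdw : ‖d‖ * ‖w‖ ≤ gapLength q (k + 1) / 2 := by
    rw [hw, norm_div, norm_mul, norm_pow, norm_pow, Complex.norm_real, Real.norm_of_nonneg hγ0,
      Complex.norm_ofNat, mul_div_assoc', div_le_iff₀ (by positivity)]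
    nlinarith [mul_nonneg hγ0 hdpos.le]
  have hdN : ‖d - N‖ ≤ C * √((k + 1 : ℕ) : ℝ) + ‖z‖ := by
    have e2 : d - N = ((gapMid q (k + 1) - ((k + 1 : ℕ) * Real.pi) ^ 2 : ℝ) : ℂ) - z := by
      rw [hd', hN]; push_cast; ring
    rw [e2]
    refine (norm_sub_le _ _).trans ?_
    rw [Complex.norm_real, Real.norm_eq_abs]
    linarith [hτ]
  have h0 : (1 : ℝ) ≤ ((k + 1 : ℕ) : ℝ) := by exact_mod_cast Nat.le_add_left 1 k
  have h1' : 1 ≤ √((k + 1 : ℕ) : ℝ) := Real.one_le_sqrt.2 h0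
  have hnum : ‖(d - N) + d * (s - 1)‖ ≤ (2 * C + ‖z‖) * √((k + 1 : ℕ) : ℝ) := by
    refine (norm_add_le _ _).trans ?_
    rw [norm_mul]
    have := mul_le_mul_of_nonneg_left hs1 hdpos.le
    nlinarith [norm_nonneg z]
  have hpi := Real.pi_gt_three
  rw [e, norm_div, ← mul_div_assoc]
  refine div_le_div₀ ((norm_nonneg _).trans hnum) hnum (by positivity) ?_
  rw [hN, norm_mul, norm_pow, norm_pow, Complex.norm_natCast, Complex.norm_real, Real.norm_eq_abs,
    abs_of_pos Real.pi_pos]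
  exact le_mul_of_one_le_right (sq_nonneg _) (by nlinarith)

lemma summable_rootTerm {j : ℕ} {z : ℂ} (hz : z ∈ gapStrip q j) :
    Summable fun k => ‖rootTerm q j k z‖ := by
  obtain ⟨C, -, hC⟩ := exists_norm_rootTerm_le q h j
  exact Summable.of_nonneg_of_le (fun _ => norm_nonneg _) (fun k => hC k z hz)
    (summable_sqrt_div_sq.mul_left _)

lemma one_add_rootTerm_ne_zero {j : ℕ} {z : ℂ} (hz : z ∈ gapStrip q j) (k : ℕ) :
    1 + rootTerm q j k z ≠ 0 := by
  unfold rootTerm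
  split_ifs with hkj
  · simp
  · rw [add_sub_cancel]
    exact div_ne_zero (standardRoot_ne_zero q h hkj hz) (index_sq_mul_pi_sq_ne_zero k)

lemma sub_mem_slitPlane {j : ℕ} {z : ℂ} (hz : z ∈ gapStrip q j) :
    z - (eigPlus q 0 : ℂ) ∈ Complex.slitPlane := by
  refine Or.inl ?_
  rw [Complex.sub_re, Complex.ofReal_re]
  have : eigPlus q 0 ≤ periodicSpectrum q (2 * j) := h.monotone (Nat.zero_le _)
  linarith [hz.1]

lemma differentiableOn_reducedRoot (j : ℕ) : DifferentiableOn ℂ (reducedRoot q j) (gapStrip q j) := by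
  obtain ⟨C, hC0, hC⟩ := exists_norm_rootTerm_le q h j
  have hprod : DifferentiableOn ℂ (fun z => ∏' k, (1 + rootTerm q j k z)) (gapStrip q j) := by
    intro z hz
    have hU : IsOpen (gapStrip q j ∩ Metric.ball 0 (‖z‖ + 1)) :=
      (isOpen_gapStrip q j).inter Metric.isOpen_ball
    have hd := differentiableOn_tprod_one_add hU
      (summable_sqrt_div_sq.mul_left (C + (‖z‖ + 1)))
      (fun k => (differentiableOn_rootTerm q h j k).mono inter_subset_left) (fun k w hw => by
        refine (hC k w hw.1).trans ?_
        gcongr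
        exact (mem_ball_zero_iff.1 hw.2).le)
    have hzU : z ∈ gapStrip q j ∩ Metric.ball 0 (‖z‖ + 1) := ⟨hz, by simp⟩
    exact ((hd z hzU).differentiableAt (hU.mem_nhds hzU)).differentiableWithinAt
  have hroot : DifferentiableOn ℂ (fun z => principalRoot (z - (eigPlus q 0 : ℂ))) (gapStrip q j) := by
    intro z hz
    have h1 : DifferentiableAt ℂ (fun z : ℂ => z - (eigPlus q 0 : ℂ)) z := by fun_prop
    exact ((differentiableAt_principalRoot (sub_mem_slitPlane q h hz)).comp z
      h1).differentiableWithinAt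
  exact (hroot.const_mul _).mul (hprod.const_mul _)

lemma reducedRoot_ne_zero {j : ℕ} {z : ℂ} (hz : z ∈ gapStrip q j) : reducedRoot q j z ≠ 0 := by
  refine mul_ne_zero (mul_ne_zero (mul_ne_zero (by norm_num) Complex.I_ne_zero) fun h0 => ?_)
    (mul_ne_zero (inv_ne_zero (index_sq_mul_pi_sq_ne_zero j))
      (tprod_one_add_ne_zero_of_summable (one_add_rootTerm_ne_zero q h hz)
        (summable_rootTerm q h hz)))
  have h1 := principalRoot_sq (z - (eigPlus q 0 : ℂ))
  rw [h0] at h1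
  exact Complex.slitPlane_ne_zero (sub_mem_slitPlane q h hz) (by rw [← h1]; norm_num)

lemma canonicalRoot_eq_mul {j : ℕ} {z : ℂ} (hz : z ∈ gapStrip q j) :
    canonicalRoot q z = standardRoot q (j + 1) z * reducedRoot q j z := by
  set F : ℕ → ℂ := fun k =>
    standardRoot q (k + 1) z / (((k + 1 : ℕ) : ℂ) ^ 2 * (Real.pi : ℂ) ^ 2) with hF
  have hupd : (fun k => 1 + rootTerm q j k z) = Function.update F j 1 := by
    funext k
    unfold rootTerm
    by_cases hk : k = j
    · subst hk; simp
    · rw [Function.update_of_ne hk, if_neg hk, add_sub_cancel]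
  have hmul : Multipliable (Function.update F j 1) := by
    rw [← hupd]; exact multipliable_one_add_of_summable (summable_rootTerm q h hz)
  have e : ∀ k, (if k = j then 1 else F k) = 1 + rootTerm q j k z := by
    intro k
    unfold rootTerm
    split_ifs
    · simp
    · rw [add_sub_cancel]
  rw [canonicalRoot, reducedRoot, hmul.tprod_eq_mul_tprod_ite' j, tprod_congr e]
  simp only [hF, div_eq_mul_inv]
  ring

/-- The square of the canonical root is a positive multiple of `Δ² - 4`, by the product formula. The
square of the standard root of the gap is written out, so that the identity extends to the gap. -/
lemma exists_hillDisc_sq_sub_four_eq : ∃ c : ℝ, 0 < c ∧ ∀ j, ∀ z ∈ gapStrip q j,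
    hillDisc (potentialLift q) z ^ 2 - 4 = c / 4 * (reducedRoot q j z ^ 2 *
      (((periodicSpectrum q (2 * j + 1) : ℂ) - z) * ((periodicSpectrum q (2 * j + 2) : ℂ) - z))) := by
  have hV := intervalIntegrable_potentialLift q
  obtain ⟨c, hc, hprod⟩ := SpectrumData.exists_product_formula hV h
  obtain ⟨C, -, hC⟩ := SpectrumData.exists_asymptotics hV h
  refine ⟨c, hc, fun j z hz => ?_⟩
  set N : ℕ → ℂ := fun k => ((k + 1 : ℕ) : ℂ) ^ 2 * (Real.pi : ℂ) ^ 2 with hN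
  have hNe : ∀ k, (((k + 1 : ℕ) : ℂ) * Real.pi) ^ 2 = N k := fun k => mul_pow _ _ _
  have hma := multipliable_zeroProduct (a := fun k => periodicSpectrum q (2 * k + 1)) (fun k => (hC k).1) z
  have hmb := multipliable_zeroProduct (a := fun k => periodicSpectrum q (2 * k + 2)) (fun k => (hC k).2) z
  have hms := multipliable_one_add_of_summable (summable_rootTerm q h hz)
  set T : ℕ → ℂ := fun k => ((periodicSpectrum q (2 * k + 1) : ℂ) - z) / N k *
    (((periodicSpectrum q (2 * k + 2) : ℂ) - z) / N k) with hT
  have hzp : zeroProduct (fun k => periodicSpectrum q (2 * k + 1)) z *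
      zeroProduct (fun k => periodicSpectrum q (2 * k + 2)) z = ∏' k, T k := by
    rw [zeroProduct, zeroProduct, ← hma.tprod_mul hmb]
    exact tprod_congr fun k => by rw [hNe]
  have hsq : (fun k => (1 + rootTerm q j k z) * (1 + rootTerm q j k z)) = Function.update T j 1 := by
    funext k
    unfold rootTerm
    by_cases hk : k = j
    · subst hk; simp
    · rw [Function.update_of_ne hk, if_neg hk, add_sub_cancel, div_mul_div_comm, ← sq (standardRoot _ _ _),
        standardRoot_sq q (gapMid_sub_ne_zero q h hk hz), hT]
      simp only
      rw [div_mul_div_comm]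
  have e : ∀ k, (if k = j then 1 else T k) = (1 + rootTerm q j k z) * (1 + rootTerm q j k z) := by
    intro k
    rw [congrFun hsq k]
    by_cases hk : k = j
    · subst hk; simp
    · rw [Function.update_of_ne hk, if_neg hk]
  have hTprod : ∏' k, T k = T j * ((∏' k, (1 + rootTerm q j k z)) * ∏' k, (1 + rootTerm q j k z)) := by
    have hmT : Multipliable (Function.update T j 1) := hsq ▸ hms.mul hms
    rw [hmT.tprod_eq_mul_tprod_ite' j, tprod_congr e, hms.tprod_mul hms]
  rw [hprod z, hzp, hTprod, reducedRoot]
  have hr := principalRoot_sq (z - (eigPlus q 0 : ℂ))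
  have hI := Complex.I_sq
  have h0 : eigPlus q 0 = periodicSpectrum q 0 := rfl
  rw [h0] at hr ⊢
  generalize principalRoot (z - (periodicSpectrum q 0 : ℂ)) = r at *
  generalize ∏' k, (1 + rootTerm q j k z) = p at *
  rw [← hr, hT]
  simp only
  have hNj : N j ≠ 0 := index_sq_mul_pi_sq_ne_zero j
  change _ = (c : ℂ) / 4 * ((-2 * Complex.I * r * ((N j)⁻¹ * p)) ^ 2 * _)
  field_simp
  linear_combination (-4 * (c : ℂ) * r ^ 2 * p ^ 2 * ((periodicSpectrum q (2 * j + 1) : ℂ) - z) *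
    ((periodicSpectrum q (2 * j + 2) : ℂ) - z)) * hI

/-- On the real axis the product of the other standard roots has the sign given by the number of
gaps to the left. -/
lemma tprod_rootTerm_sign {j : ℕ} {x : ℝ} (hx : (x : ℂ) ∈ gapStrip q j) :
    (∏' k, (1 + rootTerm q j k x)).im = 0 ∧ 0 < (-1) ^ j * (∏' k, (1 + rootTerm q j k x)).re := by
  have hreal : ∀ k, k ≠ j → ∃ s : ℝ, 0 < s ∧
      1 + rootTerm q j k x = (((gapMid q (k + 1) - x) * s : ℝ) : ℂ) := by
    intro k hk
    have hlt := norm_gap_quotient_lt q h hk hx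
    have e : (gapLength q (k + 1) : ℂ) ^ 2 / (4 * ((gapMid q (k + 1) : ℂ) - x) ^ 2) =
        ((gapLength q (k + 1) ^ 2 / (4 * (gapMid q (k + 1) - x) ^ 2) : ℝ) : ℂ) := by
      push_cast; rfl
    rw [e, Complex.norm_real, Real.norm_eq_abs] at hlt
    have hpos : 0 < 1 - gapLength q (k + 1) ^ 2 / (4 * (gapMid q (k + 1) - x) ^ 2) := by
      linarith [le_abs_self (gapLength q (k + 1) ^ 2 / (4 * (gapMid q (k + 1) - x) ^ 2))]
    have e2 : (1 : ℂ) - ((gapLength q (k + 1) ^ 2 / (4 * (gapMid q (k + 1) - x) ^ 2) : ℝ) : ℂ) =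
        ((1 - gapLength q (k + 1) ^ 2 / (4 * (gapMid q (k + 1) - x) ^ 2) : ℝ) : ℂ) := by
      rw [Complex.ofReal_sub, Complex.ofReal_one]
    refine ⟨√(1 - gapLength q (k + 1) ^ 2 / (4 * (gapMid q (k + 1) - x) ^ 2)) /
      (((k + 1 : ℕ) : ℝ) ^ 2 * Real.pi ^ 2), by positivity, ?_⟩
    unfold rootTerm
    rw [if_neg hk, add_sub_cancel, standardRoot, e, e2,
      principalRoot_ofReal hpos.le]
    push_cast
    ring
  have hleft : ∀ k < j, gapMid q (k + 1) - x < 0 := by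
    intro k hk
    have h1 := h.monotone (show 2 * k + 2 ≤ 2 * j by omega)
    have h2 := h.le k
    have h3 : periodicSpectrum q (2 * j) < x := by simpa using hx.1
    rw [gapMid_succ]
    linarith
  have hright : ∀ k, j < k → 0 < gapMid q (k + 1) - x := by
    intro k hk
    have h1 := h.monotone (show 2 * j + 3 ≤ 2 * k + 1 by omega)
    have h2 := h.le k
    have h3 : x < periodicSpectrum q (2 * j + 3) := by simpa using hx.2
    rw [gapMid_succ]
    linarith
  -- the signs of the factors to the left of the strip
  set ε : ℕ → ℂ := fun k => if k < j then -1 else 1 with hε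
  have hεprod : HasProd ε ((-1) ^ j) := by
    have : HasProd ε (∏ k ∈ Finset.range j, ε k) := hasProd_prod_of_ne_finset_one fun k hk => by
      simp only [hε]; rw [if_neg (by simpa using hk)]
    rwa [Finset.prod_congr rfl (fun k hk => by
      simp only [hε]; rw [if_pos (by simpa using hk)]), Finset.prod_const, Finset.card_range] at this
  have hsum := summable_rootTerm q h hx
  have hpos : ∀ k, ∃ t : ℝ, 0 < t ∧ ε k * (1 + rootTerm q j k x) = t := by
    intro k
    rcases lt_trichotomy k j with hk | rfl | hk
    · obtain ⟨s, hs, he⟩ := hreal k hk.ne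
      refine ⟨-((gapMid q (k + 1) - x) * s), by nlinarith [hleft k hk], ?_⟩
      rw [he]
      simp only [hε]
      rw [if_pos hk]
      push_cast; ring
    · refine ⟨1, one_pos, ?_⟩
      simp [hε, rootTerm]
    · obtain ⟨s, hs, he⟩ := hreal k hk.ne'
      refine ⟨(gapMid q (k + 1) - x) * s, mul_pos (hright k hk) hs, ?_⟩
      rw [he]
      simp only [hε]
      rw [if_neg (by omega), one_mul]
  choose t ht hte using hpos
  -- the factors to the right of the strip are unchanged, so the product still converges
  have hterm : ∀ k, 1 + ((t k : ℂ) - 1) = ε k * (1 + rootTerm q j k x) := fun k => by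
    rw [hte k]; ring
  have hsum2 : Summable fun k => ‖(t k : ℂ) - 1‖ := by
    refine (summable_nat_add_iff j).1 (((summable_nat_add_iff j).2 hsum).congr fun k => ?_)
    congr 1
    have := hterm (k + j)
    simp only [hε] at this
    rw [if_neg (by omega), one_mul] at this
    linear_combination -this
  have hp := tprod_one_add_pos hsum2 (fun k => by simp) (fun k => by simpa using ht k)
  have hmul : ∏' k, (1 + ((t k : ℂ) - 1)) = (-1) ^ j * ∏' k, (1 + rootTerm q j k x) := by
    rw [tprod_congr hterm, hεprod.multipliable.tprod_mul (multipliable_one_add_of_summable hsum),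
      hεprod.tprod_eq]
  rw [hmul] at hp
  have hcast : ((-1 : ℂ) ^ j) = (((-1 : ℝ) ^ j : ℝ) : ℂ) := by push_cast; rfl
  rw [hcast, Complex.im_ofReal_mul, Complex.re_ofReal_mul] at hp
  exact ⟨(mul_eq_zero.1 hp.1).resolve_left (pow_ne_zero j (by norm_num)), hp.2⟩

/-- On the real axis the reduced root is purely imaginary, with the sign of `-(-1) ^ j`. -/
lemma reducedRoot_ofReal {j : ℕ} {x : ℝ} (hx : (x : ℂ) ∈ gapStrip q j) :
    ∃ P : ℝ, 0 < P ∧ reducedRoot q j x = -2 * Complex.I * ((-1) ^ j * P) := by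
  obtain ⟨h1, h2⟩ := tprod_rootTerm_sign q h hx
  set p := ∏' k, (1 + rootTerm q j k x) with hp
  have hx0 : 0 < x - eigPlus q 0 := by
    have h3 : eigPlus q 0 ≤ periodicSpectrum q (2 * j) := h.monotone (Nat.zero_le _)
    have h4 : periodicSpectrum q (2 * j) < x := by simpa using hx.1
    linarith
  have hpe : p = (-1) ^ j * (((-1) ^ j * p.re : ℝ) : ℂ) := by
    have : ((-1 : ℂ) ^ j) * (-1) ^ j = 1 := by rw [← mul_pow]; norm_num
    rw [Complex.ofReal_mul, ← mul_assoc]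
    push_cast
    rw [this, one_mul]
    exact Complex.ext rfl (by simp [h1])
  refine ⟨√(x - eigPlus q 0) * ((((j + 1 : ℕ) : ℝ) ^ 2 * Real.pi ^ 2)⁻¹ * ((-1) ^ j * p.re)),
    by positivity, ?_⟩
  rw [reducedRoot, ← Complex.ofReal_sub, principalRoot_ofReal hx0.le, ← hp]
  nth_rewrite 1 [hpe]
  push_cast
  ring

end CanonicalRoot

/-! ### Actions as weighted integrals over a gap -/

section GapIntegral

/-- Integration by parts over an interval `[τ - L, τ + L]`, parametrized by `τ + L cos θ`: if
`u ^ 2 - 4` vanishes at the end points and equals `c P ^ 2` times the product of the distances to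
them, then `u' / P` integrates by parts to the function `arcosh (u / 2)`, which vanishes at the
end points and has no sign change. -/
lemma integral_pow_mul_deriv_div {τ L c : ℝ} (hL : 0 ≤ L) (hc : 0 < c) {u u' P : ℝ → ℝ}
    (hu : ∀ x ∈ Icc (τ - L) (τ + L), HasDerivAt u (u' x) x)
    (hu' : ContinuousOn u' (Icc (τ - L) (τ + L))) (hP : ContinuousOn P (Icc (τ - L) (τ + L)))
    (hP0 : ∀ x ∈ Icc (τ - L) (τ + L), 0 < P x) (h2 : ∀ x ∈ Icc (τ - L) (τ + L), 2 ≤ u x)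
    (hsq : ∀ x ∈ Icc (τ - L) (τ + L), u x ^ 2 - 4 = c * (P x ^ 2 * ((x - (τ - L)) * (τ + L - x))))
    (h0 : L = 0 → u' τ = 0) (m : ℕ) :
    ∫ θ in (0 : ℝ)..Real.pi, (τ + L * Real.cos θ) ^ (m + 1) * u' (τ + L * Real.cos θ) /
      P (τ + L * Real.cos θ) =
    -(√c * (m + 1)) * ∫ θ in (0 : ℝ)..Real.pi, (τ + L * Real.cos θ) ^ m *
      (L * Real.sin θ * Real.arcosh (u (τ + L * Real.cos θ) / 2)) := by
  have hX : ∀ θ : ℝ, τ + L * Real.cos θ ∈ Icc (τ - L) (τ + L) := fun θ =>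
    ⟨by nlinarith [Real.neg_one_le_cos θ], by nlinarith [Real.cos_le_one θ]⟩
  rcases hL.eq_or_lt with rfl | hLpos
  · -- on a single point both integrands vanish
    simp [h0 rfl]
  have hsc : √c ≠ 0 := (Real.sqrt_pos.2 hc).ne'
  have hXc : Continuous fun θ : ℝ => τ + L * Real.cos θ := by fun_prop
  have hXd : ∀ θ : ℝ, HasDerivAt (fun θ : ℝ => τ + L * Real.cos θ) (-(L * Real.sin θ)) θ := fun θ =>
    (((Real.hasDerivAt_cos θ).const_mul L).const_add τ).congr_deriv (by ring)
  have hsqθ : ∀ θ : ℝ, (u (τ + L * Real.cos θ) / 2) ^ 2 - 1 =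
      (√c * P (τ + L * Real.cos θ) * (L * Real.sin θ) / 2) ^ 2 := by
    intro θ
    have e1 := hsq _ (hX θ)
    have e2 := Real.sq_sqrt hc.le
    have e3 := Real.sin_sq_add_cos_sq θ
    linear_combination e1 / 4 - P (τ + L * Real.cos θ) ^ 2 * L ^ 2 * Real.sin θ ^ 2 / 4 * e2 -
      c * P (τ + L * Real.cos θ) ^ 2 * L ^ 2 / 4 * e3
  have hcont : Continuous fun θ : ℝ => u (τ + L * Real.cos θ) := continuous_iff_continuousAt.2
    fun θ => (hu _ (hX θ)).continuousAt.comp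
      (f := fun θ : ℝ => τ + L * Real.cos θ) hXc.continuousAt
  have hcont' : Continuous fun θ : ℝ => u' (τ + L * Real.cos θ) := hu'.comp_continuous hXc hX
  have hcontP : Continuous fun θ : ℝ => P (τ + L * Real.cos θ) := hP.comp_continuous hXc hX
  have hw : Continuous fun θ : ℝ => Real.arcosh (u (τ + L * Real.cos θ) / 2) :=
    Real.continuousOn_arcosh.comp_continuous (hcont.div_const 2) fun θ => by
      have := h2 _ (hX θ)
      rw [mem_Ici]; linarith
  have hwd : ∀ θ ∈ Ioo (0 : ℝ) Real.pi,
      HasDerivAt (fun θ : ℝ => Real.arcosh (u (τ + L * Real.cos θ) / 2))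
        (-(√c)⁻¹ * (u' (τ + L * Real.cos θ) / P (τ + L * Real.cos θ))) θ := by
    intro θ hθ
    have hs := Real.sin_pos_of_mem_Ioo hθ
    have hp := hP0 _ (hX θ)
    have hlt : 1 < u (τ + L * Real.cos θ) / 2 := by
      have e1 := hsqθ θ
      have e2 : 0 < (√c * P (τ + L * Real.cos θ) * (L * Real.sin θ) / 2) ^ 2 := by positivity
      have := h2 _ (hX θ)
      nlinarith
    have hd := (Real.hasDerivAt_arcosh hlt).comp θ
      (((hu _ (hX θ)).comp θ (hXd θ)).div_const 2)
    refine hd.congr_deriv ?_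
    rw [hsqθ θ, Real.sqrt_sq (by positivity)]
    field_simp
  -- at the end points of the interval `u = 2`
  have hwend : ∀ θ : ℝ, Real.sin θ = 0 → Real.arcosh (u (τ + L * Real.cos θ) / 2) = 0 := by
    intro θ hθ
    have e1 := hsqθ θ
    rw [hθ] at e1
    have e2 := h2 _ (hX θ)
    have : u (τ + L * Real.cos θ) / 2 = 1 := by nlinarith
    rw [this, Real.arcosh_zero]
  have hparts := intervalIntegral.integral_mul_deriv_eq_deriv_mul_of_hasDerivAt
    (a := 0) (b := Real.pi) (u := fun θ : ℝ => (τ + L * Real.cos θ) ^ (m + 1))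
    (v := fun θ : ℝ => Real.arcosh (u (τ + L * Real.cos θ) / 2))
    (u' := fun θ : ℝ => (m + 1) * (τ + L * Real.cos θ) ^ m * (-(L * Real.sin θ)))
    (v' := fun θ : ℝ => -(√c)⁻¹ * (u' (τ + L * Real.cos θ) / P (τ + L * Real.cos θ)))
    (hXc.pow _).continuousOn hw.continuousOn
    (fun θ _ => ((hXd θ).fun_pow (m + 1)).congr_deriv (by push_cast; ring))
    (fun θ hθ => hwd θ (by rwa [min_eq_left Real.pi_pos.le, max_eq_right Real.pi_pos.le] at hθ))
    (Continuous.intervalIntegrable (by fun_prop) _ _)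
    (Continuous.intervalIntegrable (continuous_const.mul (hcont'.div hcontP fun θ =>
      (hP0 _ (hX θ)).ne')) _ _)
  simp only [hwend Real.pi Real.sin_pi, hwend 0 Real.sin_zero, mul_zero, sub_zero, zero_sub] at hparts
  have e1 : ∀ θ : ℝ, (τ + L * Real.cos θ) ^ (m + 1) * u' (τ + L * Real.cos θ) /
      P (τ + L * Real.cos θ) = -√c * ((τ + L * Real.cos θ) ^ (m + 1) *
        (-(√c)⁻¹ * (u' (τ + L * Real.cos θ) / P (τ + L * Real.cos θ)))) := fun θ => by
    field_simp
  have e2 : ∀ θ : ℝ, (m + 1) * (τ + L * Real.cos θ) ^ m * (-(L * Real.sin θ)) *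
      Real.arcosh (u (τ + L * Real.cos θ) / 2) = -(m + 1) * ((τ + L * Real.cos θ) ^ m *
      (L * Real.sin θ * Real.arcosh (u (τ + L * Real.cos θ) / 2))) := fun θ => by ring
  simp only [e2] at hparts
  simp only [e1]
  rw [intervalIntegral.integral_const_mul, hparts, intervalIntegral.integral_const_mul]
  ring

variable (q : Potential)

variable {κ : ℕ → ℝ} (h : SpectrumData (fun x : ℝ => (hillDisc (potentialLift q) x).re) κ
  (periodicSpectrum q))
include h

lemma ofReal_mem_gapStrip {j : ℕ} {x : ℝ}
    (hx : x ∈ Icc (periodicSpectrum q (2 * j + 1)) (periodicSpectrum q (2 * j + 2))) :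
    (x : ℂ) ∈ gapStrip q j := by
  have h1 := h.lt_odd j
  have h2 := h.lt_odd (j + 1)
  refine ⟨?_, ?_⟩ <;> rw [Complex.ofReal_re]
  · exact h1.trans_le hx.1
  · exact hx.2.trans_lt h2

/-- The circuit around a gap stays away from the neighbouring gaps. -/
lemma closedBall_subset_gapStrip (j : ℕ) :
    Metric.closedBall (gapMid q (j + 1) : ℂ) (circuitRadius q (j + 1)) ⊆ gapStrip q j := by
  intro z hz
  have h1 : periodicSpectrum q (2 * j) < periodicSpectrum q (2 * j + 1) := h.lt_odd j
  have h2 : periodicSpectrum q (2 * j + 2) < periodicSpectrum q (2 * j + 3) := h.lt_odd (j + 1)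
  have h3 : |z.re - gapMid q (j + 1)| ≤ circuitRadius q (j + 1) := by
    refine le_trans ?_ (mem_closedBall_iff_norm.1 hz)
    simpa using Complex.abs_re_le_norm (z - gapMid q (j + 1))
  rw [gapMid_succ, circuitRadius, gapLength_succ] at h3
  change |_| ≤ _ + min (periodicSpectrum q (2 * j + 1) - periodicSpectrum q (2 * j))
    (periodicSpectrum q (2 * j + 3) - periodicSpectrum q (2 * j + 2)) / 2 at h3
  have h4 := min_le_left (periodicSpectrum q (2 * j + 1) - periodicSpectrum q (2 * j))
    (periodicSpectrum q (2 * j + 3) - periodicSpectrum q (2 * j + 2))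
  have h5 := min_le_right (periodicSpectrum q (2 * j + 1) - periodicSpectrum q (2 * j))
    (periodicSpectrum q (2 * j + 3) - periodicSpectrum q (2 * j + 2))
  rw [abs_le] at h3
  exact ⟨by linarith [h3.1], by linarith [h3.2]⟩

lemma half_gapLength_lt_circuitRadius (j : ℕ) :
    gapLength q (j + 1) / 2 < circuitRadius q (j + 1) := by
  have h1 : periodicSpectrum q (2 * j) < periodicSpectrum q (2 * j + 1) := h.lt_odd j
  have h2 : periodicSpectrum q (2 * j + 2) < periodicSpectrum q (2 * j + 3) := h.lt_odd (j + 1)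
  have : 0 < min (eigMinus q (j + 1) - eigPlus q (j + 1 - 1))
      (eigMinus q (j + 1 + 1) - eigPlus q (j + 1)) :=
    lt_min (sub_pos.2 h1) (sub_pos.2 h2)
  rw [circuitRadius]
  linarith

/-- On the gap number `j + 1` the discriminant has the sign `(-1) ^ (j + 1)` and modulus at least
two. -/
lemma two_le_neg_one_pow_mul_hillDisc {j : ℕ} {x : ℝ}
    (hx : x ∈ Icc (periodicSpectrum q (2 * j + 1)) (periodicSpectrum q (2 * j + 2))) :
    2 ≤ (-1) ^ (j + 1) * (hillDisc (potentialLift q) x).re := by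
  have hV := intervalIntegrable_potentialLift q
  have hpos := h.neg_one_pow_mul_pos (differentiable_hillDisc_re hV)
    (fun x => deriv_hillDisc_ne_zero hV) j x
    ⟨(h.zero_lt j).trans_le hx.1, hx.2.trans_lt (h.lt_succ j)⟩
  have habs : 2 ≤ |(hillDisc (potentialLift q) x).re| := by
    rcases hx.1.eq_or_lt with e | h1
    · rw [← e]; exact (h.abs_eq _).ge
    rcases hx.2.eq_or_lt with e | h2
    · rw [e]; exact (h.abs_eq _).ge
    · exact (h.two_lt_abs j x ⟨h1, h2⟩).le
  rwa [← abs_of_pos hpos, abs_mul, abs_pow, abs_neg, abs_one, one_pow, one_mul]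

/-- The actions on all levels are moments of one nonnegative density on the gap, which is parametrized
by `τ + (γ / 2) cos θ`: the contour integral collapses onto the gap and is integrated by parts there.
In a collapsed gap the density is zero. -/
lemma exists_density (j : ℕ) : ∃ k : ℝ → ℝ, Continuous k ∧ (∀ θ ∈ Icc 0 Real.pi, 0 ≤ k θ) ∧
    ∀ m : ℕ, actionJ q (j + 1) m = ((∫ θ in (0 : ℝ)..Real.pi,
      (gapMid q (j + 1) + gapLength q (j + 1) / 2 * Real.cos θ) ^ m * k θ : ℝ) : ℂ) := by
  have hV := intervalIntegrable_potentialLift q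
  obtain ⟨c, hc, hprod⟩ := exists_hillDisc_sq_sub_four_eq q h
  set D : ℝ → ℝ := fun x => (hillDisc (potentialLift q) x).re with hD
  set τ := gapMid q (j + 1) with hτ
  set L := gapLength q (j + 1) / 2 with hL
  have hL0 : 0 ≤ L := by have := gapLength_nonneg q h j; positivity
  have ha : τ - L = periodicSpectrum q (2 * j + 1) := by
    rw [hτ, hL, gapMid_succ, gapLength_succ]; ring
  have hb : τ + L = periodicSpectrum q (2 * j + 2) := by
    rw [hτ, hL, gapMid_succ, gapLength_succ]; ring
  have hstrip : ∀ x ∈ Icc (τ - L) (τ + L), (x : ℂ) ∈ gapStrip q j := fun x hx =>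
    ofReal_mem_gapStrip q h (by rwa [ha, hb] at hx)
  -- the sign of the discriminant on the gap, and of the imaginary part of the reduced root
  set ε : ℝ := (-1) ^ (j + 1) with hε
  have hεε : ε * ε = 1 := by rw [hε, ← mul_pow]; norm_num
  set P : ℝ → ℝ := fun x => ε * ((reducedRoot q j x).im / 2) with hPdef
  have hPred : ∀ x ∈ Icc (τ - L) (τ + L), 0 < P x ∧
      reducedRoot q j x = 2 * Complex.I * ((ε * P x : ℝ) : ℂ) := by
    intro x hx
    obtain ⟨p, hp, e⟩ := reducedRoot_ofReal q h (hstrip x hx)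
    have e1 : reducedRoot q j x = 2 * Complex.I * ((ε * p : ℝ) : ℂ) := by
      rw [e, hε]; push_cast; ring
    have e2 : P x = p := by
      rw [hPdef]
      simp only
      have e3 : (2 * Complex.I * ((ε * p : ℝ) : ℂ)).im = 2 * (ε * p) := by simp
      rw [e1, e3]
      linear_combination p * hεε
    rw [e2]
    exact ⟨hp, e1⟩
  have hPc : ContinuousOn P (Icc (τ - L) (τ + L)) := by
    have := (differentiableOn_reducedRoot q h j).continuousOn.comp
      Complex.continuous_ofReal.continuousOn hstrip
    exact continuousOn_const.mul ((Complex.continuous_im.comp_continuousOn this).div_const 2)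
  have hDd : Differentiable ℝ D := differentiable_hillDisc_re hV
  have hdiff := differentiable_hillDisc hV
  have hdiff' : Differentiable ℂ (deriv (hillDisc (potentialLift q))) := fun z =>
    (hdiff.analyticAt z).deriv.differentiableAt
  have hD'c : Continuous (deriv D) := by
    have e : deriv D = fun x : ℝ => (deriv (hillDisc (potentialLift q)) x).re := by
      funext x
      rw [deriv_hillDisc_ofReal hV x, Complex.ofReal_re]
    rw [e]
    exact Complex.continuous_re.comp (hdiff'.continuous.comp Complex.continuous_ofReal)
  have hD2 : ∀ x ∈ Icc (τ - L) (τ + L), 2 ≤ ε * D x := fun x hx =>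
    two_le_neg_one_pow_mul_hillDisc q h (by rwa [ha, hb] at hx)
  have hsq : ∀ x ∈ Icc (τ - L) (τ + L),
      (ε * D x) ^ 2 - 4 = c * (P x ^ 2 * ((x - (τ - L)) * (τ + L - x))) := by
    intro x hx
    have e := hprod j x (hstrip x hx)
    rw [hillDisc_ofReal_eq hV x, (hPred x hx).2, ← ha, ← hb] at e
    change (D x : ℂ) ^ 2 - 4 = _ at e
    have e2 : ((D x ^ 2 - 4 : ℝ) : ℂ) =
        ((-c * (ε * P x) ^ 2 * ((τ - L - x) * (τ + L - x)) : ℝ) : ℂ) := by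
      push_cast
      push_cast at e
      rw [e]
      linear_combination (c : ℂ) * (ε * P x) ^ 2 * ((τ - L - x) * (τ + L - x)) * Complex.I_sq
    have e3 := Complex.ofReal_injective e2
    linear_combination e3 + (D x ^ 2 + c * P x ^ 2 * ((x - (τ - L)) * (τ + L - x))) * hεε
  have hX : ∀ θ : ℝ, τ + L * Real.cos θ ∈ Icc (τ - L) (τ + L) := fun θ =>
    ⟨by nlinarith [Real.neg_one_le_cos θ], by nlinarith [Real.cos_le_one θ]⟩
  have hcontX : Continuous fun θ : ℝ => ε * D (τ + L * Real.cos θ) / 2 :=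
    (continuous_const.mul (hDd.continuous.comp (by fun_prop))).div_const 2
  refine ⟨fun θ => √c / Real.pi * (L * Real.sin θ *
    Real.arcosh (ε * D (τ + L * Real.cos θ) / 2)), ?_, ?_, fun m => ?_⟩
  · refine continuous_const.mul (Continuous.mul (by fun_prop) ?_)
    refine Real.continuousOn_arcosh.comp_continuous hcontX fun θ => ?_
    have := hD2 _ (hX θ)
    rw [mem_Ici]; linarith
  · intro θ hθ
    have h1 := Real.sin_nonneg_of_mem_Icc hθ
    have h2 : 0 ≤ Real.arcosh (ε * D (τ + L * Real.cos θ) / 2) :=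
      Real.arcosh_nonneg (by linarith [hD2 _ (hX θ)])
    have := Real.pi_pos
    positivity
  have hparts := integral_pow_mul_deriv_div (u := fun x => ε * D x) (u' := fun x => ε * deriv D x)
    hL0 hc (fun x _ => (hDd x).hasDerivAt.const_mul ε) (continuousOn_const.mul hD'c.continuousOn)
    hPc (fun x hx => (hPred x hx).1) hD2 hsq (fun hL' => by
      have h1 : periodicSpectrum q (2 * j + 1) = τ := by rw [← ha, hL', sub_zero]
      have h2 : periodicSpectrum q (2 * j + 2) = τ := by rw [← hb, hL', add_zero]
      have := h.deriv_eq j (h1.trans h2.symm)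
      rw [h1] at this
      rw [this, mul_zero]) m
  -- the part of the integrand that is analytic inside the contour
  set g : ℂ → ℂ := fun z => z ^ (m + 1) * deriv (hillDisc (potentialLift q)) z / reducedRoot q j z
    with hg
  have hsub := closedBall_subset_gapStrip q h j
  have hgd : DifferentiableOn ℂ g (gapStrip q j) :=
    (((differentiable_id.pow (m + 1)).mul hdiff').differentiableOn).div
      (differentiableOn_reducedRoot q h j) fun z hz => reducedRoot_ne_zero q h hz
  have hr := half_gapLength_lt_circuitRadius q h j
  have hrpos : 0 < circuitRadius q (j + 1) := hL0.trans_lt hr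
  have hgdc : DiffContOnCl ℂ g (Metric.ball (τ : ℂ) (circuitRadius q (j + 1))) := by
    refine DifferentiableOn.diffContOnCl ?_
    rw [closure_ball _ hrpos.ne']
    exact hgd.mono hsub
  have hcircle := circleIntegral_div_root (gapLength_nonneg q h j) hr hgdc
  have hcongr : (∮ z in C((τ : ℂ), circuitRadius q (j + 1)),
      z ^ (m + 1) * deriv (discriminant q) z / canonicalRoot q z) =
      ∮ z in C((τ : ℂ), circuitRadius q (j + 1)), g z / (((τ : ℂ) - z) *
        principalRoot (1 - (gapLength q (j + 1) : ℂ) ^ 2 / (4 * ((τ : ℂ) - z) ^ 2))) := by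
    refine circleIntegral.integral_congr hrpos.le fun z hz => ?_
    have hz' := hsub (Metric.sphere_subset_closedBall hz)
    change z ^ (m + 1) * deriv (discriminant q) z / canonicalRoot q z = _
    rw [canonicalRoot_eq_mul q h hz', standardRoot, discriminant_eq, hg]
    simp only
    rw [div_div, mul_comm (reducedRoot q j z)]
  have hgx : ∀ θ : ℝ, g ((τ + L * Real.cos θ : ℝ) : ℂ) = ((ε * ((τ + L * Real.cos θ) ^ (m + 1) *
      deriv D (τ + L * Real.cos θ) / P (τ + L * Real.cos θ)) : ℝ) : ℂ) * (2 * Complex.I)⁻¹ := by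
    intro θ
    obtain ⟨hp, e⟩ := hPred _ (hX θ)
    have hεinv : ε⁻¹ = ε := inv_eq_of_mul_eq_one_left hεε
    rw [hg]
    simp only
    rw [e, deriv_hillDisc_ofReal hV, mul_comm (2 * Complex.I), ← div_div,
      div_eq_mul_inv _ (2 * Complex.I)]
    congr 1
    rw [← Complex.ofReal_pow, ← Complex.ofReal_mul, ← Complex.ofReal_div]
    congr 1
    rw [← div_div, div_eq_mul_inv _ ε, hεinv]
    ring
  rw [actionJ, ← hτ, hcongr, hcircle]
  simp only [← hL, hgx]
  have hm : (m : ℝ) + 1 ≠ 0 := by positivity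
  have hpi := Real.pi_ne_zero
  rw [intervalIntegral.integral_mul_const, intervalIntegral.integral_ofReal]
  have e1 : ∀ θ : ℝ, ε * ((τ + L * Real.cos θ) ^ (m + 1) * deriv D (τ + L * Real.cos θ) /
      P (τ + L * Real.cos θ)) = (τ + L * Real.cos θ) ^ (m + 1) * (ε * deriv D (τ + L * Real.cos θ)) /
      P (τ + L * Real.cos θ) := fun θ => by ring
  have e2 : ∀ θ : ℝ, (τ + L * Real.cos θ) ^ m * (√c / Real.pi * (L * Real.sin θ *
      Real.arcosh (ε * D (τ + L * Real.cos θ) / 2))) = √c / Real.pi * ((τ + L * Real.cos θ) ^ m *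
      (L * Real.sin θ * Real.arcosh (ε * D (τ + L * Real.cos θ) / 2))) := fun θ => by ring
  simp only [e1, e2]
  rw [hparts, intervalIntegral.integral_const_mul]
  have hmc : (m : ℂ) + 1 ≠ 0 := by exact_mod_cast hm
  have hpic : (Real.pi : ℂ) ≠ 0 := by exact_mod_cast hpi
  push_cast
  field_simp

omit h in
lemma actionI_eq_actionJ_zero (n : ℕ) : actionI q n = actionJ q n 0 := by
  simp only [actionI, actionJ, Nat.cast_zero, zero_add, one_mul, pow_one]

end GapIntegral

/-- Bounds on the weight of an integral against a nonnegative density. -/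
lemma integral_mul_mem_Icc {a b A B : ℝ} (hab : a ≤ b) {w k : ℝ → ℝ} (hw : Continuous w)
    (hk : Continuous k) (hk0 : ∀ x ∈ Icc a b, 0 ≤ k x) (hA : ∀ x, A ≤ w x) (hB : ∀ x, w x ≤ B) :
    A * (∫ x in a..b, k x) ≤ ∫ x in a..b, w x * k x ∧
      ∫ x in a..b, w x * k x ≤ B * ∫ x in a..b, k x := by
  have hi : ∀ s : ℝ, IntervalIntegrable (fun x => s * k x) volume a b := fun s =>
    (hk.const_mul s).intervalIntegrable _ _
  have hwk := (hw.mul hk).intervalIntegrable (μ := volume) a b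
  rw [← intervalIntegral.integral_const_mul, ← intervalIntegral.integral_const_mul]
  exact ⟨intervalIntegral.integral_mono_on hab (hi A) hwk fun x hx =>
      mul_le_mul_of_nonneg_right (hA x) (hk0 x hx),
    intervalIntegral.integral_mono_on hab hwk (hi B) fun x hx =>
      mul_le_mul_of_nonneg_right (hB x) (hk0 x hx)⟩

end

theorem mainTheorem8 (q : Potential) (hq : ∫ x, q x = 0) (n m : ℕ) (hn : 1 ≤ n) :
    ((actionI q n).im = 0 ∧ (actionJ q n m).im = 0) ∧
    (4 * ‖q‖ ≤ (n : ℝ) →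
      ((2 : ℝ) ^ m)⁻¹ * ((n : ℝ) * Real.pi) ^ (2 * m) * (actionI q n).re ≤ (actionJ q n m).re ∧
      (actionJ q n m).re ≤ (2 : ℝ) ^ m * ((n : ℝ) * Real.pi) ^ (2 * m) * (actionI q n).re) ∧
    ((n : ℝ) < 4 * ‖q‖ →
      -((5 : ℝ) ^ m * ‖q‖ ^ (2 * m) * (actionI q n).re) ≤ (actionJ q n m).re ∧
      (actionJ q n m).re ≤ (256 : ℝ) ^ m * ‖q‖ ^ (2 * m) * (actionI q n).re) := by
  obtain ⟨κ, h⟩ := exists_spectrumData_periodicSpectrum q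
  obtain ⟨j, rfl⟩ : ∃ j, n = j + 1 := ⟨n - 1, by omega⟩
  obtain ⟨k, hkc, hk0, hk⟩ := exists_density q h j
  have hL := gapLength_nonneg q h j
  -- every point of integration lies in the gap
  have hX : ∀ θ : ℝ, eigMinus q (j + 1) ≤
      gapMid q (j + 1) + gapLength q (j + 1) / 2 * Real.cos θ ∧
      gapMid q (j + 1) + gapLength q (j + 1) / 2 * Real.cos θ ≤ eigPlus q (j + 1) := by
    intro θ
    have h1 := mul_le_mul_of_nonneg_left (Real.cos_le_one θ) hL
    have h2 := mul_le_mul_of_nonneg_left (Real.neg_one_le_cos θ) hL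
    rw [gapMid]
    rw [gapLength] at h1 h2 ⊢
    constructor <;> linarith
  have hXc : Continuous fun θ : ℝ =>
      (gapMid q (j + 1) + gapLength q (j + 1) / 2 * Real.cos θ) ^ m := by fun_prop
  rw [actionI_eq_actionJ_zero, hk 0, hk m, Complex.ofReal_re, Complex.ofReal_re]
  simp only [pow_zero, one_mul]
  refine ⟨⟨Complex.ofReal_im _, Complex.ofReal_im _⟩, fun hcase => ?_, fun hcase => ?_⟩
  · obtain ⟨ha, hb⟩ := eigenvalue_bounds_of_le q hn hcase
    refine integral_mul_mem_Icc Real.pi_pos.le hXc hkc hk0 (fun θ => ?_) (fun θ => ?_)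
    · rw [pow_mul, ← inv_pow, ← mul_pow]
      refine pow_le_pow_left₀ (by positivity) ?_ m
      linarith [(hX θ).1]
    · rw [pow_mul, ← mul_pow]
      refine pow_le_pow_left₀ ?_ ((hX θ).2.trans hb) m
      have : 0 ≤ (((j + 1 : ℕ) : ℝ) * Real.pi) ^ 2 := sq_nonneg _
      linarith [(hX θ).1]
  · obtain ⟨ha, hb⟩ := eigenvalue_bounds_of_lt q hn hcase
    rw [← neg_mul]
    have hQ : 0 ≤ ‖q‖ ^ 2 := sq_nonneg _
    refine integral_mul_mem_Icc Real.pi_pos.le hXc hkc hk0 (fun θ => ?_) (fun θ => ?_)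
    · rw [pow_mul, ← mul_pow]
      have hx1 := (hX θ).1
      set x := gapMid q (j + 1) + gapLength q (j + 1) / 2 * Real.cos θ
      rcases le_total 0 x with hx | hx
      · exact (neg_nonpos.2 (by positivity)).trans (pow_nonneg hx m)
      · refine (neg_le_neg (pow_le_pow_left₀ (neg_nonneg.2 hx)
          (show -x ≤ 5 * ‖q‖ ^ 2 by linarith) m)).trans ?_
        rw [← abs_of_nonpos hx, ← abs_pow]
        exact neg_abs_le _
    · rw [pow_mul, ← mul_pow]
      refine (le_abs_self _).trans ?_
      rw [abs_pow]
      refine pow_le_pow_left₀ (abs_nonneg _) (abs_le.2 ⟨?_, (hX θ).2.trans hb⟩) m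
      linarith [(hX θ).1]
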